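/- **Setting.** Let $\mathscr W$ be the set of symmetric measurable functions $[0,1]^2\to[0,1]$ modulo a.e. equality, with the cut distance $d_\square(h_1,h_2)=\sup_{S,T}\left|\int_{S\times T}(h_1-h_2)\right|$, the supremum over measurable $S,T\subseteq[0,1]$. Let $\tilde{\mathscr W}$ be its quotient by measure-preserving bijections of $[0,1]$ (relabelling), with $\delta_\square(\tilde h_1,\tilde h_2)$ the infimum of $d_\square$ over representatives, and write $\tilde h$ for the class of $h$. Let $\mathcal M([0,1])$ be the set of probability measures on $[0,1]$, identified with their distribution functions, with a metric inducing weak convergence. Let $\gamma>0$, and let $\lambda,\mu\ge 0$ be Lipschitz functions of $(t,u,v,F,\tilde h)\in[0,1]\times[0,1]^2\times\mathcal M([0,1])\times\tilde{\mathscr W}$ that are symmetric in $(u,v)$. **Process.** For $n\ge1$ let $(G_n(t))_{t\in[0,1]}$ be the random graph process on $n$ vertices that starts from the empty graph and evolves as follows. Every vertex has an independent rate-$\gamma$ Poisson clock; when the clock of $v$ rings, all edges at $v$ become inactive. The age $X_v(t)$ is the time since the clock of $v$ last rang (since time $0$ if it has not rung), and $F_n(t;\cdot)$ is the empirical distribution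 of the ages. An inactive edge $ij$ becomes active at rate $\lambda(t,X_i(t),X_j(t),F_n(t;\cdot),\tilde h^{G_n(t)})$, and an active edge $ij$ becomes inactive at rate $\mu(t,X_i(t),X_j(t),F_n(t;\cdot),\tilde h^{G_n(t)})$, where $h^{G}(x,y)=1$ if $\lceil nx\rceil$ and $\lceil ny\rceil$ are adjacent in $G$ and $h^G(x,y)=0$ otherwise. The vertices are labelled dynamically by increasing age: at every time $t$ the vertices with labels $1,\dots,n$ satisfy $X_1(t)\le\dots\le X_n(t)$, with ties broken in any way for which $t\mapsto h^{G_n(t)}$ is a random càdlàg path in $(\mathscr W,d_\square)$. **Limit.** Let $F^*(t;\cdot)\in\mathcal M([0,1])$ be given by $F^*(t;x)=1-e^{-\gamma x}$ if $x<t$ and $F^*(t;x)=1$ otherwise. For $F=F^*$ let $\bar F(t;x)=\inf\{z\in[0,1]:F(t;z)>x\}$ for $x\in[0,1)$, and $\bar F(t;1)=\inf\{z\in[0,1]:F(t;z)=1\}$. For $0\le s\le t$ let $x_s=F(s;\bar F(t;x)-(t-s))$ and $y_s=F(s;\bar F(t;y)-(t-s))$, and put $a=\bar F(t;x)\wedge\bar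 F(t;y)$. A path $t\mapsto g(t)\in\mathscr W$ solves the graphon equation if it has representatives $g(t;x,y)\in[0,1]$ with $g(0;\cdot,\cdot)=0$ such that, for all $t,x,y\in[0,1]$, one has $g(t;x,y)=g(t;x_t,y_t)$, the function $\varphi(s)=g(s;x_s,y_s)$ on $[t-a,t]$ satisfies $\varphi(t-a)=0$, and $$\varphi'(s)=(1-\varphi(s))\,\lambda\big(s,\bar F(s;x_s),\bar F(s;y_s),F(s;\cdot),\tilde g(s)\big)-\varphi(s)\,\mu\big(s,\bar F(s;x_s),\bar F(s;y_s),F(s;\cdot),\tilde g(s)\big)$$ for all $s\in[t-a,t]$. **Claim.** The graphon equation has exactly one solution $g^{(F^*)}$, this solution is a càdlàg path in $(\mathscr W,d_\square)$, and $$(h^{G_n(t)})_{t\in[0,1]}\Rightarrow g^{(F^*)}\qquad(n\to\infty)$$ in distribution on $D((\mathscr W,d_\square),[0,1])$ with the Skorokhod topology. -/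

import Mathlib

open Set Filter Topology MeasureTheory ProbabilityTheory unitInterval
open scoped ENNReal NNReal

noncomputable section

namespace AgeGraphon

/-! ### Graphons, the cut distance and unlabelled graphons -/

/-- The space `𝒲`: symmetric measurable functions `[0,1]² → [0,1]` modulo a.e. equality. -/
def Graphon : Type :=
  {h : (I × I) →ₘ[(volume : Measure (I × I))] I // ∀ᵐ p : I × I, h p.swap = h p}

instance : CoeFun Graphon (fun _ => I × I → I) := ⟨fun h => h.1⟩

/-- Cut distance: supremum over measurable `S, T ⊆ [0,1]` of `|∫_{S × T} (h₁ - h₂)|`. -/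
def cutDist (h₁ h₂ : Graphon) : ℝ :=
  ⨆ R : {S : Set I // MeasurableSet S} × {T : Set I // MeasurableSet T},
    |∫ p in (R.1 : Set I) ×ˢ (R.2 : Set I), ((h₁ p : ℝ) - (h₂ p : ℝ))|

lemma integrable_graphon (h : Graphon) (μ : Measure (I × I)) [IsFiniteMeasure μ]
    (hμ : μ ≪ volume) : Integrable (fun p => (h p : ℝ)) μ := by
  have hm : AEStronglyMeasurable (fun p => (h p : ℝ)) μ :=
    (continuous_subtype_val.comp_aestronglyMeasurable h.1.aestronglyMeasurable).mono_ac hμ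
  refine Integrable.of_bound hm 1 (ae_of_all _ fun p => ?_)
  rw [Real.norm_eq_abs, abs_of_nonneg (h p).2.1]
  exact (h p).2.2

lemma integrableOn_graphon (h : Graphon) (A : Set (I × I)) :
    IntegrableOn (fun p => (h p : ℝ)) A volume :=
  (integrable_graphon h volume Measure.AbsolutelyContinuous.rfl).integrableOn

lemma cutDist_bddAbove (h₁ h₂ : Graphon) :
    BddAbove (range fun R : {S : Set I // MeasurableSet S} × {T : Set I // MeasurableSet T} =>
      |∫ p in (R.1 : Set I) ×ˢ (R.2 : Set I), ((h₁ p : ℝ) - (h₂ p : ℝ))|) := by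
  refine ⟨1, ?_⟩
  rintro _ ⟨R, rfl⟩
  have := norm_setIntegral_le_of_norm_le_const (μ := (volume : Measure (I × I)))
    (s := (R.1 : Set I) ×ˢ (R.2 : Set I)) (f := fun p => (h₁ p : ℝ) - (h₂ p : ℝ)) (C := 1)
    (measure_lt_top _ _) (fun p _ => by
      rw [Real.norm_eq_abs, abs_le]
      constructor <;> linarith [(h₁ p).2.1, (h₁ p).2.2, (h₂ p).2.1, (h₂ p).2.2])
  rw [Real.norm_eq_abs] at this
  refine this.trans ?_
  rw [one_mul]
  exact measureReal_le_one

/-- `(𝒲, d_□)`. -/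
instance : PseudoMetricSpace Graphon where
  dist := cutDist
  dist_self h := by simp [cutDist]
  dist_comm h₁ h₂ := by
    unfold cutDist
    congr 1
    funext R
    rw [← abs_neg, ← integral_neg]
    simp
  dist_triangle h₁ h₂ h₃ := by
    have : Nonempty ({S : Set I // MeasurableSet S} × {T : Set I // MeasurableSet T}) :=
      ⟨⟨⟨∅, MeasurableSet.empty⟩, ⟨∅, MeasurableSet.empty⟩⟩⟩
    refine ciSup_le fun R => ?_
    have e : (∫ p in (R.1 : Set I) ×ˢ (R.2 : Set I), ((h₁ p : ℝ) - (h₃ p : ℝ))) =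
        (∫ p in (R.1 : Set I) ×ˢ (R.2 : Set I), ((h₁ p : ℝ) - (h₂ p : ℝ))) +
        (∫ p in (R.1 : Set I) ×ˢ (R.2 : Set I), ((h₂ p : ℝ) - (h₃ p : ℝ))) := by
      rw [← integral_add]
      · simp
      · exact (integrableOn_graphon h₁ _).sub (integrableOn_graphon h₂ _)
      · exact (integrableOn_graphon h₂ _).sub (integrableOn_graphon h₃ _)
    rw [e]
    exact (abs_add_le _ _).trans
      (add_le_add (le_ciSup (cutDist_bddAbove h₁ h₂) R) (le_ciSup (cutDist_bddAbove h₂ h₃) R))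

/-- `h₁ ∼ h₂` when `h₁(x,y) = h₂(σ x, σ y)` for a measure-preserving bijection `σ` of `[0,1]`. -/
def Graphon.Rel (h₁ h₂ : Graphon) : Prop :=
  ∃ s : I ≃ᵐ I, MeasurePreserving s volume volume ∧
    ∀ᵐ p : I × I, h₁ p = h₂ (s p.1, s p.2)

lemma measurePreserving_prodMap {s : I → I} (hs : MeasurePreserving s volume volume) :
    MeasurePreserving (fun p : I × I => (s p.1, s p.2)) volume volume :=
  hs.prod hs

instance graphonSetoid : Setoid Graphon where
  r := Graphon.Rel
  iseqv :=
    { refl := fun h => ⟨MeasurableEquiv.refl I, MeasurePreserving.id _, ae_of_all _ fun _ => rfl⟩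
      symm := by
        rintro h₁ h₂ ⟨s, hs, h⟩
        refine ⟨s.symm, hs.symm, ?_⟩
        have := (measurePreserving_prodMap (hs.symm)).quasiMeasurePreserving.ae h
        filter_upwards [this] with p hp
        simpa using hp.symm
      trans := by
        rintro h₁ h₂ h₃ ⟨s, hs, h⟩ ⟨s', hs', h'⟩
        refine ⟨s.trans s', hs'.comp hs, ?_⟩
        have := (measurePreserving_prodMap hs).quasiMeasurePreserving.ae h'
        filter_upwards [h, this] with p hp hp'
        rw [hp, hp']
        rfl }

/-- The quotient space of unlabelled graphons. -/
def UnlabelledGraphon : Type := Quotient graphonSetoid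

/-- The unlabelled graphon of a graphon. -/
def Graphon.unlabel (h : Graphon) : UnlabelledGraphon := Quotient.mk graphonSetoid h

/-- Cut metric `δ_□` on unlabelled graphons: the infimum of the cut distance over all
representatives, that is over all pairs `(h₁^σ₁, h₂^σ₂)`. -/
def cutMetric (a b : UnlabelledGraphon) : ℝ :=
  ⨅ p : {p : Graphon × Graphon // p.1.unlabel = a ∧ p.2.unlabel = b}, cutDist p.1.1 p.1.2

/-! ### Càdlàg paths on `[0,1]` with the Skorokhod `J₁` topology -/

/-- `D(E, [0,1])`: right-continuous paths with left limits. -/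
structure Skorokhod (E : Type*) [TopologicalSpace E] where
  toFun : I → E
  right_cont : ∀ t, ContinuousWithinAt toFun (Ici t) t
  left_lim : ∀ t, ∃ l, Tendsto toFun (𝓝[<] t) (𝓝 l)

instance {E : Type*} [TopologicalSpace E] : CoeFun (Skorokhod E) (fun _ => I → E) :=
  ⟨Skorokhod.toFun⟩

/-- Skorokhod distance: infimum, over increasing bijections `φ` of `[0,1]`, of
`max (sup_t |φ t - t|) (sup_t d(f t, g (φ t)))`. -/
instance {E : Type*} [PseudoMetricSpace E] : PseudoEMetricSpace (Skorokhod E) where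
  edist f g := ⨅ φ : I ≃o I, max (⨆ t, edist (φ t) t) (⨆ t, edist (f t) (g (φ t)))
  edist_self f := le_antisymm (iInf_le_of_le (OrderIso.refl I) (by simp)) (zero_le)
  edist_comm f g := by
    have key : ∀ f g : Skorokhod E,
        (⨅ φ : I ≃o I, max (⨆ t, edist (φ t) t) (⨆ t, edist (f t) (g (φ t)))) ≤
          ⨅ φ : I ≃o I, max (⨆ t, edist (φ t) t) (⨆ t, edist (g t) (f (φ t))) := by
      intro f g
      refine le_iInf fun φ => iInf_le_of_le φ.symm (max_le_max ?_ ?_)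
      · refine iSup_le fun t => le_iSup_of_le (φ.symm t) ?_
        rw [φ.apply_symm_apply, edist_comm]
      · refine iSup_le fun t => le_iSup_of_le (φ.symm t) ?_
        rw [φ.apply_symm_apply, edist_comm]
    exact le_antisymm (key f g) (key g f)
  edist_triangle f g h := by
    rw [ENNReal.iInf_add]
    refine le_iInf fun φ => ?_
    rw [ENNReal.add_iInf]
    refine le_iInf fun ψ => iInf_le_of_le (φ.trans ψ) (max_le ?_ ?_)
    · refine iSup_le fun t => ?_
      calc edist (φ.trans ψ t) t ≤ edist (φ t) t + edist (ψ (φ t)) (φ t) := by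
            rw [add_comm]; exact edist_triangle _ _ _
        _ ≤ _ := add_le_add
            ((le_iSup (fun t => edist (φ t) t) t).trans (le_max_left _ _))
            ((le_iSup (fun t => edist (ψ t) t) (φ t)).trans (le_max_left _ _))
    · refine iSup_le fun t => ?_
      calc edist (f t) (h (φ.trans ψ t)) ≤ edist (f t) (g (φ t)) + edist (g (φ t)) (h (ψ (φ t))) :=
            edist_triangle _ _ _
        _ ≤ _ := add_le_add
            ((le_iSup (fun t => edist (f t) (g (φ t))) t).trans (le_max_right _ _))
            ((le_iSup (fun t => edist (g t) (h (ψ t))) (φ t)).trans (le_max_right _ _))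

instance {E : Type*} [PseudoMetricSpace E] : MeasurableSpace (Skorokhod E) := borel _

instance {E : Type*} [PseudoMetricSpace E] : BorelSpace (Skorokhod E) := ⟨rfl⟩

/-! ### Distributions on `[0,1]`, rates, and the differential equation -/

/-- `d` is a metric on the probability measures on `[0,1]` inducing weak convergence. -/
def MetrizesWeak (d : ProbabilityMeasure I → ProbabilityMeasure I → ℝ) : Prop :=
  ∃ m : MetricSpace (ProbabilityMeasure I),
    m.toUniformSpace.toTopologicalSpace = ProbabilityMeasure.instTopologicalSpace ∧
    ∀ F F', m.dist F F' = d F F'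

/-- Switching rates `r(t, u, v, F, h̃)`. -/
abbrev Rate : Type :=
  I → I → I → ProbabilityMeasure I → UnlabelledGraphon → ℝ

/-- A nonnegative rate, symmetric in the types of the two endpoints, Lipschitz on
`[0,1] × [0,1]² × ℳ([0,1]) × 𝒲̃`, where `ℳ([0,1])` carries the metric `d`. -/
structure IsRate (d : ProbabilityMeasure I → ProbabilityMeasure I → ℝ) (r : Rate) : Prop where
  nonneg : ∀ t u v F h, 0 ≤ r t u v F h
  symm : ∀ t u v F h, r t u v F h = r t v u F h
  lipschitz : ∃ L : ℝ, ∀ t t' u u' v v' F F' h h',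
    |r t u v F h - r t' u' v' F' h'| ≤
      L * (dist t t' + dist u u' + dist v v' + d F F' + cutMetric h h')

/-- The point of `[0,1]` closest to a real number (the identity on `[0,1]`). -/
def clamp (r : ℝ) : I := Set.projIcc 0 1 zero_le_one r

/-- Distribution function `F(r) = F((-∞, r])`, as a number in `[0,1]`. -/
def distFun (F : ProbabilityMeasure I) (r : ℝ) : I :=
  clamp ((F {z : I | (z : ℝ) ≤ r} : ℝ≥0) : ℝ)

/-- Right-continuous generalised inverse `F̄(x) = inf {z ∈ [0,1] : F(z) > x}` for `x < 1`,
extended to `x = 1` by its left limit `inf {z : F(z) = 1}`. -/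
def quantile (F : ProbabilityMeasure I) (x : I) : I :=
  sInf {z : I | x < distFun F z ∨ distFun F z = 1}

/-- The label at time `s ≤ t` of the vertex which at time `t` has label `x`, when vertices are
labelled by increasing age: `F(s; F̄(t; x) - (t - s))`. With `s = t - dt` this is `x'`. -/
def originLabel (F : I → ProbabilityMeasure I) (t x : I) (s : ℝ) : I :=
  distFun (F (clamp s)) ((quantile (F t) x : ℝ) - ((t : ℝ) - s))

/-- Time elapsed, at time `t`, since the last clock ring at either of the vertices with labels
`x` and `y`: the smaller of their two ages. -/
def minAge (F : I → ProbabilityMeasure I) (t x y : I) : ℝ :=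
  min (quantile (F t) x : ℝ) (quantile (F t) y : ℝ)

/-- `g` (pointwise functions `g t x y`, with class `gcl t` in `𝒲`) solves the equation
`g(0) = 0`,
`g(t+dt; x, y) = g(t; x', y') + dt (1 - g(t; x', y')) λ[t, F̄(t;x'), F̄(t;y'), F(t), g̃(t)]
  - dt g(t; x', y') μ[t, F̄(t;x'), F̄(t;y'), F(t), g̃(t)]`
along the motion `dt ↦ (x', y')` of the labels, started from `0` when an endpoint has age `0`. -/
structure SolvesPointwise (lam mu : Rate) (F : I → ProbabilityMeasure I)
    (g : I → I → I → I) (gcl : I → Graphon) : Prop where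
  /-- `gcl t` is the graphon of `g t`. -/
  graphon : ∀ t, ∀ᵐ p : I × I, gcl t p = g t p.1 p.2
  initial : ∀ x y, g 0 x y = 0
  /-- Labels at which the age is the same are not distinguished (the equation with `dt = 0`). -/
  label : ∀ t x y, g t x y = g t (originLabel F t x t) (originLabel F t y t)
  /-- An edge is absent at the moment at which one of its endpoints has age `0`. -/
  birth : ∀ t x y, g (clamp (t - minAge F t x y))
    (originLabel F t x (t - minAge F t x y)) (originLabel F t y (t - minAge F t x y)) = 0
  /-- The differential equation while both endpoints are alive. -/
  deriv : ∀ t x y : I, ∀ s ∈ Icc ((t : ℝ) - minAge F t x y) t,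
    HasDerivWithinAt
      (fun r : ℝ => (g (clamp r) (originLabel F t x r) (originLabel F t y r) : ℝ))
      ((1 - (g (clamp s) (originLabel F t x s) (originLabel F t y s) : ℝ)) *
          lam (clamp s) (quantile (F (clamp s)) (originLabel F t x s))
            (quantile (F (clamp s)) (originLabel F t y s)) (F (clamp s)) (gcl (clamp s)).unlabel
        - (g (clamp s) (originLabel F t x s) (originLabel F t y s) : ℝ) *
          mu (clamp s) (quantile (F (clamp s)) (originLabel F t x s))
            (quantile (F (clamp s)) (originLabel F t y s)) (F (clamp s)) (gcl (clamp s)).unlabel)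
      (Icc ((t : ℝ) - minAge F t x y) t) s

/-- The path of graphons `gcl` is (the class of) a solution of the equation driven by `F`. -/
def SolvesGraphonEquation (lam mu : Rate) (F : I → ProbabilityMeasure I)
    (gcl : I → Graphon) : Prop :=
  ∃ g : I → I → I → I, SolvesPointwise lam mu F g gcl

/-! ### The random graph process -/

/-- Poisson clocks: one for every vertex, and for every pair of vertices one that proposes to
switch the edge on and one that proposes to switch it off. -/
inductive Clock (n : ℕ) : Type
  | vertex (v : Fin n)
  | on (e : Sym2 (Fin n))
  | off (e : Sym2 (Fin n))

/-- Rates of the clocks: `γ` for vertices, `C` for the two clocks of a pair. -/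
def Clock.rate {n : ℕ} (γ C : ℝ) : Clock n → ℝ
  | .vertex _ => γ
  | .on _ => C
  | .off _ => C

/-- Ring times of a clock; `z k` is the `k`-th waiting time together with a mark. -/
def ringTime (z : ℕ → ℝ × ℝ) (k : ℕ) : ℝ := ∑ i ∈ Finset.range (k + 1), (z i).1

/-- `t - max {τ_k : τ_k ≤ t} ∨ 0`, the time since the clock last rang. -/
def age (z : ℕ → ℝ × ℝ) (t : I) : I :=
  clamp (t - sSup ({0} ∪ {τ : ℝ | τ ≤ t ∧ ∃ k, ringTime z k = τ}))

/-- The type (age) of vertex `v` at time `t`. -/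
def vertexAge {n : ℕ} (z : Clock n → ℕ → ℝ × ℝ) (t : I) (v : Fin n) : I :=
  age (z (.vertex v)) t

/-- Empirical measure of finitely many points of `[0,1]`. -/
def empirical {n : ℕ} [NeZero n] (X : Fin n → I) : ProbabilityMeasure I :=
  ⟨(n : ℝ≥0∞)⁻¹ • ∑ v, Measure.dirac (X v), ⟨by
    simp [ENNReal.inv_mul_cancel (Nat.cast_ne_zero.mpr (NeZero.ne n)) (ENNReal.natCast_ne_top n)]⟩⟩

/-- The block containing `x`: `⌈n x⌉`, shifted because labels start at `0` here. -/
def block (n : ℕ) [NeZero n] (x : I) : Fin n :=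
  ⟨⌈(n : ℝ) * x⌉₊ - 1, by
    have h1 : ⌈(n : ℝ) * x⌉₊ ≤ n := Nat.ceil_le.mpr (mul_le_of_le_one_right (Nat.cast_nonneg n) x.2.2)
    have h2 := NeZero.pos n
    omega⟩

lemma measurable_block (n : ℕ) [NeZero n] : Measurable (block n) := by
  refine measurable_to_countable' fun k => ?_
  have hm : Measurable (fun x : I => ⌈(n : ℝ) * x⌉₊) :=
    Nat.measurable_ceil.comp (measurable_subtype_coe.const_mul _)
  have : block n ⁻¹' {k} = (fun x : I => ⌈(n : ℝ) * x⌉₊) ⁻¹' {m | m - 1 = (k : ℕ)} := by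
    ext x
    simp [block, Fin.ext_iff]
  rw [this]
  exact hm (MeasurableSet.of_discrete)

open Classical in
/-- Empirical graphon of a graph with labels: `1` on the block `(i, j)` if `ij` is an edge. -/
def empiricalGraphon {n : ℕ} [NeZero n] (H : SimpleGraph (Fin n)) : Graphon :=
  ⟨AEEqFun.mk (fun p : I × I => if H.Adj (block n p.1) (block n p.2) then (1 : I) else 0)
      (((measurable_of_finite
          (fun q : Fin n × Fin n => if H.Adj q.1 q.2 then (1 : I) else 0)).comp
        (((measurable_block n).comp measurable_fst).prodMk
          ((measurable_block n).comp measurable_snd))).aestronglyMeasurable), by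
    have h := AEEqFun.coeFn_mk
      (μ := (volume : Measure (I × I)))
      (fun p : I × I => if H.Adj (block n p.1) (block n p.2) then (1 : I) else 0)
      (((measurable_of_finite
          (fun q : Fin n × Fin n => if H.Adj q.1 q.2 then (1 : I) else 0)).comp
        (((measurable_block n).comp measurable_fst).prodMk
          ((measurable_block n).comp measurable_snd))).aestronglyMeasurable)
    have h' := (Measure.measurePreserving_swap
      (μ := (volume : Measure I)) (ν := (volume : Measure I))).quasiMeasurePreserving.ae h
    filter_upwards [h, h'] with p hp hp'
    rw [hp, hp']
    simp [SimpleGraph.adj_comm]⟩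

/-- `r(t, X_i(t), X_j(t), F_n(t; ·), h̃^H)` for the pair `ij`, when the current graph is `H`. -/
def currentRate {n : ℕ} [NeZero n] (r : Rate) (z : Clock n → ℕ → ℝ × ℝ) (t : I)
    (H : SimpleGraph (Fin n)) (i j : Fin n) : ℝ :=
  r t (vertexAge z t i) (vertexAge z t j) (empirical (vertexAge z t)) (empiricalGraphon H).unlabel

/-- A vertex clock rings at time `t`. -/
def VertexRings {n : ℕ} (z : Clock n → ℕ → ℝ × ℝ) (t : I) (v : Fin n) : Prop :=
  ∃ k, ringTime (z (.vertex v)) k = t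

/-- Clock `c` (of rate `C`) rings at time `t` and the proposal is accepted, its uniform mark `U`
satisfying `U ≤ ρ / C`; so proposals are accepted at rate `ρ`. -/
def Accepted {n : ℕ} (z : Clock n → ℕ → ℝ × ℝ) (C : ℝ) (t : I) (c : Clock n) (ρ : ℝ) : Prop :=
  ∃ k, ringTime (z c) k = t ∧ C * (z c k).2 ≤ ρ

/-- The graph-valued path `G` follows the dynamics driven by the clocks `z`: it starts from the
empty graph and is càdlàg; when the clock of a vertex rings all adjacent edges become inactive; an
inactive edge becomes active, resp. an active edge inactive, upon an accepted proposal, the rates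
being evaluated at the graph `H` just before. -/
structure FollowsDynamics {n : ℕ} [NeZero n] (lam mu : Rate) (C : ℝ)
    (z : Clock n → ℕ → ℝ × ℝ) (G : I → SimpleGraph (Fin n)) : Prop where
  initial : G 0 = ⊥
  right_cont : ∀ t, ∀ᶠ s in 𝓝[>] t, G s = G t
  jump : ∀ t : I, 0 < t → ∃ H : SimpleGraph (Fin n), (∀ᶠ s in 𝓝[<] t, G s = H) ∧
    ∀ i j, i ≠ j → ((G t).Adj i j ↔
      ¬ VertexRings z t i ∧ ¬ VertexRings z t j ∧
      ((¬ H.Adj i j ∧ Accepted z C t (.on s(i, j)) (currentRate lam z t H i j)) ∨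
        (H.Adj i j ∧ ¬ Accepted z C t (.off s(i, j)) (currentRate mu z t H i j))))

/-- `Y` is the labelled graphon process of the interacting age model on `n` vertices, realised on
the probability space `(Ω, P)` by thinning independent Poisson clocks. Here `Z c k` is the `k`-th
waiting time of clock `c` with its mark, `G` the graph process on the set of vertices, and
`lab ω t k` the vertex carrying label `k` at time `t` (dynamic labelling by increasing age). -/
structure IsLabelledGraphonProcess {Ω : Type*} [MeasurableSpace Ω] (P : Measure Ω)
    {n : ℕ} [NeZero n] (γ C : ℝ) (lam mu : Rate)
    (Z : Clock n → ℕ → Ω → ℝ × ℝ) (G : Ω → I → SimpleGraph (Fin n))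
    (lab : Ω → I → Equiv.Perm (Fin n)) (Y : Ω → Skorokhod Graphon) : Prop where
  law : ∀ c k, HasLaw (Z c k)
    ((expMeasure (c.rate γ C)).prod ((volume : Measure ℝ).restrict (Icc 0 1))) P
  indep : iIndepFun (fun p : Clock n × ℕ => Z p.1 p.2) P
  dynamics : ∀ᵐ ω ∂P, FollowsDynamics lam mu C (fun c k => Z c k ω) (G ω)
  labelling : ∀ᵐ ω ∂P, ∀ t,
    Monotone fun k => vertexAge (fun c k => Z c k ω) t (lab ω t k)
  graphon : ∀ᵐ ω ∂P, ∀ t, Y ω t = empiricalGraphon ((G ω t).comap (lab ω t))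
  measurable : AEMeasurable Y P

end AgeGraphon

end

/-!
In the limit the age of the vertex with label `x` at time `t` is `limitAge γ t x`, the quantile
function of the age of a single vertex, and following the labels `x_s` backwards in time means
following one vertex: its birth time (the time of its last clock ring) is constant along the motion
(`limitBirth_originLabel`). In terms of birth times the graphon equation is a family of ordinary
differential equations `∂ₜ U(t, b, b') = (1 - U) λ - U μ` started from `U = 0` at the time
`max b b'`, coupled through the graphon `g(t; x, y) = U(t, b_x, b_y)` in the rates. The rates are
Lipschitz in the cut distance, so the integral operator contracts in the norm weighted by
`exp (-8 K t)`. This gives a solution (`exists_isProfile`, `IsProfile.solves`), the same weight gives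
uniqueness (`SolvesGraphonEquation.unique`), and the solution is continuous in the cut distance.

The graph process is compared with an idealised process which uses the same clocks and marks, but in
which the rates are evaluated at `F*(t)` and `g(t)` in place of the empirical distribution and the
current graph (`edgeState`). Given the clocks of the vertices, its edges are independent, and by
Rényi's formula for the probability that a marked Poisson clock avoids a set (`voidProb_compare`)
the edge `ij` is present with probability `U(t, b_i, b_j)` exactly (`prob_edgeActive`,
`integral_edgeFluct_resample`). A second moment estimate for codegrees, together with the bound of
the cut norm of a matrix by its codegrees (`pow_four_integral_block_le`), shows that the idealised
graph is close in cut distance to the matrix `U(t, b_i, b_j)`. With the vertices labelled by age, the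
latter is close in `L¹` to `g(t)`, since the empirical age distribution is close to `F*(t)`
(`prob_ageDiscrepancy_gt_le`, `integral_abs_age_sub`).

As long as the graph process is within `e(s)` of `g(s)`, its rates differ from the idealised ones by
at most a multiple of `e(s)` up to a small error, because a graph and its relabellings have the same
unlabelled graphon. An edge then differs from the idealised one only if one of its proposals has a
mark within that distance of its threshold (`FollowsDynamics.adj_iff_of_not_doubtful`), and the
proportion of such edges is controlled by `∫ e(s) ds` and a law of large numbers. On a fine grid of
times this is a discrete Grönwall inequality (`GoodClocks.cutDist_le`); between grid points few
clocks ring. Hence the labelled graphons converge to `g` uniformly in time, in probability, and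
therefore in distribution on the Skorokhod space.
-/

noncomputable section

namespace AgeGraphon

/-! ### The limiting age distribution -/

lemma coe_clamp (r : ℝ) : (clamp r : ℝ) = max 0 (min 1 r) := by
  simp [clamp, Set.coe_projIcc]

lemma coe_clamp_of_mem {r : ℝ} (h : r ∈ Icc (0 : ℝ) 1) : (clamp r : ℝ) = r := by
  rw [coe_clamp, min_eq_right h.2, max_eq_right h.1]

lemma clamp_coe (t : I) : clamp (t : ℝ) = t := Subtype.ext (coe_clamp_of_mem t.2)

lemma continuous_clamp : Continuous clamp := continuous_projIcc (h := zero_le_one)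

lemma abs_clamp_sub_clamp_le (r s : ℝ) : |(clamp r : ℝ) - clamp s| ≤ |r - s| := by
  rw [coe_clamp, coe_clamp]
  refine (abs_max_sub_max_le_max _ _ _ _).trans (max_le (by simp) ?_)
  exact (abs_min_sub_min_le_max _ _ _ _).trans (max_le (by simp) le_rfl)

/-- The age `min (-log (1 - x) / γ) t` of the vertex with label `x` in the limiting age
distribution at time `t`. The label `1` is treated separately since `Real.log 0 = 0`. -/
def limitAge (γ : ℝ) (t x : I) : ℝ := if x = 1 then t else min (-Real.log (1 - x) / γ) t

section
variable {γ : ℝ}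

lemma limitAge_le (t x : I) : limitAge γ t x ≤ t := by
  unfold limitAge; split_ifs; exacts [le_rfl, min_le_right _ _]

lemma limitAge_nonneg (hγ : 0 < γ) (t x : I) : 0 ≤ limitAge γ t x := by
  unfold limitAge
  split_ifs with h
  · exact t.2.1
  · refine le_min (div_nonneg ?_ hγ.le) t.2.1
    exact neg_nonneg.2 (Real.log_nonpos (by linarith [x.2.2]) (by linarith [x.2.1]))

lemma limitAge_mem (hγ : 0 < γ) (t x : I) : limitAge γ t x ∈ Icc (0 : ℝ) 1 :=
  ⟨limitAge_nonneg hγ t x, (limitAge_le t x).trans t.2.2⟩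

lemma abs_limitAge_sub_le (s t x : I) : |limitAge γ t x - limitAge γ s x| ≤ |(t : ℝ) - s| := by
  unfold limitAge
  split_ifs
  · exact le_rfl
  · exact (abs_min_sub_min_le_max _ _ _ _).trans (max_le (by simp) le_rfl)

lemma limitAge_le_iff (hγ : 0 < γ) {t x : I} {z : ℝ} (hz : z < t) :
    limitAge γ t x ≤ z ↔ (x : ℝ) ≤ 1 - Real.exp (-γ * z) := by
  unfold limitAge
  have he := Real.exp_pos (-γ * z)
  split_ifs with h
  · subst h
    simp only [Icc.coe_one]
    constructor <;> intro h <;> linarith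
  · have hx : (x : ℝ) < 1 := lt_of_le_of_ne x.2.2 fun h' => h (Subtype.ext h')
    rw [min_le_iff, or_iff_left (not_le.2 hz), div_le_iff₀ hγ, neg_le,
      Real.le_log_iff_exp_le (by linarith), show -(z * γ) = -γ * z by ring]
    constructor <;> intro h <;> linarith

lemma lt_limitAge_iff (hγ : 0 < γ) {t x : I} {z : ℝ} (hz : z < t) :
    z < limitAge γ t x ↔ 1 - Real.exp (-γ * z) < x := by
  rw [← not_le, limitAge_le_iff hγ hz, not_le]

lemma limitAge_mono (hγ : 0 < γ) (t : I) : Monotone (limitAge γ t) := by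
  intro x y hxy
  by_contra! h
  have h1 : limitAge γ t y < t := h.trans_le (limitAge_le _ _)
  have h2 := (limitAge_le_iff hγ h1).1 (le_refl _)
  have h3 := (lt_limitAge_iff hγ h1).1 h
  exact absurd (show (x : ℝ) ≤ y from hxy) (by linarith)

/-- `limitAge` as a point of the unit interval. -/
def limitAgeI (γ : ℝ) (t x : I) : I := clamp (limitAge γ t x)

lemma coe_limitAgeI (hγ : 0 < γ) (t x : I) : (limitAgeI γ t x : ℝ) = limitAge γ t x :=
  coe_clamp_of_mem (limitAge_mem hγ t x)

lemma measurable_limitAge (hγ : 0 < γ) (t : I) : Measurable (limitAge γ t) :=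
  (limitAge_mono hγ t).measurable

lemma measurable_limitAgeI (hγ : 0 < γ) (t : I) : Measurable (limitAgeI γ t) :=
  continuous_clamp.measurable.comp (measurable_limitAge hγ t)

/-- The limiting age distribution `F*(t)`: the law of `limitAge γ t` for a uniform label. -/
def limitLaw {γ : ℝ} (hγ : 0 < γ) (t : I) : ProbabilityMeasure I :=
  ⟨(volume : Measure I).map (limitAgeI γ t),
    Measure.isProbabilityMeasure_map (measurable_limitAgeI hγ t).aemeasurable⟩

lemma limitLaw_apply (hγ : 0 < γ) (t : I) (z : ℝ) :
    ((limitLaw hγ t {y : I | (y : ℝ) ≤ z} : ℝ≥0) : ℝ) =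
      if z < 0 then 0 else if z < t then 1 - Real.exp (-γ * z) else 1 := by
  have hm : MeasurableSet {y : I | (y : ℝ) ≤ z} := measurableSet_le measurable_subtype_coe
    measurable_const
  have h0 : ((limitLaw hγ t {y : I | (y : ℝ) ≤ z} : ℝ≥0) : ℝ) =
      (volume : Measure I).real {x : I | limitAge γ t x ≤ z} := by
    change ((volume : Measure I).map (limitAgeI γ t)).real _ = _
    rw [measureReal_def, Measure.map_apply (measurable_limitAgeI hγ t) hm, measureReal_def]
    congr 2
    ext x
    simp [coe_limitAgeI hγ]
  rw [h0]
  split_ifs with h1 h2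
  · have : {x : I | limitAge γ t x ≤ z} = ∅ := by
      ext x
      simp only [mem_ofPred_eq, mem_empty_iff_false, iff_false, not_le]
      exact h1.trans_le (limitAge_nonneg hγ t x)
    simp [this]
  · have h3 : Real.exp (-γ * z) ≤ 1 := Real.exp_le_one_iff.2 (by nlinarith [not_lt.1 h1])
    have h4 : 1 - Real.exp (-γ * z) ∈ Icc (0 : ℝ) 1 :=
      ⟨by linarith, by linarith [Real.exp_pos (-γ * z)]⟩
    have : {x : I | limitAge γ t x ≤ z} = Iic ⟨1 - Real.exp (-γ * z), h4⟩ := by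
      ext x
      rw [mem_ofPred_eq, limitAge_le_iff hγ h2]
      rfl
    rw [this, measureReal_def, unitInterval.volume_Iic, ENNReal.toReal_ofReal h4.1]
  · have : {x : I | limitAge γ t x ≤ z} = univ := by
      ext x
      simpa using (limitAge_le t x).trans (not_lt.1 h2)
    simp [this]

lemma limitLaw_cdf (hγ : 0 < γ) (t x : I) :
    ((limitLaw hγ t {z : I | z ≤ x} : ℝ≥0) : ℝ) =
      if x < t then 1 - Real.exp (-γ * x) else 1 := by
  have := limitLaw_apply hγ t x
  rw [if_neg (not_lt.2 x.2.1)] at this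
  exact this

lemma coe_distFun_limitLaw (hγ : 0 < γ) (t : I) {z : ℝ} (hz : 0 ≤ z) :
    (distFun (limitLaw hγ t) z : ℝ) = if z < t then 1 - Real.exp (-γ * z) else 1 := by
  have h := limitLaw_apply hγ t z
  rw [if_neg (not_lt.2 hz)] at h
  unfold distFun
  rw [h, coe_clamp_of_mem]
  split_ifs
  · exact ⟨by linarith [Real.exp_le_one_iff.2 (show -γ * z ≤ 0 by nlinarith)],
      by linarith [Real.exp_pos (-γ * z)]⟩
  · simp

/-- The quantile function of `F*(t)`, including at the label `1` where its definition differs. -/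
lemma quantile_limitLaw (hγ : 0 < γ) (t x : I) :
    (quantile (limitLaw hγ t) x : ℝ) = limitAge γ t x := by
  rw [← coe_limitAgeI hγ]
  congr 1
  have key : ∀ z : I, (x < distFun (limitLaw hγ t) z ∨ distFun (limitLaw hγ t) z = 1) ↔
      (t ≤ z ∨ limitAgeI γ t x < z) := by
    intro z
    have h := coe_distFun_limitLaw hγ t z.2.1
    by_cases hz : (z : ℝ) < t
    · rw [if_pos hz] at h
      have h1 : distFun (limitLaw hγ t) z ≠ 1 := by
        intro h'
        rw [h'] at h
        simp only [Icc.coe_one] at h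
        linarith [Real.exp_pos (-γ * z)]
      have h2 : ¬ t ≤ z := not_le.2 hz
      rw [or_iff_left h1, or_iff_right h2, ← Subtype.coe_lt_coe, h, ← Subtype.coe_lt_coe,
        coe_limitAgeI hγ]
      by_cases hx1 : x = 1
      · subst hx1
        constructor
        · intro h; simp only [Icc.coe_one] at h; linarith [Real.exp_pos (-γ * z)]
        · intro h; simp [limitAge] at h; exact absurd h (not_lt.2 (le_of_lt hz))
      · have hx : (x : ℝ) < 1 := lt_of_le_of_ne x.2.2 fun h' => hx1 (Subtype.ext h')
        rw [limitAge, if_neg hx1, min_lt_iff, or_iff_left (not_lt.2 hz.le), div_lt_iff₀ hγ,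
          neg_lt, Real.lt_log_iff_exp_lt (by linarith), show -((z : ℝ) * γ) = -γ * z by ring]
        constructor <;> intro h <;> linarith
    · rw [if_neg hz] at h
      have h1 : distFun (limitLaw hγ t) z = 1 := Subtype.ext h
      simp [h1, show t ≤ z from not_lt.1 hz]
  have hle : (limitAgeI γ t x) ≤ t := by
    rw [← Subtype.coe_le_coe, coe_limitAgeI hγ]; exact limitAge_le t x
  unfold quantile
  simp_rw [key]
  apply le_antisymm
  · rcases hle.eq_or_lt with h | h
    · rw [h]; exact sInf_le (Or.inl le_rfl)
    · exact le_of_forall_gt_imp_ge_of_dense fun z hz => sInf_le (Or.inr hz)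
  · refine le_sInf ?_
    rintro z (h | h)
    · exact hle.trans h
    · exact h.le

lemma limitAge_distFun (hγ : 0 < γ) (s : I) {u : ℝ} (h0 : 0 ≤ u) (hu : u ≤ s) :
    limitAge γ s (distFun (limitLaw hγ s) u) = u := by
  have h := coe_distFun_limitLaw hγ s h0
  rcases hu.eq_or_lt with rfl | hu
  · rw [if_neg (lt_irrefl _)] at h
    rw [show distFun (limitLaw hγ s) s = 1 from Subtype.ext h]
    simp [limitAge]
  · rw [if_pos hu] at h
    have h1 : distFun (limitLaw hγ s) u ≠ 1 := by
      intro h'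
      rw [h'] at h
      simp only [Icc.coe_one] at h
      linarith [Real.exp_pos (-γ * u)]
    rw [limitAge, if_neg h1, h, sub_sub_cancel, Real.log_exp]
    rw [show -(-γ * u) / γ = u by field_simp, min_eq_left hu.le]

/-- Following the motion of labels backwards in time decreases the age at unit speed. -/
lemma limitAge_originLabel (hγ : 0 < γ) (t x : I) {s : ℝ}
    (hs : s ∈ Icc ((t : ℝ) - limitAge γ t x) t) :
    limitAge γ (clamp s) (originLabel (limitLaw hγ) t x s) = limitAge γ t x - (t - s) := by
  have h1 := limitAge_le (γ := γ) t x
  have hs' : s ∈ Icc (0 : ℝ) 1 := ⟨by linarith [hs.1], hs.2.trans t.2.2⟩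
  unfold originLabel
  rw [quantile_limitLaw hγ]
  refine limitAge_distFun hγ _ (by linarith [hs.1]) ?_
  rw [coe_clamp_of_mem hs']
  linarith

/-- The limiting time of the last clock ring of the vertex which has label `x` at time `t`. -/
def limitBirth (γ : ℝ) (t x : I) : ℝ := t - limitAge γ t x

lemma limitBirth_mem (hγ : 0 < γ) (t x : I) : limitBirth γ t x ∈ Icc (0 : ℝ) t :=
  ⟨sub_nonneg.2 (limitAge_le t x), sub_le_self _ (limitAge_nonneg hγ t x)⟩

lemma abs_limitBirth_sub_le (s t x : I) :
    |limitBirth γ t x - limitBirth γ s x| ≤ 2 * |(t : ℝ) - s| := by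
  unfold limitBirth
  have := abs_limitAge_sub_le (γ := γ) s t x
  rw [show (t : ℝ) - limitAge γ t x - (s - limitAge γ s x) =
    (t - s) - (limitAge γ t x - limitAge γ s x) by ring]
  exact (abs_sub _ _).trans (by linarith)

lemma measurable_limitBirth (hγ : 0 < γ) (t : I) : Measurable (limitBirth γ t) :=
  measurable_const.sub (measurable_limitAge hγ t)

lemma limitBirth_originLabel (hγ : 0 < γ) (t x : I) {s : ℝ} (hs : s ∈ Icc (limitBirth γ t x) t) :
    limitBirth γ (clamp s) (originLabel (limitLaw hγ) t x s) = limitBirth γ t x := by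
  have h1 := limitBirth_mem hγ t x
  rw [limitBirth, limitAge_originLabel hγ t x hs,
    coe_clamp_of_mem ⟨h1.1.trans hs.1, hs.2.trans t.2.2⟩, limitBirth]
  ring

lemma minAge_limitLaw (hγ : 0 < γ) (t x y : I) :
    (t : ℝ) - minAge (limitLaw hγ) t x y = max (limitBirth γ t x) (limitBirth γ t y) := by
  rw [minAge, quantile_limitLaw hγ, quantile_limitLaw hγ, limitBirth, limitBirth, max_sub_sub_left]

/-- The age distribution moves continuously in the weak topology. -/
lemma continuous_limitLaw (hγ : 0 < γ) : Continuous (limitLaw hγ) := by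
  rw [continuous_iff_continuousAt]
  intro t
  rw [ContinuousAt, ProbabilityMeasure.tendsto_iff_forall_integral_tendsto]
  intro f
  have e : ∀ s : I, ∫ z, f z ∂(limitLaw hγ s : Measure I) = ∫ x : I, f (limitAgeI γ s x) :=
    fun s => integral_map (measurable_limitAgeI hγ s).aemeasurable
      f.continuous.aestronglyMeasurable
  simp_rw [e]
  refine tendsto_integral_filter_of_dominated_convergence (fun _ => ‖f‖)
    (Eventually.of_forall fun s => (f.continuous.measurable.comp
      (measurable_limitAgeI hγ s)).aestronglyMeasurable)
    (Eventually.of_forall fun s => ae_of_all _ fun x => f.norm_coe_le_norm _)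
    (integrable_const _) (ae_of_all _ fun x => ?_)
  have hc : Continuous fun s => limitAgeI γ s x := by
    refine continuous_clamp.comp ?_
    unfold limitAge
    split_ifs
    · exact continuous_subtype_val
    · exact continuous_const.min continuous_subtype_val
  exact (f.continuous.comp hc).tendsto t

end

/-! ### Estimates for the cut distance -/

/-- The graphon with a given symmetric measurable representative. -/
def graphonOf (f : I × I → I) (hf : Measurable f) (hs : ∀ p, f p.swap = f p) : Graphon :=
  ⟨AEEqFun.mk f hf.aestronglyMeasurable, by
    have h := AEEqFun.coeFn_mk (μ := (volume : Measure (I × I))) f hf.aestronglyMeasurable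
    have h' := (Measure.measurePreserving_swap
      (μ := (volume : Measure I)) (ν := (volume : Measure I))).quasiMeasurePreserving.ae h
    filter_upwards [h, h'] with p hp hp'
    rw [hp, hp', hs]⟩

lemma graphonOf_ae (f : I × I → I) (hf : Measurable f) (hs : ∀ p, f p.swap = f p) :
    ∀ᵐ p : I × I, graphonOf f hf hs p = f p :=
  AEEqFun.coeFn_mk (μ := (volume : Measure (I × I))) f hf.aestronglyMeasurable

lemma graphon_ext {h₁ h₂ : Graphon} (h : ∀ᵐ p : I × I, h₁ p = h₂ p) : h₁ = h₂ :=
  Subtype.ext (AEEqFun.ext h)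

instance : Nonempty ({S : Set I // MeasurableSet S} × {T : Set I // MeasurableSet T}) :=
  ⟨⟨⟨∅, MeasurableSet.empty⟩, ⟨∅, MeasurableSet.empty⟩⟩⟩

lemma cutDist_le {h₁ h₂ : Graphon} {c : ℝ}
    (h : ∀ S T : Set I, MeasurableSet S → MeasurableSet T →
      |∫ p in S ×ˢ T, ((h₁ p : ℝ) - (h₂ p : ℝ))| ≤ c) : cutDist h₁ h₂ ≤ c :=
  ciSup_le fun R => h R.1 R.2 R.1.2 R.2.2

lemma cutDist_le_of_ae {h₁ h₂ : Graphon} {c : ℝ}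
    (h : ∀ᵐ p : I × I, |(h₁ p : ℝ) - h₂ p| ≤ c) : cutDist h₁ h₂ ≤ c := by
  have hc : 0 ≤ c := by
    obtain ⟨p, hp⟩ := h.exists
    exact (abs_nonneg _).trans hp
  refine cutDist_le fun S T _ _ => ?_
  have := norm_setIntegral_le_of_norm_le_const_ae (μ := (volume : Measure (I × I)))
    (s := S ×ˢ T) (f := fun p => (h₁ p : ℝ) - (h₂ p : ℝ)) (C := c)
    (measure_lt_top _ _) (by filter_upwards [ae_restrict_of_ae h] with p hp using hp)
  rw [Real.norm_eq_abs] at this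
  refine this.trans ?_
  exact mul_le_of_le_one_right hc measureReal_le_one

lemma cutDist_nonneg (h₁ h₂ : Graphon) : 0 ≤ cutDist h₁ h₂ := dist_nonneg (x := h₁) (y := h₂)

lemma cutMetric_le (h₁ h₂ : Graphon) : cutMetric h₁.unlabel h₂.unlabel ≤ cutDist h₁ h₂ :=
  ciInf_le (f := fun p : {p : Graphon × Graphon //
      p.1.unlabel = h₁.unlabel ∧ p.2.unlabel = h₂.unlabel} => cutDist p.1.1 p.1.2)
    ⟨0, by rintro _ ⟨p, rfl⟩; exact cutDist_nonneg _ _⟩ ⟨(h₁, h₂), rfl, rfl⟩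

lemma cutMetric_nonneg (a b : UnlabelledGraphon) : 0 ≤ cutMetric a b :=
  Real.iInf_nonneg fun _ => cutDist_nonneg _ _

/-! ### Rates along the limiting age distribution -/

/-- What the graphon equation needs to know of a rate, once its measure argument has been
replaced by the limiting age distribution at the current time: it is nonnegative, symmetric,
bounded and Lipschitz in the graphon with constant `K`, and continuous along continuous paths
of unlabelled graphons. -/
structure TameRate (r : I → I → I → UnlabelledGraphon → ℝ) (K : ℝ) : Prop where
  nonneg : ∀ t u v h, 0 ≤ r t u v h
  symm : ∀ t u v h, r t u v h = r t v u h
  bound : ∀ t u v h, r t u v h ≤ K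
  lipschitz : ∀ t u v h h', |r t u v h - r t u v h'| ≤ K * cutMetric h h'
  cont : ∀ c : I → UnlabelledGraphon,
    (∀ t, Tendsto (fun s => cutMetric (c s) (c t)) (𝓝 t) (𝓝 0)) →
    Continuous fun p : I × I × I => r p.1 p.2.1 p.2.2 (c p.1)

lemma TameRate.mono {r : I → I → I → UnlabelledGraphon → ℝ} {K K' : ℝ} (h : TameRate r K)
    (hK : K ≤ K') : TameRate r K' where
  nonneg := h.nonneg
  symm := h.symm
  bound t u v c := (h.bound t u v c).trans hK
  lipschitz t u v c c' := (h.lipschitz t u v c c').trans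
    (mul_le_mul_of_nonneg_right hK (cutMetric_nonneg _ _))
  cont := h.cont

lemma IsRate.exists_lipschitz {d : ProbabilityMeasure I → ProbabilityMeasure I → ℝ}
    (hd : MetrizesWeak d) {r : Rate} (hr : IsRate d r) :
    ∃ L : ℝ, 0 ≤ L ∧ ∀ t t' u u' v v' F F' h h',
      |r t u v F h - r t' u' v' F' h'| ≤
        L * (dist t t' + dist u u' + dist v v' + d F F' + cutMetric h h') := by
  obtain ⟨L, hL⟩ := hr.lipschitz
  obtain ⟨m, -, hm⟩ := hd
  refine ⟨|L|, abs_nonneg _, fun t t' u u' v v' F F' h h' => (hL ..).trans ?_⟩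
  refine mul_le_mul_of_nonneg_right (le_abs_self _) ?_
  have h1 : 0 ≤ d F F' := by rw [← hm]; exact @dist_nonneg _ m.toPseudoMetricSpace _ _
  have h2 := cutMetric_nonneg h h'
  positivity

/-- The metric `d` is continuous along the limiting age distributions. -/
lemma MetrizesWeak.tendsto {d : ProbabilityMeasure I → ProbabilityMeasure I → ℝ}
    (hd : MetrizesWeak d) {α : Type*} {l : Filter α} {F : α → ProbabilityMeasure I}
    {F₀ : ProbabilityMeasure I} (h : Tendsto F l (𝓝 F₀)) :
    Tendsto (fun a => d (F a) F₀) l (𝓝 0) := by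
  obtain ⟨m, hm, hmd⟩ := hd
  have h' : @Tendsto _ _ F l (@nhds _ m.toUniformSpace.toTopologicalSpace F₀) := by
    rw [hm]; exact h
  simp_rw [← hmd]
  exact (@tendsto_iff_dist_tendsto_zero _ _ m.toPseudoMetricSpace _ _ _).1 h'

lemma MetrizesWeak.nonneg {d : ProbabilityMeasure I → ProbabilityMeasure I → ℝ}
    (hd : MetrizesWeak d) (F F' : ProbabilityMeasure I) : 0 ≤ d F F' := by
  obtain ⟨m, -, hm⟩ := hd
  rw [← hm]; exact @dist_nonneg _ m.toPseudoMetricSpace _ _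

lemma MetrizesWeak.bounded {d : ProbabilityMeasure I → ProbabilityMeasure I → ℝ}
    (hd : MetrizesWeak d) {F : I → ProbabilityMeasure I} (hF : Continuous F) :
    ∃ D, ∀ t, d (F t) (F 0) ≤ D := by
  obtain ⟨m, hm, hmd⟩ := hd
  have hF' : @Continuous _ _ _ m.toUniformSpace.toTopologicalSpace F := by rw [hm]; exact hF
  have : Continuous fun t => d (F t) (F 0) := by
    simp_rw [← hmd]
    exact @Continuous.dist _ _ m.toPseudoMetricSpace _ _ _ hF' (@continuous_const _ _ _ (_) _)
  obtain ⟨D, hD⟩ := (isCompact_range this).bddAbove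
  exact ⟨D, fun t => hD ⟨t, rfl⟩⟩

lemma IsRate.tame {d : ProbabilityMeasure I → ProbabilityMeasure I → ℝ}
    (hd : MetrizesWeak d) {r : Rate} (hr : IsRate d r) {F : I → ProbabilityMeasure I}
    (hF : Continuous F) : ∃ K, TameRate (fun t u v h => r t u v (F t) h) K := by
  obtain ⟨L, hL0, hL⟩ := hr.exists_lipschitz hd
  obtain ⟨D, hD⟩ := hd.bounded hF
  set h₀ : UnlabelledGraphon := (graphonOf (fun _ => 0) measurable_const (fun _ => rfl)).unlabel
  have hself : ∀ F, d F F = 0 := by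
    obtain ⟨m, -, hm⟩ := hd
    intro F; rw [← hm]; exact @dist_self _ m.toPseudoMetricSpace F
  have hd1 : ∀ s t : I, dist s t ≤ 1 := fun s t => by
    rw [Subtype.dist_eq, Real.dist_eq, abs_le]
    constructor <;> linarith [s.2.1, s.2.2, t.2.1, t.2.2]
  have hcm : ∀ h h', cutMetric h h' ≤ 1 := by
    intro h h'
    induction h using Quotient.inductionOn with | _ h
    induction h' using Quotient.inductionOn with | _ h'
    refine (cutMetric_le h h').trans (cutDist_le_of_ae (ae_of_all _ fun p => ?_))
    rw [abs_le]
    constructor <;> linarith [(h p).2.1, (h p).2.2, (h' p).2.1, (h' p).2.2]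
  refine ⟨|r 0 0 0 (F 0) h₀| + L * (4 + D) + L, ?_, ?_, ?_, ?_, ?_⟩
  · exact fun t u v h => hr.nonneg ..
  · exact fun t u v h => hr.symm ..
  · intro t u v h
    have h1 := hL t 0 u 0 v 0 (F t) (F 0) h h₀
    have h2 : L * (dist t 0 + dist u 0 + dist v 0 + d (F t) (F 0) + cutMetric h h₀) ≤
        L * (4 + D) := by
      refine mul_le_mul_of_nonneg_left ?_ hL0
      linarith [hd1 t 0, hd1 u 0, hd1 v 0, hD t, hcm h h₀]
    have h3 := (abs_le.1 (h1.trans h2)).2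
    have h4 := le_abs_self (r 0 0 0 (F 0) h₀)
    linarith
  · intro t u v h h'
    have h1 := hL t t u u v v (F t) (F t) h h'
    simp only [dist_self, hself, zero_add] at h1
    refine h1.trans (mul_le_mul_of_nonneg_right ?_ (cutMetric_nonneg _ _))
    have : 0 ≤ D := (hd.nonneg _ _).trans (hD 0)
    have := abs_nonneg (r 0 0 0 (F 0) h₀)
    nlinarith
  · intro c hc
    rw [continuous_iff_continuousAt]
    intro p
    rw [ContinuousAt, tendsto_iff_dist_tendsto_zero]
    have hlim : Tendsto (fun q : I × I × I => L * (dist q.1 p.1 + dist q.2.1 p.2.1 +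
        dist q.2.2 p.2.2 + d (F q.1) (F p.1) + cutMetric (c q.1) (c p.1))) (𝓝 p) (𝓝 0) := by
      have e : (0 : ℝ) = L * (dist p.1 p.1 + dist p.2.1 p.2.1 + dist p.2.2 p.2.2 + 0 + 0) := by
        simp
      rw [show 𝓝 (0 : ℝ) = 𝓝 (L * (dist p.1 p.1 + dist p.2.1 p.2.1 + dist p.2.2 p.2.2 + 0 + 0))
        from congrArg _ e]
      have hfst : Tendsto (fun q : I × I × I => q.1) (𝓝 p) (𝓝 p.1) := continuous_fst.tendsto p
      refine Tendsto.const_mul L (((Tendsto.add (Tendsto.add ?_ ?_) ?_).add ?_).add ?_)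
      · exact (Continuous.dist continuous_fst continuous_const).tendsto p
      · exact (Continuous.dist (by fun_prop) continuous_const).tendsto p
      · exact (Continuous.dist (by fun_prop) continuous_const).tendsto p
      · exact hd.tendsto ((hF.tendsto p.1).comp hfst)
      · exact (hc p.1).comp hfst
    refine squeeze_zero (fun _ => dist_nonneg) (fun q => ?_) hlim
    rw [Real.dist_eq]
    exact hL ..

/-! ### Existence and uniqueness for the graphon equation -/

/-- The right-hand side `(1 - a) λ - a μ` is Lipschitz in all its arguments. -/
lemma abs_field_sub_le {a a' l l' m m' K δ : ℝ} (ha : a ∈ Icc (0 : ℝ) 1)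
    (hl' : 0 ≤ l') (hlK : l' ≤ K) (hm' : 0 ≤ m') (hmK : m' ≤ K) (hK : 0 ≤ K)
    (h1 : |l - l'| ≤ K * δ) (h2 : |m - m'| ≤ K * δ) (h3 : |a - a'| ≤ δ) :
    |((1 - a) * l - a * m) - ((1 - a') * l' - a' * m')| ≤ 4 * K * δ := by
  have e : ((1 - a) * l - a * m) - ((1 - a') * l' - a' * m') =
      (1 - a) * (l - l') + (-a) * (m - m') + (-(l' + m')) * (a - a') := by ring
  have hδ : 0 ≤ δ := (abs_nonneg _).trans h3
  have hKδ : 0 ≤ K * δ := mul_nonneg hK hδ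
  rw [e]
  refine (abs_add_three _ _ _).trans ?_
  rw [abs_mul, abs_mul, abs_mul, abs_neg, abs_neg, abs_of_nonneg ha.1,
    abs_of_nonneg (sub_nonneg.2 ha.2), abs_of_nonneg (add_nonneg hl' hm')]
  have b1 : (1 - a) * |l - l'| ≤ (1 - a) * (K * δ) :=
    mul_le_mul_of_nonneg_left h1 (sub_nonneg.2 ha.2)
  have b2 : a * |m - m'| ≤ a * (K * δ) := mul_le_mul_of_nonneg_left h2 ha.1
  have b3 : (l' + m') * |a - a'| ≤ (2 * K) * δ :=
    mul_le_mul (by linarith) h3 (abs_nonneg _) (by linarith)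
  nlinarith

/-- A function which starts at a nonnegative value and does not decrease while negative stays
nonnegative. -/
lemma nonneg_of_deriv_nonneg_of_neg {f f' : ℝ → ℝ} {a b : ℝ} (hab : a ≤ b)
    (hf : ∀ s, HasDerivAt f (f' s) s) (ha : 0 ≤ f a)
    (h : ∀ s ∈ Icc a b, f s < 0 → 0 ≤ f' s) : 0 ≤ f b := by
  by_contra! hb
  have hc : Continuous f := continuous_iff_continuousAt.2 fun s => (hf s).continuousAt
  have hcomp : IsCompact (Icc a b ∩ f ⁻¹' Ici 0) :=
    isCompact_Icc.inter_right (isClosed_Ici.preimage hc)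
  obtain ⟨s₀, ⟨hs₀, hs₀'⟩, hmax⟩ := hcomp.exists_isGreatest ⟨a, ⟨le_rfl, hab⟩, ha⟩
  have hmono : MonotoneOn f (Icc s₀ b) := by
    refine monotoneOn_of_deriv_nonneg (convex_Icc _ _) hc.continuousOn
      (fun s _ => (hf s).differentiableAt.differentiableWithinAt) fun s hs => ?_
    rw [interior_Icc] at hs
    rw [(hf s).deriv]
    have hsI : s ∈ Icc a b := ⟨hs₀.1.trans hs.1.le, hs.2.le⟩
    refine h s hsI ?_
    by_contra! hn
    exact absurd (hmax ⟨hsI, hn⟩) (not_le.2 hs.1)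
  have := hmono ⟨le_rfl, hs₀.2⟩ ⟨hs₀.2, le_rfl⟩ hs₀.2
  exact absurd (lt_of_le_of_lt this hb) (not_lt.2 hs₀')

section
variable {γ : ℝ} (hγ : 0 < γ)

/-- A continuous function of the time and the birth times of two vertices, made symmetric in the
latter by ordering them and cut off outside `[0,1]`. -/
def cutOff (V : C(I × I × I, ℝ)) (t b b' : ℝ) : I :=
  clamp (V (clamp t, clamp (min b b'), clamp (max b b')))

lemma continuous_cutOff (V : C(I × I × I, ℝ)) :
    Continuous fun p : ℝ × ℝ × ℝ => cutOff V p.1 p.2.1 p.2.2 := by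
  unfold cutOff
  have := continuous_clamp
  fun_prop

lemma cutOff_symm (V : C(I × I × I, ℝ)) (t b b' : ℝ) : cutOff V t b b' = cutOff V t b' b := by
  unfold cutOff; rw [min_comm, max_comm]

/-- The path of graphons in which the value at two labels is a function of the birth times that
these labels have under the limiting age distribution. -/
def birthGraphon (V : C(I × I × I, ℝ)) (t : I) : Graphon :=
  graphonOf (fun p => cutOff V t (limitBirth γ t p.1) (limitBirth γ t p.2))
    ((continuous_cutOff V).measurable.comp (measurable_const.prodMk
      (((measurable_limitBirth hγ t).comp measurable_fst).prodMk
        ((measurable_limitBirth hγ t).comp measurable_snd))))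
    fun _ => cutOff_symm V _ _ _

lemma birthGraphon_ae (V : C(I × I × I, ℝ)) (t : I) : ∀ᵐ p : I × I, birthGraphon hγ V t p =
    cutOff V t (limitBirth γ t p.1) (limitBirth γ t p.2) :=
  graphonOf_ae _ _ _

lemma abs_cutOff_sub_le (V V' : C(I × I × I, ℝ)) (t b b' : ℝ) {δ : ℝ}
    (h : ∀ b b', |V (clamp t, b, b') - V' (clamp t, b, b')| ≤ δ) :
    |(cutOff V t b b' : ℝ) - cutOff V' t b b'| ≤ δ :=
  (abs_clamp_sub_clamp_le _ _).trans (h _ _)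

lemma cutDist_birthGraphon_le (V V' : C(I × I × I, ℝ)) (t : I) {δ : ℝ}
    (h : ∀ b b', |V (t, b, b') - V' (t, b, b')| ≤ δ) :
    cutDist (birthGraphon hγ V t) (birthGraphon hγ V' t) ≤ δ := by
  refine cutDist_le_of_ae ?_
  filter_upwards [birthGraphon_ae hγ V t, birthGraphon_ae hγ V' t] with p h1 h2
  rw [h1, h2]
  exact abs_cutOff_sub_le _ _ _ _ _ (by rwa [clamp_coe])

/-- A path of graphons given by a continuous function of time and the limiting birth times is
continuous. -/
lemma continuous_of_birth (hγ : 0 < γ) {g : I → Graphon} {U : ℝ → ℝ → ℝ → ℝ}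
    (hU : Continuous fun p : ℝ × ℝ × ℝ => U p.1 p.2.1 p.2.2)
    (hg : ∀ t, ∀ᵐ p : I × I, (g t p : ℝ) = U t (limitBirth γ t p.1) (limitBirth γ t p.2)) :
    Continuous g := by
  have huc := (isCompact_Icc (a := ((0 : ℝ), (0 : ℝ), (0 : ℝ)))
    (b := (1, 1, 1))).uniformContinuousOn_of_continuous hU.continuousOn
  rw [Metric.uniformContinuousOn_iff_le] at huc
  rw [Metric.continuous_iff]
  intro t ε hε
  obtain ⟨δ, hδ, h⟩ := huc (ε / 2) (half_pos hε)
  refine ⟨δ / 2, half_pos hδ, fun s hs => ?_⟩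
  refine lt_of_le_of_lt (cutDist_le_of_ae ?_) (half_lt_self hε)
  have hmem : ∀ r x y : I, ((r : ℝ), limitBirth γ r x, limitBirth γ r y) ∈
      Icc ((0 : ℝ), (0 : ℝ), (0 : ℝ)) (1, 1, 1) := fun r x y =>
    have h1 := limitBirth_mem hγ r x
    have h2 := limitBirth_mem hγ r y
    ⟨⟨r.2.1, h1.1, h2.1⟩, ⟨r.2.2, h1.2.trans r.2.2, h2.2.trans r.2.2⟩⟩
  filter_upwards [hg s, hg t] with p h1 h2
  rw [h1, h2, ← Real.dist_eq]
  refine h _ (hmem _ _ _) _ (hmem _ _ _) ?_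
  rw [Subtype.dist_eq, Real.dist_eq] at hs
  have b1 := abs_limitBirth_sub_le (γ := γ) t s p.1
  have b2 := abs_limitBirth_sub_le (γ := γ) t s p.2
  have := abs_nonneg ((s : ℝ) - t)
  simp only [Prod.dist_eq, Real.dist_eq]
  exact max_le (by linarith) (max_le (by linarith) (by linarith))

lemma continuous_birthGraphon (V : C(I × I × I, ℝ)) : Continuous (birthGraphon hγ V) := by
  refine continuous_of_birth hγ (U := fun t b b' => cutOff V t b b')
    (continuous_subtype_val.comp (continuous_cutOff V)) fun t => ?_
  filter_upwards [birthGraphon_ae hγ V t] with p hp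
  rw [hp]

lemma tendsto_cutMetric_of_continuous {g : I → Graphon} (hg : Continuous g) (t : I) :
    Tendsto (fun s => cutMetric (g s).unlabel (g t).unlabel) (𝓝 t) (𝓝 0) :=
  squeeze_zero (fun _ => cutMetric_nonneg _ _) (fun s => cutMetric_le (g s) (g t))
    (tendsto_iff_dist_tendsto_zero.1 (hg.tendsto t))

variable {l m : I → I → I → UnlabelledGraphon → ℝ} {K : ℝ}

/-- The right-hand side of the graphon equation in terms of the birth times of two vertices. -/
def birthField (l m : I → I → I → UnlabelledGraphon → ℝ) (V : C(I × I × I, ℝ))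
    (p : I × I × I) : ℝ :=
  (1 - clamp (V p)) * l p.1 (clamp (p.1 - p.2.1)) (clamp (p.1 - p.2.2))
      (birthGraphon hγ V p.1).unlabel -
    clamp (V p) * m p.1 (clamp (p.1 - p.2.1)) (clamp (p.1 - p.2.2))
      (birthGraphon hγ V p.1).unlabel

lemma TameRate.continuous_birth {r : I → I → I → UnlabelledGraphon → ℝ} (hr : TameRate r K)
    {g : I → Graphon} (hg : Continuous g) : Continuous fun p : I × I × I =>
      r p.1 (clamp (p.1 - p.2.1)) (clamp (p.1 - p.2.2)) (g p.1).unlabel := by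
  have hc := continuous_clamp
  exact (hr.cont _ (tendsto_cutMetric_of_continuous hg)).comp
    (g := fun p : I × I × I => r p.1 p.2.1 p.2.2 (g p.1).unlabel)
    (f := fun p : I × I × I => (p.1, clamp (p.1 - p.2.1), clamp (p.1 - p.2.2)))
    (by fun_prop)

lemma continuous_birthField (hl : TameRate l K) (hm : TameRate m K) (V : C(I × I × I, ℝ)) :
    Continuous (birthField hγ l m V) := by
  have h1 := hl.continuous_birth (continuous_birthGraphon hγ V)
  have h2 := hm.continuous_birth (continuous_birthGraphon hγ V)
  have hc := continuous_clamp
  have h3 : Continuous fun p : I × I × I => (clamp (V p) : ℝ) :=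
    continuous_subtype_val.comp (hc.comp V.continuous)
  exact ((continuous_const.sub h3).mul h1).sub (h3.mul h2)

/-- The integral operator of which the solution of the graphon equation is the fixed point:
the field is integrated from the time at which the younger vertex was born. -/
def birthIntegral (hl : TameRate l K) (hm : TameRate m K) (V : C(I × I × I, ℝ)) :
    C(I × I × I, ℝ) where
  toFun p := ∫ s in (max p.2.1 p.2.2 : ℝ)..max p.1 (max p.2.1 p.2.2 : ℝ),
    birthField hγ l m V (clamp s, p.2)
  continuous_toFun := by
    have hF : Continuous (Function.uncurry fun (p : I × I × I) (s : ℝ) =>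
        birthField hγ l m V (clamp s, p.2)) := by
      have h := continuous_birthField hγ hl hm V
      have hc := continuous_clamp
      unfold Function.uncurry
      fun_prop
    have hI : ∀ (p : I × I × I) (a b : ℝ), IntervalIntegrable
        (fun s => birthField hγ l m V (clamp s, p.2)) volume a b := fun p a b =>
      (hF.comp (Continuous.prodMk_right p)).intervalIntegrable a b
    have e : (fun p : I × I × I => ∫ s in (max p.2.1 p.2.2 : ℝ)..max p.1 (max p.2.1 p.2.2 : ℝ),
        birthField hγ l m V (clamp s, p.2)) = fun p =>
        (∫ s in (0 : ℝ)..max p.1 (max p.2.1 p.2.2 : ℝ), birthField hγ l m V (clamp s, p.2)) -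
        ∫ s in (0 : ℝ)..(max p.2.1 p.2.2 : ℝ), birthField hγ l m V (clamp s, p.2) := by
      funext p
      rw [intervalIntegral.integral_interval_sub_left (hI _ _ _) (hI _ _ _)]
    rw [e]
    exact (intervalIntegral.continuous_parametric_intervalIntegral_of_continuous hF
      (by fun_prop)).sub (intervalIntegral.continuous_parametric_intervalIntegral_of_continuous hF
      (by fun_prop))

lemma intervalIntegrable_birthField (hl : TameRate l K) (hm : TameRate m K)
    (V : C(I × I × I, ℝ)) (q : I × I) (a b : ℝ) :
    IntervalIntegrable (fun s => birthField hγ l m V (clamp s, q)) volume a b :=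
  ((continuous_birthField hγ hl hm V).comp
    (continuous_clamp.prodMk continuous_const)).intervalIntegrable a b

lemma abs_birthField_sub_le (hl : TameRate l K) (hm : TameRate m K) (hK : 0 ≤ K)
    (V V' : C(I × I × I, ℝ)) (p : I × I × I) {δ : ℝ}
    (h : ∀ b b', |V (p.1, b, b') - V' (p.1, b, b')| ≤ δ) :
    |birthField hγ l m V p - birthField hγ l m V' p| ≤ 4 * K * δ := by
  have hc : cutMetric (birthGraphon hγ V p.1).unlabel (birthGraphon hγ V' p.1).unlabel ≤ δ :=
    (cutMetric_le _ _).trans (cutDist_birthGraphon_le hγ V V' p.1 h)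
  exact abs_field_sub_le (clamp (V p)).2 (hl.nonneg ..) (hl.bound ..) (hm.nonneg ..)
    (hm.bound ..) hK ((hl.lipschitz ..).trans (mul_le_mul_of_nonneg_left hc hK))
    ((hm.lipschitz ..).trans (mul_le_mul_of_nonneg_left hc hK))
    ((abs_clamp_sub_clamp_le _ _).trans (h p.2.1 p.2.2))

/-- The integral operator halves distances in the norm weighted by `exp (-8 K t)`, since the field is
Lipschitz with constant `4 K`. -/
lemma abs_birthIntegral_sub_le (hl : TameRate l K) (hm : TameRate m K) (hK : 0 < K)
    (V V' : C(I × I × I, ℝ)) {D : ℝ}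
    (h : ∀ p, |V p - V' p| ≤ D * Real.exp (8 * K * p.1)) (p : I × I × I) :
    |birthIntegral hγ hl hm V p - birthIntegral hγ hl hm V' p| ≤
      D / 2 * Real.exp (8 * K * p.1) := by
  have hD : 0 ≤ D := by
    have := (abs_nonneg _).trans (h p)
    exact nonneg_of_mul_nonneg_left this (Real.exp_pos _)
  change |(∫ s in (max p.2.1 p.2.2 : ℝ)..max p.1 (max p.2.1 p.2.2 : ℝ), _) -
    ∫ s in (max p.2.1 p.2.2 : ℝ)..max p.1 (max p.2.1 p.2.2 : ℝ), _| ≤ _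
  rw [← intervalIntegral.integral_sub (intervalIntegrable_birthField hγ hl hm V _ _ _)
    (intervalIntegrable_birthField hγ hl hm V' _ _ _)]
  rcases le_total (p.1 : ℝ) (max p.2.1 p.2.2 : ℝ) with hle | hle
  · rw [max_eq_right hle, intervalIntegral.integral_same, abs_zero]
    positivity
  rw [max_eq_left hle]
  have hder : ∀ s : ℝ, HasDerivAt (fun s => D / 2 * Real.exp (8 * K * s))
      (4 * K * (D * Real.exp (8 * K * s))) s := fun s => by
    have h1 : HasDerivAt (fun s : ℝ => 8 * K * s) (8 * K) s := by
      simpa using (hasDerivAt_id s).const_mul (8 * K)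
    convert! h1.exp.const_mul (D / 2) using 1
    ring
  have hint : ∫ s in (max p.2.1 p.2.2 : ℝ)..p.1, 4 * K * (D * Real.exp (8 * K * s)) =
      D / 2 * Real.exp (8 * K * p.1) - D / 2 * Real.exp (8 * K * (max p.2.1 p.2.2 : ℝ)) :=
    intervalIntegral.integral_eq_sub_of_hasDerivAt (fun s _ => hder s)
      (Continuous.intervalIntegrable (by fun_prop) _ _)
  have := intervalIntegral.norm_integral_le_of_norm_le (μ := volume) hle
    (f := fun s => birthField hγ l m V (clamp s, p.2) - birthField hγ l m V' (clamp s, p.2))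
    (g := fun s => 4 * K * (D * Real.exp (8 * K * s)))
    (ae_of_all _ fun s hs => by
      have h0 : s ∈ Icc (0 : ℝ) 1 := ⟨(le_max_of_le_left p.2.1.2.1).trans hs.1.le,
        hs.2.trans p.1.2.2⟩
      refine abs_birthField_sub_le hγ hl hm hK.le V V' _ fun b b' => ?_
      simpa [coe_clamp_of_mem h0] using h (clamp s, b, b'))
    (Continuous.intervalIntegrable (by fun_prop) _ _)
  rw [hint] at this
  refine this.trans (sub_le_self _ (by positivity))

/-- The fixed point is found by Banach's theorem for the norm weighted by `exp (-8 K t)`. -/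
lemma exists_birthIntegral_fixed (hl : TameRate l K) (hm : TameRate m K) (hK : 0 < K) :
    ∃ V, birthIntegral hγ hl hm V = V := by
  let w : C(I × I × I, ℝ) := ⟨fun p => Real.exp (8 * K * p.1), by fun_prop⟩
  let w' : C(I × I × I, ℝ) := ⟨fun p => Real.exp (-(8 * K * p.1)), by fun_prop⟩
  have hww : ∀ p, w p * w' p = 1 := fun p => by
    change Real.exp _ * Real.exp _ = 1
    rw [← Real.exp_add]; simp
  let T : C(I × I × I, ℝ) → C(I × I × I, ℝ) := fun W => w' * birthIntegral hγ hl hm (w * W)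
  have hT : ContractingWith (1 / 2 : ℝ≥0) T := by
    refine ⟨by
      rw [div_lt_iff₀ two_pos]; norm_num, LipschitzWith.of_dist_le_mul fun W W' => ?_⟩
    rw [ContinuousMap.dist_le (by positivity)]
    intro p
    have h := abs_birthIntegral_sub_le hγ hl hm hK (w * W) (w * W') (D := dist W W') (fun q => by
      rw [ContinuousMap.mul_apply, ContinuousMap.mul_apply, ← mul_sub, abs_mul, mul_comm]
      have : |w q| = Real.exp (8 * K * q.1) := abs_of_pos (Real.exp_pos _)
      rw [this]
      refine mul_le_mul_of_nonneg_right ?_ (Real.exp_pos _).le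
      rw [← Real.dist_eq]
      exact ContinuousMap.dist_apply_le_dist q) p
    change |w' p * _ - w' p * _| ≤ _
    rw [← mul_sub, abs_mul, abs_of_pos (show 0 < w' p from Real.exp_pos _)]
    calc w' p * _ ≤ w' p * (dist W W' / 2 * w p) :=
          mul_le_mul_of_nonneg_left h (Real.exp_pos _).le
      _ = (w p * w' p) * (dist W W' / 2) := by ring
      _ = _ := by rw [hww]; simp; ring
  have hfix := hT.fixedPoint_isFixedPt
  set W := ContractingWith.fixedPoint T hT
  refine ⟨w * W, ?_⟩
  have h2 : w * T W = w * W := congrArg _ hfix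
  rw [← h2]
  ext p
  have h3 : (w * T W) p = (w p * w' p) * birthIntegral hγ hl hm (w * W) p := by
    change w p * (w' p * _) = _
    rw [mul_assoc]
  rw [h3, hww, one_mul, h2]

/-- The solution of the graphon equation in terms of birth times: `U t b b'` is the probability
that at time `t` there is an edge between two vertices whose clocks last rang at the times `b` and
`b'`, and `g` is the corresponding path of graphons. -/
structure IsProfile (γ : ℝ) (l m : I → I → I → UnlabelledGraphon → ℝ) (g : I → Graphon)
    (U : ℝ → ℝ → ℝ → ℝ) : Prop where
  cont : Continuous fun p : ℝ × ℝ × ℝ => U p.1 p.2.1 p.2.2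
  mem : ∀ t b b', U t b b' ∈ Icc (0 : ℝ) 1
  birth : ∀ b b' : I, U (max (b : ℝ) b') b b' = 0
  deriv : ∀ b b' : I, ∀ s ∈ Icc (max (b : ℝ) b') 1, HasDerivWithinAt (fun r => U r b b')
    ((1 - U s b b') * l (clamp s) (clamp (s - b)) (clamp (s - b')) (g (clamp s)).unlabel
      - U s b b' * m (clamp s) (clamp (s - b)) (clamp (s - b')) (g (clamp s)).unlabel)
    (Icc (max (b : ℝ) b') 1) s
  graphon : ∀ t, ∀ᵐ p : I × I, (g t p : ℝ) = U t (limitBirth γ t p.1) (limitBirth γ t p.2)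

lemma IsProfile.continuous (hγ : 0 < γ) {g : I → Graphon} {U : ℝ → ℝ → ℝ → ℝ}
    (h : IsProfile γ l m g U) : Continuous g := continuous_of_birth hγ h.cont h.graphon

lemma exists_isProfile (hγ : 0 < γ) (hl : TameRate l K) (hm : TameRate m K) (hK : 0 < K) :
    ∃ g U, IsProfile γ l m g U := by
  obtain ⟨V, hV⟩ := exists_birthIntegral_fixed hγ hl hm hK
  have hcont := continuous_birthField hγ hl hm V
  have hVf : ∀ (t b b' : I), (max (b : ℝ) b') ≤ t →
      V (t, b, b') = ∫ s in (max (b : ℝ) b')..t, birthField hγ l m V (clamp s, b, b') := by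
    intro t b b' h
    have := congrArg (fun W : C(I × I × I, ℝ) => W (t, b, b')) hV.symm
    refine this.trans ?_
    change ∫ s in (max (b : ℝ) b')..max t (max (b : ℝ) b'), _ = _
    rw [max_eq_left h]
  have hder : ∀ (b b' : I) (s : ℝ), HasDerivAt
      (fun r => ∫ s in (max (b : ℝ) b')..r, birthField hγ l m V (clamp s, b, b'))
      (birthField hγ l m V (clamp s, b, b')) s := by
    intro b b' s
    have hc : Continuous fun s => birthField hγ l m V (clamp s, b, b') :=
      hcont.comp (continuous_clamp.prodMk continuous_const)
    exact intervalIntegral.integral_hasDerivAt_right (hc.intervalIntegrable _ _)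
      (hc.stronglyMeasurableAtFilter _ _) hc.continuousAt
  have hb0 : ∀ b b' : I, (0 : ℝ) ≤ max (b : ℝ) b' := fun b b' => le_max_of_le_left b.2.1
  -- Outside `[0,1]` the cut-off makes the field point back towards `[0,1]`.
  have hmem : ∀ (t b b' : I), (max (b : ℝ) b') ≤ t → V (t, b, b') ∈ Icc (0 : ℝ) 1 := by
    intro t b b' h
    have hs : ∀ s ∈ Icc (max (b : ℝ) b') t, V (clamp s, b, b') =
        ∫ r in (max (b : ℝ) b')..s, birthField hγ l m V (clamp r, b, b') := by
      intro s hs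
      have hc := coe_clamp_of_mem ⟨(hb0 b b').trans hs.1, hs.2.trans t.2.2⟩
      rw [hVf (clamp s) b b' (by rw [hc]; exact hs.1), hc]
    have ht := hVf t b b' h
    constructor
    · rw [ht]
      refine nonneg_of_deriv_nonneg_of_neg
        (f := fun t => ∫ s in (max (b : ℝ) b')..t, birthField hγ l m V (clamp s, b, b')) h
        (hder b b') (by simp) fun s hsI hneg => ?_
      rw [← hs s hsI] at hneg
      have : (clamp (V (clamp s, b, b')) : ℝ) = 0 := by
        rw [coe_clamp, max_eq_left]
        exact min_le_of_right_le hneg.le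
      simp only [birthField, this]
      simpa using hl.nonneg _ _ _ _
    · rw [ht, ← sub_nonneg]
      refine nonneg_of_deriv_nonneg_of_neg
        (f := fun t => 1 - ∫ s in (max (b : ℝ) b')..t, birthField hγ l m V (clamp s, b, b')) h
        (fun s => (hder b b' s).const_sub 1) (by simp) fun s hsI hneg => ?_
      rw [← hs s hsI] at hneg
      have : (clamp (V (clamp s, b, b')) : ℝ) = 1 := by
        rw [coe_clamp, min_eq_left (by linarith), max_eq_right zero_le_one]
      simp only [birthField, this]
      simpa using hm.nonneg _ _ _ _
  have hcut : ∀ (t : ℝ) (b b' : I), t ∈ Icc (max (b : ℝ) b') 1 → b ≤ b' →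
      (cutOff V t b b' : ℝ) = V (clamp t, b, b') := by
    intro t b b' ht hbb
    unfold cutOff
    rw [min_eq_left (show (b : ℝ) ≤ b' from hbb), max_eq_right (show (b : ℝ) ≤ b' from hbb),
      clamp_coe, clamp_coe, coe_clamp_of_mem]
    refine hmem _ _ _ ?_
    rw [coe_clamp_of_mem ⟨(hb0 b b').trans ht.1, ht.2⟩]
    exact ht.1
  have hbirth : ∀ b b' : I, b ≤ b' → (cutOff V (max (b : ℝ) b') b b' : ℝ) = 0 := by
    intro b b' hbb
    have h1 : (max (b : ℝ) b') ≤ 1 := max_le b.2.2 b'.2.2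
    rw [hcut _ b b' ⟨le_rfl, h1⟩ hbb, hVf, coe_clamp_of_mem ⟨hb0 b b', h1⟩]
    · simp
    · rw [coe_clamp_of_mem ⟨hb0 b b', h1⟩]
  have hderiv : ∀ b b' : I, b ≤ b' → ∀ s ∈ Icc (max (b : ℝ) b') 1,
      HasDerivWithinAt (fun r => (cutOff V r b b' : ℝ))
      ((1 - cutOff V s b b') * l (clamp s) (clamp (s - b)) (clamp (s - b'))
        (birthGraphon hγ V (clamp s)).unlabel - cutOff V s b b' * m (clamp s) (clamp (s - b))
        (clamp (s - b')) (birthGraphon hγ V (clamp s)).unlabel) (Icc (max (b : ℝ) b') 1) s := by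
    intro b b' hbb s hs
    have hcs : ∀ r ∈ Icc (max (b : ℝ) b') 1, (clamp r : ℝ) = r := fun r hr =>
      coe_clamp_of_mem ⟨(hb0 b b').trans hr.1, hr.2⟩
    have he : birthField hγ l m V (clamp s, b, b') = (1 - cutOff V s b b') *
        l (clamp s) (clamp (s - b)) (clamp (s - b')) (birthGraphon hγ V (clamp s)).unlabel -
        cutOff V s b b' * m (clamp s) (clamp (s - b)) (clamp (s - b'))
        (birthGraphon hγ V (clamp s)).unlabel := by
      have : (clamp (V (clamp s, b, b')) : ℝ) = cutOff V s b b' := by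
        unfold cutOff
        rw [min_eq_left (show (b : ℝ) ≤ b' from hbb), max_eq_right (show (b : ℝ) ≤ b' from hbb),
          clamp_coe, clamp_coe]
      simp only [birthField, this, hcs s hs]
    rw [← he]
    refine (hder b b' s).hasDerivWithinAt.congr_of_mem (fun r hr => ?_) hs
    have h1 := hcs r hr
    rw [hcut r b b' hr hbb, hVf _ _ _ (by rw [h1]; exact hr.1), h1]
  refine ⟨birthGraphon hγ V, fun t b b' => cutOff V t b b', ?_, ?_, ?_, ?_, ?_⟩
  · exact continuous_subtype_val.comp (continuous_cutOff V)
  · exact fun t b b' => (cutOff V t b b').2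
  · intro b b'
    rcases le_total b b' with h | h
    · exact hbirth b b' h
    · rw [cutOff_symm, max_comm]; exact hbirth b' b h
  · intro b b' s hs
    rcases le_total b b' with h | h
    · exact hderiv b b' h s hs
    · rw [max_comm] at hs ⊢
      have := hderiv b' b h s hs
      simp_rw [cutOff_symm V _ (b : ℝ) b']
      rw [hl.symm _ (clamp (s - b)), hm.symm _ (clamp (s - b))]
      exact this
  · intro t
    filter_upwards [birthGraphon_ae hγ V t] with p hp
    rw [hp]

end

section
variable {γ : ℝ} {lam mu : Rate} {K : ℝ}

lemma mem_unitInterval_of_minAge (F : I → ProbabilityMeasure I) (t x y : I)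
    (h : minAge F t x y ≤ t) {s : ℝ} (hs : s ∈ Icc ((t : ℝ) - minAge F t x y) t) :
    s ∈ Icc (0 : ℝ) 1 :=
  ⟨by linarith [hs.1], hs.2.trans t.2.2⟩

lemma IsProfile.solves (hγ : 0 < γ) {g : I → Graphon} {U : ℝ → ℝ → ℝ → ℝ}
    (h : IsProfile γ (fun t u v c => lam t u v (limitLaw hγ t) c)
      (fun t u v c => mu t u v (limitLaw hγ t) c) g U) :
    SolvesGraphonEquation lam mu (limitLaw hγ) g := by
  have hbI : ∀ t x : I, limitBirth γ t x ∈ Icc (0 : ℝ) 1 := fun t x =>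
    ⟨(limitBirth_mem hγ t x).1, (limitBirth_mem hγ t x).2.trans t.2.2⟩
  -- Along the motion of the labels the birth times are constant.
  have hval : ∀ t x y : I, ∀ s ∈ Icc ((t : ℝ) - minAge (limitLaw hγ) t x y) t,
      U (clamp s) (limitBirth γ (clamp s) (originLabel (limitLaw hγ) t x s))
        (limitBirth γ (clamp s) (originLabel (limitLaw hγ) t y s)) =
      U s (limitBirth γ t x) (limitBirth γ t y) := by
    intro t x y s hs
    rw [minAge_limitLaw hγ] at hs
    rw [limitBirth_originLabel hγ t x ⟨(le_max_left _ _).trans hs.1, hs.2⟩,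
      limitBirth_originLabel hγ t y ⟨(le_max_right _ _).trans hs.1, hs.2⟩,
      coe_clamp_of_mem ⟨((hbI t x).1.trans (le_max_left _ _)).trans hs.1, hs.2.trans t.2.2⟩]
  have hle : ∀ t x y : I, (t : ℝ) - minAge (limitLaw hγ) t x y ≤ t := fun t x y => by
    rw [minAge_limitLaw hγ]
    exact max_le (limitBirth_mem hγ t x).2 (limitBirth_mem hγ t y).2
  refine ⟨fun t x y => ⟨U t (limitBirth γ t x) (limitBirth γ t y), h.mem _ _ _⟩,
    ?_, ?_, ?_, ?_, ?_⟩
  · intro t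
    filter_upwards [h.graphon t] with p hp
    exact Subtype.ext hp
  · intro x y
    have h0 : ∀ x, limitBirth γ 0 x = 0 := fun x =>
      le_antisymm (limitBirth_mem hγ 0 x).2 (limitBirth_mem hγ 0 x).1
    refine Subtype.ext ?_
    change U _ _ _ = 0
    rw [h0, h0]
    simpa using h.birth 0 0
  · intro t x y
    refine Subtype.ext ?_
    have := hval t x y t ⟨hle t x y, le_rfl⟩
    rw [clamp_coe] at this
    exact this.symm
  · intro t x y
    refine Subtype.ext ?_
    change U _ _ _ = 0
    rw [hval t x y _ ⟨le_rfl, hle t x y⟩, minAge_limitLaw hγ]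
    exact h.birth ⟨_, hbI t x⟩ ⟨_, hbI t y⟩
  · intro t x y s hs
    have hs' := hs
    rw [minAge_limitLaw hγ] at hs'
    have hq : ∀ z, s ∈ Icc (limitBirth γ t z) t →
        quantile (limitLaw hγ (clamp s)) (originLabel (limitLaw hγ) t z s) =
          clamp (s - limitBirth γ t z) := by
      intro z hz
      refine Subtype.ext ?_
      rw [quantile_limitLaw hγ, limitAge_originLabel hγ t z hz, coe_clamp_of_mem]
      · rw [limitBirth]; ring
      · exact ⟨sub_nonneg.2 hz.1, by linarith [(hbI t z).1, hz.2, t.2.2]⟩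
    have hd := h.deriv ⟨_, hbI t x⟩ ⟨_, hbI t y⟩ s ⟨hs'.1, hs'.2.trans t.2.2⟩
    rw [hq x ⟨(le_max_left _ _).trans hs'.1, hs'.2⟩, hq y ⟨(le_max_right _ _).trans hs'.1, hs'.2⟩]
    simp only []
    rw [hval t x y s hs]
    refine (hd.mono ?_).congr_of_mem (fun r hr => hval t x y r hr) hs
    rw [minAge_limitLaw hγ]
    exact Icc_subset_Icc_right t.2.2

/-- Two solutions of the graphon equation agree: the largest difference, weighted by
`exp (-8 K t)`, is at most half of itself. -/
lemma SolvesGraphonEquation.unique {F : I → ProbabilityMeasure I}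
    (hF : ∀ t x y, minAge F t x y ≤ t)
    (hl : TameRate (fun t u v c => lam t u v (F t) c) K)
    (hm : TameRate (fun t u v c => mu t u v (F t) c) K) (hK : 0 < K) {g₁ g₂ : I → Graphon}
    (h₁ : SolvesGraphonEquation lam mu F g₁) (h₂ : SolvesGraphonEquation lam mu F g₂) :
    g₁ = g₂ := by
  obtain ⟨f₁, h₁⟩ := h₁
  obtain ⟨f₂, h₂⟩ := h₂
  let e : I × I × I → ℝ := fun p => Real.exp (-(8 * K * p.1)) *
    |(f₁ p.1 p.2.1 p.2.2 : ℝ) - f₂ p.1 p.2.1 p.2.2|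
  have habs : ∀ a b : I, |(a : ℝ) - b| ≤ 1 := fun a b => by
    rw [abs_le]; constructor <;> linarith [a.2.1, a.2.2, b.2.1, b.2.2]
  have hbdd : BddAbove (range e) := by
    refine ⟨1, ?_⟩
    rintro _ ⟨p, rfl⟩
    refine mul_le_one₀ (Real.exp_le_one_iff.2 ?_) (abs_nonneg _) (habs _ _)
    have := p.1.2.1
    have : 0 ≤ 8 * K * p.1 := by positivity
    linarith
  set M := ⨆ p, e p with hM
  have hM0 : 0 ≤ M := (by positivity : 0 ≤ e 0).trans (le_ciSup hbdd 0)
  have hle : ∀ t x y : I, |(f₁ t x y : ℝ) - f₂ t x y| ≤ M * Real.exp (8 * K * t) := by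
    intro t x y
    have := le_ciSup hbdd (t, x, y)
    have h' : Real.exp (-(8 * K * t)) * |(f₁ t x y : ℝ) - f₂ t x y| ≤ M := this
    rw [Real.exp_neg, inv_mul_le_iff₀ (Real.exp_pos _)] at h'
    linarith
  have hhalf : ∀ t x y : I, |(f₁ t x y : ℝ) - f₂ t x y| ≤ M / 2 * Real.exp (8 * K * t) := by
    intro t x y
    set a := (t : ℝ) - minAge F t x y with ha
    have hat : a ≤ t := by
      have : 0 ≤ minAge F t x y := le_min (quantile (F t) x).2.1 (quantile (F t) y).2.1
      linarith
    set φ := fun r : ℝ => (f₁ (clamp r) (originLabel F t x r) (originLabel F t y r) : ℝ)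
    set ψ := fun r : ℝ => (f₂ (clamp r) (originLabel F t x r) (originLabel F t y r) : ℝ)
    have hd₁ := h₁.deriv t x y
    have hd₂ := h₂.deriv t x y
    have hd := fun s hs => (hd₁ s hs).sub (hd₂ s hs)
    have hder : ∀ s : ℝ, HasDerivAt (fun s => M / 2 * Real.exp (8 * K * s))
        (4 * K * (M * Real.exp (8 * K * s))) s := fun s => by
      have h1 : HasDerivAt (fun s : ℝ => 8 * K * s) (8 * K) s := by
        simpa using (hasDerivAt_id s).const_mul (8 * K)
      convert! h1.exp.const_mul (M / 2) using 1
      ring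
    have key := image_norm_le_of_norm_deriv_right_le_deriv_boundary'
      (f := fun r => φ r - ψ r) (a := a) (b := t)
      (fun s hs => (hd s hs).continuousWithinAt)
      (fun s hs => (hd s ⟨hs.1, hs.2.le⟩).mono_of_mem_nhdsWithin
        (mem_of_superset (Icc_mem_nhdsGE hs.2) (Icc_subset_Icc_left hs.1)))
      (B := fun s => M / 2 * Real.exp (8 * K * s)) (B' := fun s => 4 * K * (M * Real.exp (8 * K * s)))
      (by
        have e1 : φ a = 0 := congrArg Subtype.val (h₁.birth t x y)
        have e2 : ψ a = 0 := congrArg Subtype.val (h₂.birth t x y)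
        rw [e1, e2, sub_zero, norm_zero]
        positivity)
      (fun s _ => (hder s).continuousAt.continuousWithinAt)
      (fun s _ => (hder s).hasDerivWithinAt)
      (fun s hs => by
        have h0 := mem_unitInterval_of_minAge F t x y (hF t x y) ⟨hs.1, hs.2.le⟩
        have hc : cutMetric (g₁ (clamp s)).unlabel (g₂ (clamp s)).unlabel ≤
            M * Real.exp (8 * K * s) := by
          refine (cutMetric_le _ _).trans (cutDist_le_of_ae ?_)
          filter_upwards [h₁.graphon (clamp s), h₂.graphon (clamp s)] with p hp hp'
          rw [hp, hp']
          have := hle (clamp s) p.1 p.2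
          rwa [coe_clamp_of_mem h0] at this
        refine abs_field_sub_le (f₁ (clamp s) _ _).2 (hl.nonneg ..) (hl.bound ..) (hm.nonneg ..)
          (hm.bound ..) hK.le ((hl.lipschitz ..).trans (mul_le_mul_of_nonneg_left hc hK.le))
          ((hm.lipschitz ..).trans (mul_le_mul_of_nonneg_left hc hK.le)) ?_
        have := hle (clamp s) (originLabel F t x s) (originLabel F t y s)
        rwa [coe_clamp_of_mem h0] at this)
    have := key ⟨hat, le_rfl⟩
    have e1 : φ t = f₁ t x y := by
      simp only [φ]; rw [clamp_coe, ← h₁.label]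
    have e2 : ψ t = f₂ t x y := by
      simp only [ψ]; rw [clamp_coe, ← h₂.label]
    rwa [e1, e2] at this
  have hMM : M ≤ M / 2 := by
    refine ciSup_le fun p => ?_
    have := hhalf p.1 p.2.1 p.2.2
    change Real.exp (-(8 * K * p.1)) * _ ≤ _
    rw [Real.exp_neg, inv_mul_le_iff₀ (Real.exp_pos _)]
    linarith
  have hM00 : M = 0 := by linarith
  have hff : ∀ t x y, f₁ t x y = f₂ t x y := by
    intro t x y
    have := hle t x y
    rw [hM00, zero_mul] at this
    exact Subtype.ext (sub_eq_zero.1 (abs_nonpos_iff.1 this))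
  funext t
  refine graphon_ext ?_
  filter_upwards [h₁.graphon t, h₂.graphon t] with p hp hp'
  rw [hp, hp', hff]

lemma minAge_limitLaw_le (hγ : 0 < γ) (t x y : I) : minAge (limitLaw hγ) t x y ≤ t := by
  have h := minAge_limitLaw hγ t x y
  have := (limitBirth_mem hγ t x).1.trans (le_max_left _ (limitBirth γ t y))
  linarith

end

/-! ### A single marked Poisson clock -/

/-- The law of a waiting time and its mark. -/
def waitLaw (r : ℝ) : Measure (ℝ × ℝ) :=
  (expMeasure r).prod ((volume : Measure ℝ).restrict (Icc 0 1))

instance (r : ℝ) [h : Fact (0 < r)] : IsProbabilityMeasure (expMeasure r) :=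
  isProbabilityMeasure_expMeasure h.out

instance : IsProbabilityMeasure ((volume : Measure ℝ).restrict (Icc 0 1)) :=
  ⟨by simp⟩

instance (r : ℝ) [Fact (0 < r)] : IsProbabilityMeasure (waitLaw r) := by
  unfold waitLaw; infer_instance

lemma ae_wait_pos (r : ℝ) : ∀ᵐ p ∂(waitLaw r), 0 < p.1 := by
  have h : ∀ᵐ w ∂(expMeasure r), 0 < w := by
    change ∀ᵐ w ∂((volume : Measure ℝ).withDensity (gammaPDF 1 r)), 0 < w
    have hpdf : Measurable (gammaPDF 1 r) := (measurable_gammaPDFReal 1 r).ennreal_ofReal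
    rw [ae_withDensity_iff hpdf]
    have h0 : ∀ᵐ w : ℝ, w ≠ 0 := by simp [ae_iff]
    filter_upwards [h0] with w hw h
    by_contra! hn
    exact h (exponentialPDF_of_neg (lt_of_le_of_ne hn hw))
  exact Measure.quasiMeasurePreserving_fst.ae h

/-- The law of the sequence of waiting times and marks of a clock of rate `r`. -/
def clockLaw (r : ℝ) [Fact (0 < r)] : Measure (ℕ → ℝ × ℝ) := Measure.infinitePi fun _ => waitLaw r

instance (r : ℝ) [Fact (0 < r)] : IsProbabilityMeasure (clockLaw r) := by
  unfold clockLaw; infer_instance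

/-- Put a waiting time in front of a sequence of waiting times. -/
def consWait (p : (ℝ × ℝ) × (ℕ → ℝ × ℝ)) (k : ℕ) : ℝ × ℝ := Nat.casesOn k p.1 p.2

lemma measurable_consWait : Measurable consWait := by
  refine measurable_pi_iff.2 fun k => ?_
  cases k with
  | zero => exact measurable_fst
  | succ k => exact (measurable_pi_apply k).comp measurable_snd

/-- A clock is a first waiting time followed by an independent copy of the clock. -/
lemma map_consWait (r : ℝ) [Fact (0 < r)] :
    ((waitLaw r).prod (clockLaw r)).map consWait = clockLaw r := by
  refine Measure.eq_infinitePi _ fun s t ht => ?_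
  classical
  obtain ⟨m, hm⟩ := s.exists_nat_subset_range
  set t' : ℕ → Set (ℝ × ℝ) := fun i => if i ∈ s then t i else univ with ht'
  have ht'm : ∀ i, MeasurableSet (t' i) := fun i => by
    simp only [ht']; split_ifs; exacts [ht i, .univ]
  have e1 : (s : Set ℕ).pi t = (Finset.range (m + 1) : Set ℕ).pi t' := by
    ext z
    simp only [Set.mem_pi, ht', Finset.mem_coe]
    constructor
    · intro h i _
      split_ifs with hi
      exacts [h i hi, mem_univ _]
    · intro h i hi
      have := h i (Finset.mem_range.2 ((Finset.mem_range.1 (hm hi)).trans (Nat.lt_succ_self m)))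
      rwa [if_pos hi] at this
  have e2 : ∏ i ∈ s, waitLaw r (t i) = ∏ i ∈ Finset.range (m + 1), waitLaw r (t' i) := by
    refine Finset.prod_subset_one_on_sdiff (hm.trans (Finset.range_mono (Nat.le_succ m))) ?_ ?_
    · intro i hi
      rw [Finset.mem_sdiff] at hi
      simp [ht', hi.2]
    · intro i hi
      simp [ht', hi]
  have e3 : consWait ⁻¹' ((Finset.range (m + 1) : Set ℕ).pi t') =
      t' 0 ×ˢ ((Finset.range m : Set ℕ).pi fun i => t' (i + 1)) := by
    ext p
    simp only [Set.mem_preimage, Set.mem_pi, Finset.coe_range, mem_Iio, mem_prod]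
    constructor
    · intro h
      exact ⟨h 0 (Nat.succ_pos m), fun i hi => h (i + 1) (Nat.succ_lt_succ hi)⟩
    · rintro ⟨h0, h⟩ i hi
      cases i with
      | zero => exact h0
      | succ i => exact h i (Nat.lt_of_succ_lt_succ hi)
  have hpi : MeasurableSet ((Finset.range (m + 1) : Set ℕ).pi t') :=
    MeasurableSet.pi (Finset.countable_toSet _) fun i _ => ht'm i
  rw [e1, e2, Measure.map_apply measurable_consWait hpi, e3, Measure.prod_prod, clockLaw,
    Measure.infinitePi_pi _ fun i _ => ht'm _, Finset.prod_range_succ', mul_comm]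

lemma ringTime_zero (z : ℕ → ℝ × ℝ) : ringTime z 0 = (z 0).1 := by simp [ringTime]

lemma ringTime_consWait_zero (p) : ringTime (consWait p) 0 = p.1.1 := by
  rw [ringTime_zero]; rfl

lemma ringTime_consWait_succ (p) (k : ℕ) :
    ringTime (consWait p) (k + 1) = p.1.1 + ringTime p.2 k := by
  unfold ringTime
  rw [Finset.sum_range_succ', add_comm]
  rfl

lemma ringTime_succ (z : ℕ → ℝ × ℝ) (k : ℕ) : ringTime z (k + 1) = ringTime z k + (z (k + 1)).1 :=
  Finset.sum_range_succ (fun i => (z i).1) (k + 1)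

lemma measurable_ringTime (k : ℕ) : Measurable fun z : ℕ → ℝ × ℝ => ringTime z k := by
  unfold ringTime
  fun_prop

lemma integral_expMeasure {r : ℝ} (hr : 0 < r) {f : ℝ → ℝ} (hf : Measurable f)
    (hb : ∀ w, |f w| ≤ 1) (h1 : ∀ w, 1 < w → f w = 1) :
    ∫ w, f w ∂(expMeasure r) =
      Real.exp (-r) + ∫ w in (0 : ℝ)..1, r * Real.exp (-(r * w)) * f w := by
  have := isProbabilityMeasure_expMeasure hr
  have hfi : Integrable f (expMeasure r) := Integrable.of_bound hf.aestronglyMeasurable 1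
    (ae_of_all _ hb)
  have hpdf : Measurable (gammaPDF 1 r) := (measurable_gammaPDFReal 1 r).ennreal_ofReal
  have e0 : ∫ w, (f w - 1) ∂(expMeasure r) = ∫ w, (gammaPDF 1 r w).toReal • (f w - 1) := by
    change ∫ w, (f w - 1) ∂(volume.withDensity (gammaPDF 1 r)) = _
    exact integral_withDensity_eq_integral_toReal_smul hpdf
      (ae_of_all _ fun w => ENNReal.ofReal_lt_top) _
  have e1 : ∫ w, (gammaPDF 1 r w).toReal • (f w - 1) =
      ∫ w in (0 : ℝ)..1, r * Real.exp (-(r * w)) * (f w - 1) := by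
    rw [intervalIntegral.integral_of_le zero_le_one, ← integral_Icc_eq_integral_Ioc,
      ← integral_indicator measurableSet_Icc]
    congr 1
    funext w
    have h2 : gammaPDF 1 r w = exponentialPDF r w := rfl
    rw [h2, exponentialPDF_eq]
    by_cases hw0 : 0 ≤ w
    · rw [if_pos hw0, ENNReal.toReal_ofReal (by positivity)]
      by_cases hw1 : w ≤ 1
      · rw [indicator_of_mem (show w ∈ Icc (0 : ℝ) 1 from ⟨hw0, hw1⟩)]; rfl
      · rw [indicator_of_notMem (fun h => hw1 h.2), h1 w (not_le.1 hw1)]; simp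
    · rw [if_neg hw0, indicator_of_notMem (fun h => hw0 h.1)]; simp
  have e2 : ∫ w in (0 : ℝ)..1, r * Real.exp (-(r * w)) = 1 - Real.exp (-r) := by
    have hd : ∀ w ∈ uIcc (0 : ℝ) 1, HasDerivAt (fun w => -Real.exp (-(r * w)))
        (r * Real.exp (-(r * w))) w := fun w _ => by
      have h3 : HasDerivAt (fun w : ℝ => -(r * w)) (-r) w := by
        convert! (hasDerivAt_id w).const_mul (-r) using 1
        · funext w; simp
        · simp
      convert! h3.exp.neg using 1
      ring
    rw [intervalIntegral.integral_eq_sub_of_hasDerivAt hd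
      (Continuous.intervalIntegrable (by fun_prop) _ _)]
    simp; ring
  have hii : IntervalIntegrable (fun w => r * Real.exp (-(r * w)) * f w) volume 0 1 := by
    refine IntervalIntegrable.continuousOn_mul ?_ (Continuous.continuousOn (by fun_prop))
    refine (intervalIntegrable_iff_integrableOn_Ioc_of_le zero_le_one).2 ?_
    exact Integrable.of_bound hf.aestronglyMeasurable 1 (ae_of_all _ hb)
  have e3 : ∫ w in (0 : ℝ)..1, r * Real.exp (-(r * w)) * (f w - 1) =
      (∫ w in (0 : ℝ)..1, r * Real.exp (-(r * w)) * f w) - (1 - Real.exp (-r)) := by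
    rw [← e2, ← intervalIntegral.integral_sub hii (Continuous.intervalIntegrable (by fun_prop) _ _)]
    congr 1; funext w; ring
  have e4 : ∫ w, (f w - 1) ∂(expMeasure r) = (∫ w, f w ∂(expMeasure r)) - 1 := by
    rw [integral_sub hfi (integrable_const _)]; simp
  linarith

/-! ### Void probabilities -/

/-- The event that no ring of a clock, started at time `x`, falls into the set `S` of pairs of a
time and a mark. -/
def voidEvent (S : Set (ℝ × ℝ)) (x : ℝ) : Set (ℕ → ℝ × ℝ) :=
  {z | ∀ k, (x + ringTime z k, (z k).2) ∉ S}

lemma measurableSet_voidEvent_prod {S : Set (ℝ × ℝ)} (hS : MeasurableSet S) :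
    MeasurableSet {p : ℝ × (ℕ → ℝ × ℝ) | p.2 ∈ voidEvent S p.1} := by
  have : {p : ℝ × (ℕ → ℝ × ℝ) | p.2 ∈ voidEvent S p.1} =
      ⋂ k, (fun p : ℝ × (ℕ → ℝ × ℝ) => (p.1 + ringTime p.2 k, (p.2 k).2)) ⁻¹' Sᶜ := by
    ext p; simp [voidEvent]
  rw [this]
  refine MeasurableSet.iInter fun k => ?_
  have : Measurable fun p : ℝ × (ℕ → ℝ × ℝ) => ringTime p.2 k :=
    (measurable_ringTime k).comp measurable_snd
  exact ((measurable_fst.add this).prodMk (by fun_prop)) hS.compl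

lemma measurableSet_voidEvent {S : Set (ℝ × ℝ)} (hS : MeasurableSet S) (x : ℝ) :
    MeasurableSet (voidEvent S x) :=
  measurable_prodMk_left (measurableSet_voidEvent_prod hS)

lemma consWait_mem_voidEvent (S : Set (ℝ × ℝ)) (x : ℝ) (p : (ℝ × ℝ) × (ℕ → ℝ × ℝ)) :
    consWait p ∈ voidEvent S x ↔ (x + p.1.1, p.1.2) ∉ S ∧ p.2 ∈ voidEvent S (x + p.1.1) := by
  constructor
  · intro h
    refine ⟨by simpa [ringTime_consWait_zero, consWait] using h 0, fun k => ?_⟩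
    have := h (k + 1)
    rw [ringTime_consWait_succ, ← add_assoc] at this
    exact this
  · rintro ⟨h0, h⟩ k
    cases k with
    | zero => simpa [ringTime_consWait_zero, consWait] using h0
    | succ k => rw [ringTime_consWait_succ, ← add_assoc]; exact h k

/-- The probability that a clock, started at time `x`, never rings in `S`. -/
def voidProb (r : ℝ) [Fact (0 < r)] (S : Set (ℝ × ℝ)) (x : ℝ) : ℝ :=
  (clockLaw r).real (voidEvent S x)

/-- The measure of the marks which `S` contains at time `y`. -/
def markMass (S : Set (ℝ × ℝ)) (y : ℝ) : ℝ :=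
  ((volume : Measure ℝ).restrict (Icc 0 1)).real {u | (y, u) ∈ S}

section
variable {r : ℝ} [hr : Fact (0 < r)] {S : Set (ℝ × ℝ)}

lemma voidProb_mem (x : ℝ) : voidProb r S x ∈ Icc (0 : ℝ) 1 :=
  ⟨measureReal_nonneg, measureReal_le_one⟩

lemma markMass_mem (y : ℝ) : markMass S y ∈ Icc (0 : ℝ) 1 :=
  ⟨measureReal_nonneg, measureReal_le_one⟩

lemma measurable_voidProb (hS : MeasurableSet S) : Measurable (voidProb r S) :=
  (measurable_measure_prodMk_left (ν := clockLaw r) (measurableSet_voidEvent_prod hS)).ennreal_toReal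

lemma measurable_markMass (hS : MeasurableSet S) : Measurable (markMass S) :=
  (measurable_measure_prodMk_left
    (ν := (volume : Measure ℝ).restrict (Icc 0 1)) hS).ennreal_toReal

/-- Decomposition of the void probability at the first ring. -/
lemma voidProb_first_ring (hS : MeasurableSet S) (x : ℝ) :
    voidProb r S x = ∫ w, (1 - markMass S (x + w)) * voidProb r S (x + w) ∂(expMeasure r) := by
  have hV := measurableSet_voidEvent hS x
  have h1 : voidProb r S x =
      ((waitLaw r).prod (clockLaw r)).real (consWait ⁻¹' voidEvent S x) := by
    have h0 := congrArg (fun ν : Measure _ => ν.real (voidEvent S x)) (map_consWait r)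
    simp only [measureReal_def] at h0 ⊢
    rw [Measure.map_apply measurable_consWait hV] at h0
    exact h0.symm
  have hms : MeasurableSet (consWait ⁻¹' voidEvent S x) := measurable_consWait hV
  have h1' : ((waitLaw r).prod (clockLaw r)).real (consWait ⁻¹' voidEvent S x) =
      ∫ p, (consWait ⁻¹' voidEvent S x).indicator (fun _ => (1 : ℝ)) p
        ∂((waitLaw r).prod (clockLaw r)) := by
    rw [integral_indicator_const _ hms]; simp
  rw [h1, h1', integral_prod _ ((integrable_const _).indicator hms), waitLaw]
  have hin : ∀ p : ℝ × ℝ, ∫ z, (consWait ⁻¹' voidEvent S x).indicator (fun _ => (1 : ℝ)) (p, z)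
      ∂(clockLaw r) = {q : ℝ × ℝ | (x + q.1, q.2) ∉ S}.indicator
        (fun q => voidProb r S (x + q.1)) p := by
    intro p
    by_cases hp : (x + p.1, p.2) ∈ S
    · simp [indicator, consWait_mem_voidEvent, hp]
    · rw [indicator_of_mem (show p ∈ {q : ℝ × ℝ | (x + q.1, q.2) ∉ S} from hp)]
      have h2 : (fun z => (consWait ⁻¹' voidEvent S x).indicator (fun _ => (1 : ℝ)) (p, z)) =
          (voidEvent S (x + p.1)).indicator fun _ => 1 := by
        funext z
        have h3 : (p, z) ∈ consWait ⁻¹' voidEvent S x ↔ z ∈ voidEvent S (x + p.1) := by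
          rw [mem_preimage, consWait_mem_voidEvent]; simp [hp]
        by_cases h4 : z ∈ voidEvent S (x + p.1)
        · rw [indicator_of_mem (h3.2 h4), indicator_of_mem h4]
        · rw [indicator_of_notMem (mt h3.1 h4), indicator_of_notMem h4]
      rw [h2, integral_indicator_const _ (measurableSet_voidEvent hS _)]
      simp [voidProb]
  simp_rw [hin]
  have hS' : MeasurableSet {q : ℝ × ℝ | (x + q.1, q.2) ∉ S} :=
    ((measurable_const.add measurable_fst).prodMk measurable_snd) hS.compl
  have hu : Measurable fun q : ℝ × ℝ => voidProb r S (x + q.1) :=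
    (measurable_voidProb hS).comp (measurable_const.add measurable_fst)
  rw [integral_prod _ ((Integrable.of_bound hu.aestronglyMeasurable 1 (ae_of_all _ fun q => by
    rw [Real.norm_eq_abs, abs_of_nonneg (voidProb_mem _).1]; exact (voidProb_mem _).2)).indicator
    hS')]
  congr 1
  funext w
  have h3 : (fun u => {q : ℝ × ℝ | (x + q.1, q.2) ∉ S}.indicator
      (fun q => voidProb r S (x + q.1)) (w, u)) =
      {u | (x + w, u) ∈ S}ᶜ.indicator fun _ => voidProb r S (x + w) := by
    funext u
    by_cases hu : (x + w, u) ∈ S <;> simp [indicator, hu]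
  have hsec : MeasurableSet {u | (x + w, u) ∈ S} := measurable_prodMk_left hS
  rw [h3, integral_indicator_const _ hsec.compl, measureReal_compl hsec]
  simp [markMass]

lemma ae_clock_wait_pos : ∀ᵐ z ∂(clockLaw r), ∀ k, 0 < (z k).1 := by
  rw [ae_all_iff]
  intro k
  exact (measurePreserving_eval_infinitePi (fun _ : ℕ => waitLaw r) k).quasiMeasurePreserving.ae
    (ae_wait_pos r)

lemma ringTime_pos {z : ℕ → ℝ × ℝ} (hz : ∀ k, 0 < (z k).1) (k : ℕ) : 0 < ringTime z k :=
  Finset.sum_pos (fun i _ => hz i) (by simp)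

lemma voidProb_eq_one (hS1 : ∀ p ∈ S, p.1 ≤ 1) {x : ℝ} (hx : 1 ≤ x) : voidProb r S x = 1 := by
  have h : ∀ᵐ z ∂(clockLaw r), z ∈ voidEvent S x := by
    filter_upwards [ae_clock_wait_pos (r := r)] with z hz k hk
    have := hS1 _ hk
    have := ringTime_pos hz k
    simp only at *
    linarith
  have h' : voidEvent S x =ᵐ[clockLaw r] univ := eventuallyEq_univ.2 h
  rw [voidProb, measureReal_congr h']
  simp

lemma voidProb_integral_eq (hS : MeasurableSet S) (hS1 : ∀ p ∈ S, p.1 ≤ 1) {x : ℝ} (hx : 0 ≤ x) :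
    voidProb r S x = Real.exp (-r) + ∫ w in (0 : ℝ)..1, r * Real.exp (-(r * w)) *
      ((1 - markMass S (x + w)) * voidProb r S (x + w)) := by
  rw [voidProb_first_ring hS x]
  refine integral_expMeasure hr.out ?_ ?_ ?_
  · have h1 := (measurable_markMass hS).comp (measurable_const_add x)
    have h2 := (measurable_voidProb (r := r) hS).comp (measurable_const_add x)
    exact (measurable_const.sub h1).mul h2
  · intro w
    have h1 := markMass_mem (S := S) (x + w)
    have h2 := voidProb_mem (r := r) (S := S) (x + w)
    rw [abs_le]
    constructor <;> nlinarith [h1.1, h1.2, h2.1, h2.2]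
  · intro w hw
    rw [voidProb_eq_one hS1 (by linarith)]
    have : {u | (x + w, u) ∈ S} = ∅ := by
      ext u
      simp only [mem_ofPred_eq, mem_empty_iff_false, iff_false]
      intro h
      have := hS1 _ h
      simp only at this
      linarith
    simp [markMass, this]

end

lemma integral_exp_neg_mul (r : ℝ) :
    ∫ w in (0 : ℝ)..1, r * Real.exp (-(r * w)) = 1 - Real.exp (-r) := by
  have hd : ∀ w ∈ uIcc (0 : ℝ) 1, HasDerivAt (fun w => -Real.exp (-(r * w)))
      (r * Real.exp (-(r * w))) w := fun w _ => by
    have h3 : HasDerivAt (fun w : ℝ => -(r * w)) (-r) w := by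
      convert! (hasDerivAt_id w).const_mul (-r) using 1
      · funext w; simp
      · simp
    convert! h3.exp.neg using 1
    ring
  rw [intervalIntegral.integral_eq_sub_of_hasDerivAt hd
    (Continuous.intervalIntegrable (by fun_prop) _ _)]
  simp; ring

lemma intervalIntegrable_of_bounded {f : ℝ → ℝ} (hf : Measurable f) {B : ℝ} (hB : ∀ y, |f y| ≤ B)
    (a b : ℝ) : IntervalIntegrable f volume a b := by
  constructor <;> exact Integrable.of_bound hf.aestronglyMeasurable B (ae_of_all _ hB)

/-- `exp (- ∫_x^∞ r mb)` solves the integral equation of the void probability. -/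
lemma integral_eq_of_deriv {r : ℝ} {E mb : ℝ → ℝ} (hE : Continuous E) (hE1 : ∀ x, 1 ≤ x → E x = 1)
    {s : Set ℝ} (hs : s.Countable) (hd : ∀ y ∉ s, HasDerivAt E (r * mb y * E y) y)
    (hmb : Measurable mb) {B : ℝ} (hB : ∀ y, |mb y| ≤ B) {x : ℝ} (hx : 0 ≤ x) :
    E x = Real.exp (-r) + ∫ w in (0 : ℝ)..1, r * Real.exp (-(r * w)) *
      ((1 - mb (x + w)) * E (x + w)) := by
  have hcount : ((fun w => x + w) ⁻¹' s).Countable := hs.preimage (add_right_injective x)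
  have hEx : Continuous fun w => E (x + w) := hE.comp (continuous_const_add x)
  have := integral_eq_of_hasDerivAt_off_countable (fun w => -(Real.exp (-(r * w)) * E (x + w)))
    (fun w => r * Real.exp (-(r * w)) * ((1 - mb (x + w)) * E (x + w))) (a := 0) (b := 1) hcount
    (Continuous.continuousOn (by fun_prop)) (fun w hw => by
      have h1 : HasDerivAt (fun w : ℝ => -(r * w)) (-r) w := by
        convert! (hasDerivAt_id w).const_mul (-r) using 1
        · funext w; simp
        · simp
      have h2 : HasDerivAt (fun w => E (x + w)) (r * mb (x + w) * E (x + w)) w :=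
        HasDerivAt.comp_const_add x w (hd _ hw.2)
      convert! (h1.exp.mul h2).neg using 1
      ring)
    (by
      refine IntervalIntegrable.continuousOn_mul ?_ (Continuous.continuousOn (by fun_prop))
      refine IntervalIntegrable.mul_continuousOn ?_ hEx.continuousOn
      refine (intervalIntegrable_const).sub ?_
      exact intervalIntegrable_of_bounded (hmb.comp (measurable_const_add x)) (fun y => hB _) _ _)
  rw [this, hE1 (x + 1) (by linarith)]
  simp

section
variable {r : ℝ} [hr : Fact (0 < r)] {S : Set (ℝ × ℝ)}

/-- The first-ring operator contracts by the factor `1 - exp (-r)`, since a clock does not ring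
within a unit of time with probability `exp (-r)`. -/
lemma nonpos_of_le_first_ring {D c : ℝ → ℝ} (hD : Measurable D) (hc : Measurable c)
    (hD1 : ∀ x, |D x| ≤ 1) (hc01 : ∀ x, c x ∈ Icc (0 : ℝ) 1)
    (h : ∀ x, 0 ≤ x → D x ≤ ∫ w in (0 : ℝ)..1, r * Real.exp (-(r * w)) * (c (x + w) * D (x + w)))
    {x : ℝ} (hx : 0 ≤ x) : D x ≤ 0 := by
  have hr0 := hr.out
  have hbdd : BddAbove (range fun x : Ici (0 : ℝ) => max 0 (D x)) :=
    ⟨1, by rintro _ ⟨x, rfl⟩; exact max_le zero_le_one ((le_abs_self _).trans (hD1 x))⟩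
  set M := ⨆ x : Ici (0 : ℝ), max 0 (D x) with hM
  have hDM : ∀ y, 0 ≤ y → D y ≤ M := fun y hy =>
    (le_max_right _ _).trans (le_ciSup hbdd ⟨y, hy⟩)
  have hM0 : 0 ≤ M := (le_max_left _ _).trans (le_ciSup hbdd ⟨0, le_refl (0 : ℝ)⟩)
  have hstep : ∀ y, 0 ≤ y → D y ≤ M * (1 - Real.exp (-r)) := by
    intro y hy
    refine (h y hy).trans ?_
    rw [← integral_exp_neg_mul r, ← intervalIntegral.integral_const_mul]
    refine intervalIntegral.integral_mono_on zero_le_one ?_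
      (Continuous.intervalIntegrable (by fun_prop) _ _) fun w hw => ?_
    · refine IntervalIntegrable.continuousOn_mul ?_ (Continuous.continuousOn (by fun_prop))
      refine intervalIntegrable_of_bounded (B := 1) ?_ (fun w => ?_) _ _
      · exact (hc.comp (measurable_const_add y)).mul (hD.comp (measurable_const_add y))
      · rw [abs_mul, abs_of_nonneg (hc01 _).1]
        exact mul_le_one₀ (hc01 _).2 (abs_nonneg _) (hD1 _)
    · rw [mul_comm M]
      refine mul_le_mul_of_nonneg_left ?_ (by positivity)
      have h1 := hDM (y + w) (add_nonneg hy hw.1)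
      have h2 := hc01 (y + w)
      calc c (y + w) * D (y + w) ≤ c (y + w) * M := mul_le_mul_of_nonneg_left h1 h2.1
        _ ≤ M := mul_le_of_le_one_left hM0 h2.2
  have hexp : Real.exp (-r) ≤ 1 := Real.exp_le_one_iff.2 (by linarith)
  have hMM : M ≤ M * (1 - Real.exp (-r)) := by
    have : Nonempty (Ici (0 : ℝ)) := ⟨⟨0, le_refl (0 : ℝ)⟩⟩
    exact ciSup_le fun y => max_le (mul_nonneg hM0 (by linarith)) (hstep y y.2)
  have : M * Real.exp (-r) ≤ 0 := by linarith
  have hM1 : M ≤ 0 := nonpos_of_mul_nonpos_left this (Real.exp_pos _)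
  exact (hDM x hx).trans hM1

/-- Rényi's formula, as two inequalities: the void probability of a set `S` of times and marks
with times in `(s, t]` is compared with `exp (- ∫_s^t ℓ)` when the intensity `r * markMass S` of
rings in `S` is compared with `ℓ`. Both quantities satisfy an integral equation given by the first
ring, and `nonpos_of_le_first_ring` applies to their difference. -/
lemma voidProb_compare (hS : MeasurableSet S) {s t : ℝ} (h0s : 0 ≤ s) (hst : s ≤ t) (ht1 : t ≤ 1)
    (hSt : ∀ p ∈ S, s < p.1 ∧ p.1 ≤ t) {ℓ : ℝ → ℝ} (hℓ : Continuous ℓ) (hℓ0 : ∀ y, 0 ≤ ℓ y) :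
    ((∀ y ∈ Ioc s t, r * markMass S y ≤ ℓ y) →
      Real.exp (-∫ y in s..t, ℓ y) ≤ voidProb r S 0) ∧
    ((∀ y ∈ Ioc s t, ℓ y = r * markMass S y) →
      voidProb r S 0 = Real.exp (-∫ y in s..t, ℓ y)) := by
  have hr0 := hr.out
  -- `E x` is the candidate for the void probability of a clock started at time `x`
  set q : ℝ → ℝ := fun x => max s (min x t) with hq
  have hqc : Continuous q := by fun_prop
  set E : ℝ → ℝ := fun x => Real.exp (-∫ y in q x..t, ℓ y) with hEdef
  set mb : ℝ → ℝ := (Ioc s t).indicator fun y => ℓ y / r with hmbdef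
  have hint : ∀ a b, IntervalIntegrable ℓ volume a b := fun a b => hℓ.intervalIntegrable a b
  have hprim : ∀ x, HasDerivAt (fun x => ∫ y in x..t, ℓ y) (-ℓ x) x := fun x =>
    intervalIntegral.integral_hasDerivAt_left (hint _ _) (hℓ.stronglyMeasurableAtFilter _ _)
      hℓ.continuousAt
  have hprimc : Continuous fun x => ∫ y in x..t, ℓ y :=
    continuous_iff_continuousAt.2 fun x => (hprim x).continuousAt
  have hEc : Continuous E := (Real.continuous_exp.comp (hprimc.comp hqc).neg)
  have hqt : ∀ x, q x ≤ t := fun x => max_le hst (min_le_right _ _)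
  have hE01 : ∀ x, E x ∈ Icc (0 : ℝ) 1 := fun x => ⟨(Real.exp_pos _).le, by
    refine Real.exp_le_one_iff.2 (neg_nonpos.2 ?_)
    exact intervalIntegral.integral_nonneg (hqt x) fun y _ => hℓ0 y⟩
  have hE1' : ∀ x, t ≤ x → E x = 1 := fun x hx => by
    simp only [hEdef, hq, min_eq_right hx, max_eq_right hst]
    simp
  have hmbm : Measurable mb := (hℓ.measurable.div_const r).indicator measurableSet_Ioc
  obtain ⟨B, hB⟩ : ∃ B, ∀ y, |mb y| ≤ B := by
    obtain ⟨B, hB⟩ := (isCompact_Icc (a := s) (b := t)).exists_bound_of_continuousOn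
      (hℓ.div_const r).continuousOn
    refine ⟨max B 0, fun y => ?_⟩
    by_cases hy : y ∈ Ioc s t
    · simp only [hmbdef, indicator_of_mem hy]
      exact (hB y (Ioc_subset_Icc_self hy)).trans (le_max_left _ _)
    · simp [hmbdef, indicator_of_notMem hy]
  have hd : ∀ y ∉ ({s, t} : Set ℝ), HasDerivAt E (r * mb y * E y) y := by
    intro y hy
    have hys : y ≠ s := fun h => hy (by simp [h])
    have hyt : y ≠ t := fun h => hy (by simp [h])
    rcases lt_or_gt_of_ne hys with h | h
    · have h1 : mb y = 0 := indicator_of_notMem (fun h' => absurd h'.1 (not_lt.2 h.le)) _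
      rw [h1, mul_zero, zero_mul]
      refine (hasDerivAt_const y (E s)).congr_of_eventuallyEq ?_
      filter_upwards [Iio_mem_nhds h] with x hx
      have hx' : x < s := hx
      simp only [hEdef, hq]
      rw [max_eq_left (min_le_of_left_le hx'.le), min_eq_left hst, max_self]
    rcases lt_or_gt_of_ne hyt with h' | h'
    · have h1 : mb y = ℓ y / r := indicator_of_mem (show y ∈ Ioc s t from ⟨h, h'.le⟩) _
      have h2 : HasDerivAt (fun x => Real.exp (-∫ y in x..t, ℓ y))
          (Real.exp (-∫ z in y..t, ℓ z) * ℓ y) y := by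
        have := (hprim y).neg.exp
        rw [neg_neg] at this
        exact this
      have hqe : ∀ᶠ x in 𝓝 y, q x = x := by
        filter_upwards [Ioo_mem_nhds h h'] with x hx
        simp only [hq]
        rw [min_eq_left hx.2.le, max_eq_right hx.1.le]
      have h3 : r * mb y * E y = Real.exp (-∫ z in y..t, ℓ z) * ℓ y := by
        simp only [hEdef, hqe.self_of_nhds, h1]
        field_simp
      rw [h3]
      refine h2.congr_of_eventuallyEq ?_
      filter_upwards [hqe] with x hx
      simp only [hEdef, hx]
    · have h1 : mb y = 0 := indicator_of_notMem (fun h'' => absurd h''.2 (not_le.2 h')) _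
      rw [h1, mul_zero, zero_mul]
      refine (hasDerivAt_const y 1).congr_of_eventuallyEq ?_
      filter_upwards [Ioi_mem_nhds h'] with x hx
      exact hE1' x (le_of_lt hx)
  have hcount : ({s, t} : Set ℝ).Countable := (Set.toFinite _).countable
  have hEeq := fun {x : ℝ} (hx : 0 ≤ x) => integral_eq_of_deriv (r := r) hEc
    (fun x hx => hE1' x (ht1.trans hx)) hcount hd hmbm hB hx
  have hueq := fun {x : ℝ} (hx : 0 ≤ x) => voidProb_integral_eq (r := r) hS
    (fun p hp => (hSt p hp).2.trans ht1) hx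
  have hum := measurable_voidProb (r := r) hS
  have hmm := measurable_markMass hS
  have hout : ∀ y ∉ Ioc s t, markMass S y = 0 := by
    intro y hy
    have : {u | (y, u) ∈ S} = ∅ := by
      ext u
      simp only [mem_ofPred_eq, mem_empty_iff_false, iff_false]
      exact fun h => hy (hSt _ h)
    simp [markMass, this]
  have hE0 : E 0 = Real.exp (-∫ y in s..t, ℓ y) := by
    simp only [hEdef, hq]
    rw [min_eq_left (h0s.trans hst), max_eq_left h0s]
  have hIE : ∀ x, IntervalIntegrable (fun w => r * Real.exp (-(r * w)) *
      ((1 - mb (x + w)) * E (x + w))) volume 0 1 := by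
    intro x
    refine IntervalIntegrable.continuousOn_mul ?_ (Continuous.continuousOn (by fun_prop))
    refine IntervalIntegrable.mul_continuousOn ?_
      (hEc.comp (continuous_const_add x)).continuousOn
    refine (intervalIntegrable_const).sub ?_
    exact intervalIntegrable_of_bounded (hmbm.comp (measurable_const_add x)) (fun y => hB _) _ _
  have hIu : ∀ x, IntervalIntegrable (fun w => r * Real.exp (-(r * w)) *
      ((1 - markMass S (x + w)) * voidProb r S (x + w))) volume 0 1 := by
    intro x
    refine IntervalIntegrable.continuousOn_mul ?_ (Continuous.continuousOn (by fun_prop))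
    refine intervalIntegrable_of_bounded (B := 1) ?_ (fun w => ?_) _ _
    · exact (measurable_const.sub (hmm.comp (measurable_const_add x))).mul
        (hum.comp (measurable_const_add x))
    · have h1 := markMass_mem (S := S) (x + w)
      have h2 := voidProb_mem (r := r) (S := S) (x + w)
      rw [abs_le]
      constructor <;> nlinarith [h1.1, h1.2, h2.1, h2.2]
  have hIv : ∀ x, IntervalIntegrable (fun w => r * Real.exp (-(r * w)) *
      ((1 - markMass S (x + w)) * (E (x + w) - voidProb r S (x + w)))) volume 0 1 := by
    intro x
    refine IntervalIntegrable.continuousOn_mul ?_ (Continuous.continuousOn (by fun_prop))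
    refine intervalIntegrable_of_bounded (B := 1) ?_ (fun w => ?_) _ _
    · exact (measurable_const.sub (hmm.comp (measurable_const_add x))).mul
        ((hEc.measurable.comp (measurable_const_add x)).sub (hum.comp (measurable_const_add x)))
    · have h1 := markMass_mem (S := S) (x + w)
      have h2 := voidProb_mem (r := r) (S := S) (x + w)
      have h3 := hE01 (x + w)
      rw [abs_mul]
      refine mul_le_one₀ ?_ (abs_nonneg _) ?_ <;> rw [abs_le] <;> constructor <;>
        linarith [h1.1, h1.2, h2.1, h2.2, h3.1, h3.2]
  have hlow : (∀ y, markMass S y ≤ mb y) → E 0 ≤ voidProb r S 0 := by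
    intro hle
    rw [← sub_nonpos]
    refine nonpos_of_le_first_ring (r := r) (D := fun x => E x - voidProb r S x)
      (c := fun x => 1 - markMass S x) (hEc.measurable.sub hum) (measurable_const.sub hmm)
      (fun x => ?_) (fun x => ?_) (fun x hx => ?_) le_rfl
    · have h2 := voidProb_mem (r := r) (S := S) x
      have h3 := hE01 x
      rw [abs_le]
      constructor <;> linarith [h2.1, h2.2, h3.1, h3.2]
    · have h1 := markMass_mem (S := S) x
      exact ⟨by linarith [h1.2], by linarith [h1.1]⟩
    · rw [hEeq hx, hueq hx, add_sub_add_left_eq_sub, ← intervalIntegral.integral_sub (hIE x) (hIu x)]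
      refine intervalIntegral.integral_mono_on zero_le_one ((hIE x).sub (hIu x)) (hIv x)
        fun w _ => ?_
      rw [← mul_sub]
      refine mul_le_mul_of_nonneg_left ?_ (by positivity)
      have := mul_le_mul_of_nonneg_right (hle (x + w)) (hE01 (x + w)).1
      linarith
  have hup : (∀ y, markMass S y = mb y) → voidProb r S 0 ≤ E 0 := by
    intro heq
    rw [← sub_nonpos]
    refine nonpos_of_le_first_ring (r := r) (D := fun x => voidProb r S x - E x)
      (c := fun x => 1 - markMass S x) (hum.sub hEc.measurable) (measurable_const.sub hmm)
      (fun x => ?_) (fun x => ?_) (fun x hx => ?_) le_rfl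
    · have h2 := voidProb_mem (r := r) (S := S) x
      have h3 := hE01 x
      rw [abs_le]
      constructor <;> linarith [h2.1, h2.2, h3.1, h3.2]
    · have h1 := markMass_mem (S := S) x
      exact ⟨by linarith [h1.2], by linarith [h1.1]⟩
    · rw [hEeq hx, hueq hx, add_sub_add_left_eq_sub, ← intervalIntegral.integral_sub (hIu x) (hIE x)]
      refine le_of_eq ?_
      congr 1
      funext w
      rw [heq]
      ring
  rw [← hE0]
  constructor
  · intro h
    refine hlow fun y => ?_
    by_cases hy : y ∈ Ioc s t
    · simp only [hmbdef, indicator_of_mem hy]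
      rw [le_div_iff₀ hr0, mul_comm]
      exact h y hy
    · rw [hout y hy]; simp [hmbdef, indicator_of_notMem hy]
  · intro h
    have heq : ∀ y, markMass S y = mb y := fun y => by
      by_cases hy : y ∈ Ioc s t
      · simp only [hmbdef, indicator_of_mem hy]
        rw [h y hy]; field_simp
      · rw [hout y hy]; simp [hmbdef, indicator_of_notMem hy]
    exact le_antisymm (hup heq) (hlow fun y => (heq y).le)

end

/-! ### Probabilities for one and for two clocks -/

section
variable {r : ℝ} [hr : Fact (0 < r)]

lemma ae_ringTime_unbounded : ∀ᵐ z ∂(clockLaw r), ∃ k, 1 < ringTime z k := by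
  have hr0 := hr.out
  -- If all ring times are at most `1`, so are all waiting times.
  have hsub : ∀ᵐ z ∂(clockLaw r), ¬ (∃ k, 1 < ringTime z k) →
      z ∈ ⋂ m : ℕ, (Finset.range m : Set ℕ).pi fun _ => {p : ℝ × ℝ | p.1 ≤ 1} := by
    filter_upwards [ae_clock_wait_pos (r := r)] with z hz h
    push Not at h
    simp only [mem_iInter, Set.mem_pi, mem_ofPred_eq]
    intro _ i _
    refine le_trans ?_ (h i)
    exact Finset.single_le_sum (f := fun i => (z i).1) (fun j _ => (hz j).le) (by simp)
  have hzero : clockLaw r (⋂ m : ℕ, (Finset.range m : Set ℕ).pi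
      fun _ => {p : ℝ × ℝ | p.1 ≤ 1}) = 0 := by
    have hlt : waitLaw r {p : ℝ × ℝ | p.1 ≤ 1} < 1 := by
      have h1 : {p : ℝ × ℝ | p.1 ≤ 1} = Iic 1 ×ˢ univ := by ext p; simp
      have h2 := cdf_expMeasure_eq hr0 1
      rw [ProbabilityTheory.cdf_eq_real, if_pos zero_le_one] at h2
      rw [waitLaw, h1, Measure.prod_prod, measure_univ, mul_one]
      have h3 : expMeasure r (Iic 1) = ENNReal.ofReal (1 - Real.exp (-(r * 1))) := by
        rw [← h2, ofReal_measureReal]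
      rw [h3, ← ENNReal.ofReal_one]
      exact (ENNReal.ofReal_lt_ofReal_iff one_pos).2 (by linarith [Real.exp_pos (-(r * 1))])
    refine le_antisymm (ge_of_tendsto' (ENNReal.tendsto_pow_atTop_nhds_zero_of_lt_one hlt)
      fun m => ?_) (zero_le)
    refine (measure_mono (iInter_subset _ m)).trans ?_
    rw [clockLaw, Measure.infinitePi_pi _ fun i _ =>
      measurableSet_le measurable_fst measurable_const]
    simp
  have hz := measure_eq_zero_iff_ae_notMem.1 hzero
  filter_upwards [hsub, hz] with z h1 h2
  by_contra h
  exact h2 (h1 h)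

lemma ae_mark_mem : ∀ᵐ z ∂(clockLaw r), ∀ k, (z k).2 ∈ Icc (0 : ℝ) 1 := by
  rw [ae_all_iff]
  intro k
  refine (measurePreserving_eval_infinitePi (fun _ : ℕ => waitLaw r) k).quasiMeasurePreserving.ae
    (p := fun p : ℝ × ℝ => p.2 ∈ Icc (0 : ℝ) 1) ?_
  have h : ∀ᵐ u ∂((volume : Measure ℝ).restrict (Icc 0 1)), u ∈ Icc (0 : ℝ) 1 :=
    ae_restrict_mem measurableSet_Icc
  exact Measure.quasiMeasurePreserving_snd.ae h

/-- The clock has a ring in `(s, t]` whose proposal is accepted for the threshold `ℓ`. -/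
def HasAccepted (r : ℝ) (ℓ : ℝ → ℝ) (s t : ℝ) (z : ℕ → ℝ × ℝ) : Prop :=
  ∃ k, s < ringTime z k ∧ ringTime z k ≤ t ∧ r * (z k).2 ≤ ℓ (ringTime z k)

lemma measurableSet_threshold {ℓ : ℝ → ℝ} (hℓ : Measurable ℓ) (r s t : ℝ) :
    MeasurableSet {p : ℝ × ℝ | s < p.1 ∧ p.1 ≤ t ∧ r * p.2 ≤ ℓ p.1} :=
  (measurableSet_lt measurable_const measurable_fst).inter
    ((measurableSet_le measurable_fst measurable_const).inter
      (measurableSet_le (measurable_snd.const_mul r) (hℓ.comp measurable_fst)))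

lemma setOf_not_hasAccepted (r : ℝ) (ℓ : ℝ → ℝ) (s t : ℝ) :
    {z | ¬ HasAccepted r ℓ s t z} =
      voidEvent {p : ℝ × ℝ | s < p.1 ∧ p.1 ≤ t ∧ r * p.2 ≤ ℓ p.1} 0 := by
  ext z
  simp [HasAccepted, voidEvent]

lemma measurableSet_hasAccepted {ℓ : ℝ → ℝ} (hℓ : Measurable ℓ) (r s t : ℝ) :
    MeasurableSet {z | HasAccepted r ℓ s t z} := by
  have := measurableSet_voidEvent (measurableSet_threshold hℓ r s t) 0
  rw [← setOf_not_hasAccepted] at this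
  have h : {z | HasAccepted r ℓ s t z} = {z | ¬ HasAccepted r ℓ s t z}ᶜ := by ext z; simp
  rw [h]
  exact this.compl

/-- Accepted proposals form a Poisson process of intensity `ℓ`. -/
lemma prob_not_hasAccepted {ℓ : ℝ → ℝ} (hℓ : Continuous ℓ) (hℓm : ∀ y, ℓ y ∈ Icc (0 : ℝ) r)
    {s t : ℝ} (h0s : 0 ≤ s) (hst : s ≤ t) (ht1 : t ≤ 1) :
    (clockLaw r).real {z | ¬ HasAccepted r ℓ s t z} = Real.exp (-∫ y in s..t, ℓ y) := by
  have hr0 := hr.out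
  rw [setOf_not_hasAccepted]
  refine (voidProb_compare (r := r) (measurableSet_threshold hℓ.measurable r s t) h0s hst ht1
    (fun p hp => ⟨hp.1, hp.2.1⟩) hℓ (fun y => (hℓm y).1)).2 fun y hy => ?_
  have : {u | (y, u) ∈ {p : ℝ × ℝ | s < p.1 ∧ p.1 ≤ t ∧ r * p.2 ≤ ℓ p.1}} = Iic (ℓ y / r) := by
    ext u
    simp only [mem_ofPred_eq, mem_Iic, le_div_iff₀ hr0, hy.1, hy.2, true_and, mul_comm]
  have h1 : ℓ y / r ∈ Icc (0 : ℝ) 1 :=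
    ⟨div_nonneg (hℓm y).1 hr0.le, (div_le_one hr0).2 (hℓm y).2⟩
  have h2 : Iic (ℓ y / r) ∩ Icc 0 1 = Icc 0 (ℓ y / r) := by
    ext u
    simp only [mem_inter_iff, mem_Iic, mem_Icc]
    constructor
    · rintro ⟨h, h', -⟩; exact ⟨h', h⟩
    · rintro ⟨h, h'⟩; exact ⟨h', h, h'.trans h1.2⟩
  rw [markMass, this, measureReal_restrict_apply measurableSet_Iic, h2, Real.volume_real_Icc_of_le h1.1]
  field_simp
  ring

/-- The clock rings in `(s, t]`. -/
def HasRing (s t : ℝ) (z : ℕ → ℝ × ℝ) : Prop := ∃ k, s < ringTime z k ∧ ringTime z k ≤ t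

lemma measurableSet_hasRing (s t : ℝ) : MeasurableSet {z | HasRing s t z} := by
  have : {z | HasRing s t z} = ⋃ k, {z | s < ringTime z k ∧ ringTime z k ≤ t} := by
    ext z; simp [HasRing]
  rw [this]
  exact MeasurableSet.iUnion fun k =>
    (measurableSet_lt measurable_const (measurable_ringTime k)).inter
      (measurableSet_le (measurable_ringTime k) measurable_const)

lemma prob_not_hasRing {s t : ℝ} (h0s : 0 ≤ s) (hst : s ≤ t) (ht1 : t ≤ 1) :
    (clockLaw r).real {z | ¬ HasRing s t z} = Real.exp (-(r * (t - s))) := by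
  have hr0 := hr.out
  have h := prob_not_hasAccepted (r := r) (ℓ := fun _ => r) continuous_const
    (fun _ => ⟨hr0.le, le_rfl⟩) h0s hst ht1
  rw [intervalIntegral.integral_const, smul_eq_mul, mul_comm] at h
  rw [← h]
  refine measureReal_congr ?_
  filter_upwards [ae_mark_mem (r := r)] with z hz
  refine propext (not_congr ⟨?_, ?_⟩)
  · rintro ⟨k, h1, h2⟩
    exact ⟨k, h1, h2, mul_le_of_le_one_right hr0.le (hz k).2⟩
  · rintro ⟨k, h1, h2, -⟩
    exact ⟨k, h1, h2⟩

lemma prob_hasRing_le {s t : ℝ} (h0s : 0 ≤ s) (hst : s ≤ t) (ht1 : t ≤ 1) :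
    (clockLaw r).real {z | HasRing s t z} ≤ r * (t - s) := by
  have h := prob_not_hasRing (r := r) h0s hst ht1
  have h2 : {z | ¬ HasRing s t z} = {z | HasRing s t z}ᶜ := rfl
  rw [h2, probReal_compl_eq_one_sub (measurableSet_hasRing s t)] at h
  linarith [Real.add_one_le_exp (-(r * (t - s)))]

/-- The clock rings in `(s, t]` with a mark so close to the threshold `θ` that the outcome of the
proposal could be changed by an error `ρ` in the threshold. -/
def HasClose (r : ℝ) (θ ρ : ℝ → ℝ) (s t : ℝ) (z : ℕ → ℝ × ℝ) : Prop :=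
  ∃ k, s < ringTime z k ∧ ringTime z k ≤ t ∧
    |r * (z k).2 - θ (ringTime z k)| ≤ ρ (ringTime z k)

/-- The marks within `ρ` of the threshold have intensity at most `2 ρ`; the threshold `θ` itself need
only be measurable. -/
lemma prob_hasClose_le {θ ρ : ℝ → ℝ} (hθ : Measurable θ) (hρ : Continuous ρ) (hρ0 : ∀ y, 0 ≤ ρ y)
    {s t : ℝ} (h0s : 0 ≤ s) (hst : s ≤ t) (ht1 : t ≤ 1) :
    (clockLaw r).real {z | HasClose r θ ρ s t z} ≤ ∫ y in s..t, 2 * ρ y := by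
  have hr0 := hr.out
  set S : Set (ℝ × ℝ) := {p | s < p.1 ∧ p.1 ≤ t ∧ |r * p.2 - θ p.1| ≤ ρ p.1} with hSdef
  have hS : MeasurableSet S := (measurableSet_lt measurable_const measurable_fst).inter
    ((measurableSet_le measurable_fst measurable_const).inter
      (measurableSet_le (measurable_norm.comp ((measurable_snd.const_mul r).sub
        (hθ.comp measurable_fst))) (hρ.measurable.comp measurable_fst)))
  have h := (voidProb_compare (r := r) hS h0s hst ht1
    (fun p hp => ⟨hp.1, hp.2.1⟩) (ℓ := fun y => 2 * ρ y) (by fun_prop)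
    (fun y => mul_nonneg two_pos.le (hρ0 y))).1 fun y hy => by
    have hsub : {u | (y, u) ∈ S} ⊆ Icc ((θ y - ρ y) / r) ((θ y + ρ y) / r) := by
      rintro u ⟨-, -, hu⟩
      have hu := abs_le.1 hu
      simp only at hu
      exact ⟨(div_le_iff₀ hr0).2 (by linarith [hu.1]), (le_div_iff₀ hr0).2 (by linarith [hu.2])⟩
    have h1 : markMass S y ≤ volume.real (Icc ((θ y - ρ y) / r) ((θ y + ρ y) / r)) := by
      refine (measureReal_mono hsub).trans ?_
      rw [measureReal_restrict_apply measurableSet_Icc]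
      exact measureReal_mono inter_subset_left (by simp)
    rw [Real.volume_real_Icc_of_le (by gcongr; linarith [hρ0 y])] at h1
    calc r * markMass S y ≤ r * ((θ y + ρ y) / r - (θ y - ρ y) / r) :=
          mul_le_mul_of_nonneg_left h1 hr0.le
      _ = 2 * ρ y := by field_simp; ring
  have hV : {z | HasClose r θ ρ s t z}ᶜ = voidEvent S 0 := by
    ext z; simp [HasClose, voidEvent, hSdef]
  have hVm := measurableSet_voidEvent hS 0
  have hm : MeasurableSet {z | HasClose r θ ρ s t z} := by
    rw [← hV] at hVm; exact MeasurableSet.of_compl hVm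
  rw [voidProb, ← hV, probReal_compl_eq_one_sub hm] at h
  linarith [Real.add_one_le_exp (-∫ y in s..t, 2 * ρ y)]

lemma ae_ringTime_ne {y : ℝ} (hy0 : 0 < y) (hy1 : y ≤ 1) :
    ∀ᵐ z ∂(clockLaw r), ∀ k, ringTime z k ≠ y := by
  have hr0 := hr.out
  have hsub : ∀ ε ∈ Ioc 0 y, (clockLaw r).real {z | ∃ k, ringTime z k = y} ≤ r * ε := by
    intro ε hε
    refine (measureReal_mono ?_).trans
      ((prob_hasRing_le (r := r) (s := y - ε) (t := y) (by linarith [hε.2]) (by linarith [hε.1])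
        hy1).trans (by ring_nf; rfl))
    rintro z ⟨k, hk⟩
    exact ⟨k, by rw [hk]; linarith [hε.1], hk.le⟩
  have h0 : (clockLaw r).real {z | ∃ k, ringTime z k = y} = 0 := by
    refine le_antisymm (le_of_forall_pos_le_add fun ε hε => ?_) measureReal_nonneg
    rw [zero_add]
    refine (hsub (min (ε / r) y) ⟨lt_min (div_pos hε hr0) hy0, min_le_right _ _⟩).trans ?_
    calc r * min (ε / r) y ≤ r * (ε / r) := mul_le_mul_of_nonneg_left (min_le_left _ _) hr0.le
      _ = ε := by field_simp
  have h1 : clockLaw r {z | ∃ k, ringTime z k = y} = 0 :=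
    (measureReal_eq_zero_iff (by simp)).1 h0
  filter_upwards [measure_eq_zero_iff_ae_notMem.1 h1] with z hz k hk
  exact hz ⟨k, hk⟩

end

section
variable {r : ℝ}

open Classical in
/-- The time of the last accepted ring in `(b, t]`, or `b` if there is none. -/
def lastAccepted (r : ℝ) (m : ℝ → ℝ) (b t : ℝ) (z : ℕ → ℝ × ℝ) : ℝ :=
  ⨆ k, if b < ringTime z k ∧ ringTime z k ≤ t ∧ r * (z k).2 ≤ m (ringTime z k)
    then ringTime z k else b

lemma lastAccepted_le_iff {m : ℝ → ℝ} {b t s : ℝ} (hbs : b ≤ s) (z : ℕ → ℝ × ℝ) :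
    lastAccepted r m b t z ≤ s ↔ ¬ HasAccepted r m s t z := by
  classical
  have hbdd : BddAbove (range fun k => if b < ringTime z k ∧ ringTime z k ≤ t ∧
      r * (z k).2 ≤ m (ringTime z k) then ringTime z k else b) := by
    refine ⟨max b t, ?_⟩
    rintro _ ⟨k, rfl⟩
    dsimp only
    split_ifs with h
    · exact le_max_of_le_right h.2.1
    · exact le_max_left _ _
  unfold lastAccepted
  rw [ciSup_le_iff hbdd]
  constructor
  · rintro h ⟨k, h1, h2, h3⟩
    have := h k
    rw [if_pos ⟨hbs.trans_lt h1, h2, h3⟩] at this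
    exact absurd h1 (not_lt.2 this)
  · intro h k
    split_ifs with hk
    · by_contra! h1
      exact h ⟨k, h1, hk.2⟩
    · exact hbs

lemma lastAccepted_mem {m : ℝ → ℝ} {b t : ℝ} (hbt : b ≤ t) (z : ℕ → ℝ × ℝ) :
    lastAccepted r m b t z ∈ Icc b t := by
  constructor
  · by_contra! h
    classical
    have hbdd : BddAbove (range fun k => if b < ringTime z k ∧ ringTime z k ≤ t ∧
        r * (z k).2 ≤ m (ringTime z k) then ringTime z k else b) := by
      refine ⟨max b t, ?_⟩
      rintro _ ⟨k, rfl⟩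
      dsimp only
      split_ifs with h
      · exact le_max_of_le_right h.2.1
      · exact le_max_left _ _
    have h0 := le_ciSup hbdd 0
    have h1 : b ≤ if b < ringTime z 0 ∧ ringTime z 0 ≤ t ∧
        r * (z 0).2 ≤ m (ringTime z 0) then ringTime z 0 else b := by
      split_ifs with h2
      exacts [h2.1.le, le_rfl]
    exact absurd h (not_lt.2 (h1.trans h0))
  · rw [lastAccepted_le_iff hbt]
    rintro ⟨k, h1, h2, -⟩
    exact absurd h1 (not_lt.2 h2)

end

section
variable {Ω : Type*} [MeasurableSpace Ω] {r : ℝ}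

lemma measurable_ringTime_comp {z : Ω → ℕ → ℝ × ℝ} (hz : Measurable z) (k : ℕ) :
    Measurable fun ω => ringTime (z ω) k := (measurable_ringTime k).comp hz

lemma measurable_mark_comp {z : Ω → ℕ → ℝ × ℝ} (hz : Measurable z) (k : ℕ) :
    Measurable fun ω => (z ω k).2 := measurable_snd.comp ((measurable_pi_apply k).comp hz)

lemma measurable_lastAccepted {m : Ω → ℝ → ℝ} (hm : Measurable (Function.uncurry m))
    {b : Ω → ℝ} (hb : Measurable b) (t : ℝ) {z : Ω → ℕ → ℝ × ℝ} (hz : Measurable z) :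
    Measurable fun ω => lastAccepted r (m ω) (b ω) t (z ω) := by
  unfold lastAccepted
  refine Measurable.iSup fun k => ?_
  have hk := measurable_ringTime_comp hz k
  refine Measurable.ite ?_ hk hb
  exact (measurableSet_lt hb hk).inter ((measurableSet_le hk measurable_const).inter
    (measurableSet_le ((measurable_mark_comp hz k).const_mul r) (hm.comp (measurable_id.prodMk hk))))

lemma measurableSet_hasAccepted_comp {ℓ : Ω → ℝ → ℝ} (hℓ : Measurable (Function.uncurry ℓ))
    {s : Ω → ℝ} (hs : Measurable s) (t : ℝ) {z : Ω → ℕ → ℝ × ℝ} (hz : Measurable z) :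
    MeasurableSet {ω | HasAccepted r (ℓ ω) (s ω) t (z ω)} := by
  have : {ω | HasAccepted r (ℓ ω) (s ω) t (z ω)} = ⋃ k, {ω | s ω < ringTime (z ω) k ∧
      ringTime (z ω) k ≤ t ∧ r * (z ω k).2 ≤ ℓ ω (ringTime (z ω) k)} := by
    ext z; simp [HasAccepted]
  rw [this]
  refine MeasurableSet.iUnion fun k => ?_
  have hk := measurable_ringTime_comp hz k
  exact (measurableSet_lt hs hk).inter ((measurableSet_le hk measurable_const).inter
    (measurableSet_le ((measurable_mark_comp hz k).const_mul r) (hℓ.comp (measurable_id.prodMk hk))))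

lemma measurableSet_hasClose_comp {θ : Ω → ℝ → ℝ} (hθ : Measurable (Function.uncurry θ))
    {ρ : ℝ → ℝ} (hρ : Measurable ρ) (s t : ℝ) {z : Ω → ℕ → ℝ × ℝ} (hz : Measurable z) :
    MeasurableSet {ω | HasClose r (θ ω) ρ s t (z ω)} := by
  have : {ω | HasClose r (θ ω) ρ s t (z ω)} = ⋃ k, {ω | s < ringTime (z ω) k ∧
      ringTime (z ω) k ≤ t ∧
      |r * (z ω k).2 - θ ω (ringTime (z ω) k)| ≤ ρ (ringTime (z ω) k)} := by
    ext z; simp [HasClose]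
  rw [this]
  refine MeasurableSet.iUnion fun k => ?_
  have hk := measurable_ringTime_comp hz k
  exact (measurableSet_lt measurable_const hk).inter ((measurableSet_le hk measurable_const).inter
    (measurableSet_le (measurable_norm.comp (((measurable_mark_comp hz k).const_mul r).sub
      (hθ.comp (measurable_id.prodMk hk)))) (hρ.comp hk)))

end

/-- State at time `t` of an edge which is absent at time `b`, is switched on and off by two clocks
with the given thresholds and is not touched otherwise: there is an accepted proposal to switch it
on after the last accepted proposal to switch it off. -/
def EdgeActive (r : ℝ) (ℓ m : ℝ → ℝ) (b t : ℝ) (zon zoff : ℕ → ℝ × ℝ) : Prop :=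
  HasAccepted r ℓ (lastAccepted r m b t zoff) t zon

section
variable {r : ℝ} [hr : Fact (0 < r)]

/-- The probability that the last accepted ring of the first clock comes after that of the
second. The integrand is the density of the last accepted ring of the first clock times the
probability that the second clock has no accepted ring after it. -/
lemma prob_edgeActive {ℓ m : ℝ → ℝ} (hℓ : Continuous ℓ) (hm : Continuous m)
    (hℓr : ∀ y, ℓ y ∈ Icc (0 : ℝ) r) (hmr : ∀ y, m y ∈ Icc (0 : ℝ) r) {b t : ℝ}
    (hb : 0 ≤ b) (hbt : b ≤ t) (ht : t ≤ 1) :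
    ∫ zoff, (clockLaw r).real {zon | EdgeActive r ℓ m b t zon zoff} ∂(clockLaw r) =
      ∫ s in b..t, ℓ s * Real.exp (-∫ y in s..t, ℓ y) * Real.exp (-∫ y in s..t, m y) := by
  set T := lastAccepted r m b t with hT
  have hTm : Measurable T := measurable_lastAccepted (Ω := ℕ → ℝ × ℝ) (r := r) (m := fun _ => m)
    (hm.measurable.comp measurable_snd) measurable_const t measurable_id
  have hint : ∀ f : ℝ → ℝ, Continuous f → ∀ a b, IntervalIntegrable f volume a b := fun f hf a b =>
    hf.intervalIntegrable a b
  set E : ℝ → ℝ := fun s => Real.exp (-∫ y in s..t, ℓ y) with hE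
  have hEd : ∀ s, HasDerivAt E (ℓ s * E s) s := fun s => by
    have := (intervalIntegral.integral_hasDerivAt_left (hint ℓ hℓ s t)
      (hℓ.stronglyMeasurableAtFilter _ _) hℓ.continuousAt).neg.exp
    rw [neg_neg, mul_comm] at this
    exact this
  have hEc : Continuous E := continuous_iff_continuousAt.2 fun s => (hEd s).continuousAt
  have hℓE : Continuous fun s => ℓ s * E s := hℓ.mul hEc
  have hEt : E t = 1 := by simp [hE]
  -- `1 - E T` is the integral of `ℓ E` over the times after `T`
  have h1 : ∀ zoff, (clockLaw r).real {zon | EdgeActive r ℓ m b t zon zoff} =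
      ∫ s, (Ioc b t).indicator (fun s => ({z | T z ≤ s}.indicator (fun _ => ℓ s * E s) zoff)) s := by
    intro zoff
    have hTI := lastAccepted_mem (r := r) (m := m) hbt zoff
    have h2 : (clockLaw r).real {zon | ¬ HasAccepted r ℓ (T zoff) t zon} = E (T zoff) :=
      prob_not_hasAccepted hℓ hℓr (hb.trans hTI.1) hTI.2 ht
    have h3 := probReal_compl_eq_one_sub (μ := clockLaw r)
      (measurableSet_hasAccepted hℓ.measurable r (T zoff) t)
    have h4 : (clockLaw r).real {zon | EdgeActive r ℓ m b t zon zoff} = 1 - E (T zoff) := by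
      rw [← h2]
      change (clockLaw r).real {zon | HasAccepted r ℓ (T zoff) t zon} = _
      have : {zon | ¬ HasAccepted r ℓ (T zoff) t zon} = {zon | HasAccepted r ℓ (T zoff) t zon}ᶜ :=
        rfl
      rw [this, h3]; ring
    have h5 : ∫ s in (T zoff)..t, ℓ s * E s = 1 - E (T zoff) := by
      rw [intervalIntegral.integral_eq_sub_of_hasDerivAt (fun s _ => hEd s)
        (hint _ hℓE _ _), hEt]
    rw [h4, ← h5, intervalIntegral.integral_of_le hTI.2, ← integral_Icc_eq_integral_Ioc,
      ← integral_indicator measurableSet_Icc]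
    refine integral_congr_ae ?_
    have hne : ∀ᵐ s : ℝ, s ≠ b := by simp [ae_iff]
    filter_upwards [hne] with s hs
    by_cases hs1 : s ∈ Ioc b t
    · rw [indicator_of_mem hs1]
      by_cases hs2 : T zoff ≤ s
      · rw [indicator_of_mem (show s ∈ Icc (T zoff) t from ⟨hs2, hs1.2⟩),
          indicator_of_mem (show zoff ∈ {z | T z ≤ s} from hs2)]
      · rw [indicator_of_notMem (fun h => hs2 h.1),
          indicator_of_notMem (show zoff ∉ {z | T z ≤ s} from hs2)]
    · rw [indicator_of_notMem hs1, indicator_of_notMem]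
      intro h
      exact hs1 ⟨lt_of_le_of_ne (hTI.1.trans h.1) (Ne.symm hs), h.2⟩
  simp_rw [h1]
  rw [integral_integral_swap]
  · rw [intervalIntegral.integral_of_le hbt, ← integral_indicator measurableSet_Ioc]
    congr 1
    funext s
    by_cases hs : s ∈ Ioc b t
    · simp only [indicator_of_mem hs]
      have hms : MeasurableSet {z | T z ≤ s} := measurableSet_le hTm measurable_const
      rw [integral_indicator_const _ hms, smul_eq_mul]
      have : {z | T z ≤ s} = {z | ¬ HasAccepted r m s t z} := by
        ext z
        exact lastAccepted_le_iff hs.1.le z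
      rw [this, prob_not_hasAccepted hm hmr (hb.trans hs.1.le) hs.2 ht]
      ring
    · simp [indicator_of_notMem hs]
  · have hmeas : Measurable (Function.uncurry fun (z : ℕ → ℝ × ℝ) (s : ℝ) =>
        (Ioc b t).indicator (fun s => ({z | T z ≤ s}.indicator (fun _ => ℓ s * E s) z)) s) := by
      have : (Function.uncurry fun (z : ℕ → ℝ × ℝ) (s : ℝ) =>
        (Ioc b t).indicator (fun s => ({z | T z ≤ s}.indicator (fun _ => ℓ s * E s) z)) s) =
        ({p : (ℕ → ℝ × ℝ) × ℝ | p.2 ∈ Ioc b t} ∩ {p | T p.1 ≤ p.2}).indicator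
          fun p => ℓ p.2 * E p.2 := by
        funext p
        simp only [Function.uncurry]
        by_cases h1 : p.2 ∈ Ioc b t
        · rw [indicator_of_mem h1]
          by_cases h2 : T p.1 ≤ p.2
          · rw [indicator_of_mem (show p.1 ∈ {z | T z ≤ p.2} from h2), indicator_of_mem
              (show p ∈ {p : (ℕ → ℝ × ℝ) × ℝ | p.2 ∈ Ioc b t} ∩ {p | T p.1 ≤ p.2} from ⟨h1, h2⟩)]
          · rw [indicator_of_notMem (show p.1 ∉ {z | T z ≤ p.2} from h2),
              indicator_of_notMem fun h => h2 h.2]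
        · rw [indicator_of_notMem h1, indicator_of_notMem fun h => h1 h.1]
      rw [this]
      exact (hℓE.measurable.comp measurable_snd).indicator
        ((measurable_snd measurableSet_Ioc).inter
          (measurableSet_le (hTm.comp measurable_fst) measurable_snd))
    obtain ⟨B, hB⟩ := (isCompact_Icc (a := b) (b := t)).exists_bound_of_continuousOn
      hℓE.continuousOn
    have hdom : Integrable (fun p : (ℕ → ℝ × ℝ) × ℝ => (Ioc b t).indicator (fun _ => |B|) p.2)
        ((clockLaw r).prod volume) :=
      Integrable.comp_snd (f := (Ioc b t).indicator fun _ => |B|) ((integrableOn_const (by simp)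
        (by simp)).integrable_indicator measurableSet_Ioc) (clockLaw r)
    refine hdom.mono' hmeas.aestronglyMeasurable (ae_of_all _ fun p => ?_)
    simp only [Function.uncurry]
    by_cases h1 : p.2 ∈ Ioc b t
    · rw [indicator_of_mem h1, indicator_of_mem h1]
      by_cases h2 : T p.1 ≤ p.2
      · rw [indicator_of_mem (show p.1 ∈ {z | T z ≤ p.2} from h2)]
        exact (hB p.2 (Ioc_subset_Icc_self h1)).trans (le_abs_self B)
      · rw [indicator_of_notMem (show p.1 ∉ {z | T z ≤ p.2} from h2), norm_zero]
        exact abs_nonneg B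
    · rw [indicator_of_notMem h1, indicator_of_notMem h1, norm_zero]

end

/-- Variation of constants for the equation `φ' = (1 - φ) ℓ - φ m`. -/
lemma eq_integral_of_linear_ode {φ ℓ m : ℝ → ℝ} (hℓ : Continuous ℓ) (hm : Continuous m) {b t : ℝ}
    (hbt : b ≤ t) (h0 : φ b = 0)
    (hd : ∀ s ∈ Icc b t, HasDerivWithinAt φ ((1 - φ s) * ℓ s - φ s * m s) (Icc b t) s) :
    φ t = ∫ s in b..t, ℓ s * Real.exp (-∫ y in s..t, ℓ y) * Real.exp (-∫ y in s..t, m y) := by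
  have hint : ∀ f : ℝ → ℝ, Continuous f → ∀ s, HasDerivAt (fun s => Real.exp (-∫ y in s..t, f y))
      (f s * Real.exp (-∫ y in s..t, f y)) s := fun f hf s => by
    have := (intervalIntegral.integral_hasDerivAt_left (hf.intervalIntegrable s t)
      (hf.stronglyMeasurableAtFilter volume _) hf.continuousAt).neg.exp
    rw [neg_neg, mul_comm] at this
    exact this
  have h1 := hint ℓ hℓ
  have h2 := hint m hm
  have c1 : Continuous fun s => Real.exp (-∫ y in s..t, ℓ y) :=
    continuous_iff_continuousAt.2 fun s => (h1 s).continuousAt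
  have c2 : Continuous fun s => Real.exp (-∫ y in s..t, m y) :=
    continuous_iff_continuousAt.2 fun s => (h2 s).continuousAt
  have hφc : ContinuousOn φ (Icc b t) := fun s hs => (hd s hs).continuousWithinAt
  have := intervalIntegral.integral_eq_sub_of_hasDerivAt_of_le hbt
    (f := fun s => φ s * (Real.exp (-∫ y in s..t, ℓ y) * Real.exp (-∫ y in s..t, m y)))
    (f' := fun s => ℓ s * Real.exp (-∫ y in s..t, ℓ y) * Real.exp (-∫ y in s..t, m y))
    (hφc.mul (c1.mul c2).continuousOn) (fun s hs => by
      have h3 := (hd s (Ioo_subset_Icc_self hs)).hasDerivAt (Icc_mem_nhds hs.1 hs.2)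
      convert! h3.mul ((h1 s).mul (h2 s)) using 1
      simp only [Pi.mul_apply]
      ring)
    (((hℓ.mul c1).mul c2).intervalIntegrable _ _)
  rw [this, h0]
  simp

/-! ### Finite products of probability measures -/

section
variable {ι : Type*} [Fintype ι] {X : ι → Type*} [∀ i, MeasurableSpace (X i)]
  {μ : ∀ i, Measure (X i)} [∀ i, IsProbabilityMeasure (μ i)]

open Classical in
/-- Replace the coordinates in `s` of the first point by those of the second. -/
def resample (s : Set ι) (p : (∀ i, X i) × (∀ i, X i)) (i : ι) : X i :=
  if i ∈ s then p.2 i else p.1 i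

omit [Fintype ι] in
lemma measurable_resample (s : Set ι) : Measurable (resample (X := X) s) := by
  refine measurable_pi_iff.2 fun i => ?_
  unfold resample
  by_cases hi : i ∈ s
  · simp only [hi, if_true]; exact (measurable_pi_apply i).comp measurable_snd
  · simp only [hi, if_false]; exact (measurable_pi_apply i).comp measurable_fst

/-- Resampling some of the coordinates of a product measure does not change it. -/
lemma measurePreserving_resample (s : Set ι) :
    MeasurePreserving (resample s) ((Measure.pi μ).prod (Measure.pi μ)) (Measure.pi μ) := by
  classical
  refine ⟨measurable_resample s, (Measure.pi_eq fun t ht => ?_).symm⟩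
  rw [Measure.map_apply (measurable_resample s) (.univ_pi ht)]
  have h : resample s ⁻¹' (univ.pi t) =
      (univ.pi fun i => if i ∈ s then univ else t i) ×ˢ
        (univ.pi fun i => if i ∈ s then t i else univ) := by
    ext p
    simp only [resample, mem_preimage, Set.mem_pi, mem_univ, true_implies, mem_prod]
    rw [← forall_and]
    refine forall_congr' fun i => ?_
    by_cases hi : i ∈ s <;> simp [hi]
  rw [h, Measure.prod_prod, Measure.pi_pi, Measure.pi_pi, ← Finset.prod_mul_distrib]
  refine Finset.prod_congr rfl fun i _ => ?_
  by_cases hi : i ∈ s <;> simp [hi]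

omit [Fintype ι] [∀ i, MeasurableSpace (X i)] in
lemma dependsOn_resample_left {β : Type*} {f : (∀ i, X i) → β} {s t : Set ι} (hf : DependsOn f t)
    (hst : Disjoint s t) (p : (∀ i, X i) × (∀ i, X i)) : f (resample s p) = f p.1 :=
  hf fun i hi => by
    have : i ∉ s := fun h => Set.disjoint_left.1 hst h hi
    simp [resample, this]

omit [Fintype ι] [∀ i, MeasurableSpace (X i)] in
lemma dependsOn_resample_right {β : Type*} {f : (∀ i, X i) → β} {s : Set ι} (hf : DependsOn f s)
    (p : (∀ i, X i) × (∀ i, X i)) : f (resample s p) = f p.2 :=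
  hf fun i hi => by simp [resample, hi]

/-- Integration over the coordinates in `s` while the others are frozen. -/
lemma integral_resample (s : Set ι) {f : (∀ i, X i) → ℝ} (hf : Integrable f (Measure.pi μ)) :
    ∫ z, f z ∂(Measure.pi μ) = ∫ x, ∫ y, f (resample s (x, y)) ∂(Measure.pi μ) ∂(Measure.pi μ) := by
  have h := measurePreserving_resample (μ := μ) s
  rw [← h.map_eq, integral_map h.measurable.aemeasurable
    (by rw [h.map_eq]; exact hf.aestronglyMeasurable), h.map_eq]
  exact integral_prod _ (h.integrable_comp_of_integrable hf)

/-- Functions of disjoint sets of coordinates are uncorrelated. -/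
lemma integral_mul_of_dependsOn {f g : (∀ i, X i) → ℝ} {s t : Set ι} (hf : DependsOn f s)
    (hg : DependsOn g t) (hst : Disjoint s t) (hfi : Measurable f) (hgi : Measurable g) :
    ∫ z, f z * g z ∂(Measure.pi μ) = (∫ z, f z ∂(Measure.pi μ)) * ∫ z, g z ∂(Measure.pi μ) := by
  have h := measurePreserving_resample (μ := μ) s
  have e : ∫ z, f z * g z ∂(Measure.pi μ) = ∫ p, f (resample s p) * g (resample s p)
      ∂((Measure.pi μ).prod (Measure.pi μ)) := by
    nth_rewrite 1 [← h.map_eq]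
    rw [integral_map h.measurable.aemeasurable (f := fun z => f z * g z)
      (hfi.mul hgi).aestronglyMeasurable]
  rw [e]
  simp_rw [dependsOn_resample_right hf, dependsOn_resample_left hg hst, mul_comm (f _)]
  rw [integral_prod_mul, mul_comm]

lemma integrable_of_measurable_bounded {Ω : Type*} [MeasurableSpace Ω] {P : Measure Ω}
    [IsFiniteMeasure P] {f : Ω → ℝ} (hf : Measurable f) {B : ℝ} (hB : ∀ ω, |f ω| ≤ B) :
    Integrable f P :=
  Integrable.of_bound hf.aestronglyMeasurable B (ae_of_all _ hB)

/-- The variance of a sum of `[0,1]`-valued functions of few coordinates each is at most the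
number of pairs of summands which share a coordinate. -/
lemma integral_sq_sum_sub_le {α : Type*} [Fintype α] {ξ : α → (∀ i, X i) → ℝ}
    {s : α → Set ι} (hξ : ∀ a, Measurable (ξ a)) (h01 : ∀ a z, ξ a z ∈ Icc (0 : ℝ) 1)
    (hs : ∀ a, DependsOn (ξ a) (s a)) {A : Finset (α × α)}
    (hA : ∀ p, p ∉ A → Disjoint (s p.1) (s p.2)) :
    ∫ z, (∑ a, (ξ a z - ∫ z, ξ a z ∂(Measure.pi μ))) ^ 2 ∂(Measure.pi μ) ≤ A.card := by
  set π := Measure.pi μ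
  set η : α → (∀ i, X i) → ℝ := fun a z => ξ a z - ∫ z, ξ a z ∂π with hη
  have hi : ∀ a, Integrable (ξ a) π := fun a => integrable_of_measurable_bounded (hξ a) (B := 1)
    fun z => by rw [abs_of_nonneg (h01 a z).1]; exact (h01 a z).2
  have hmean : ∀ a, ∫ z, ξ a z ∂π ∈ Icc (0 : ℝ) 1 := fun a =>
    ⟨integral_nonneg fun z => (h01 a z).1, by
      have := integral_mono (hi a) (integrable_const 1) fun z => (h01 a z).2
      simpa using this⟩
  have hηm : ∀ a, Measurable (η a) := fun a => (hξ a).sub_const _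
  have hη1 : ∀ a z, |η a z| ≤ 1 := fun a z => by
    rw [abs_le]
    constructor <;> linarith [(h01 a z).1, (h01 a z).2, (hmean a).1, (hmean a).2]
  have hη0 : ∀ a, ∫ z, η a z ∂π = 0 := fun a => by
    simp only [hη]
    rw [integral_sub (hi a) (integrable_const _)]
    simp
  have hηs : ∀ a, DependsOn (η a) (s a) := fun a x y h => by
    change ξ a x - _ = ξ a y - _
    rw [hs a h]
  have hpm : ∀ p : α × α, Measurable fun z => η p.1 z * η p.2 z := fun p => (hηm _).mul (hηm _)
  have hp1 : ∀ (p : α × α) z, |η p.1 z * η p.2 z| ≤ 1 := fun p z => by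
    rw [abs_mul]; exact mul_le_one₀ (hη1 _ _) (abs_nonneg _) (hη1 _ _)
  have e1 : ∀ z, (∑ a, η a z) ^ 2 = ∑ p : α × α, η p.1 z * η p.2 z := fun z => by
    rw [sq, Finset.sum_mul_sum, ← Finset.sum_product', Finset.univ_product_univ]
  change ∫ z, (∑ a, η a z) ^ 2 ∂π ≤ _
  simp_rw [e1]
  rw [integral_finsetSum _ fun p _ => integrable_of_measurable_bounded (hpm p) (hp1 p)]
  classical
  calc ∑ p : α × α, ∫ z, η p.1 z * η p.2 z ∂π ≤ ∑ p : α × α, if p ∈ A then (1 : ℝ) else 0 := by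
        refine Finset.sum_le_sum fun p _ => ?_
        split_ifs with hp
        · have := integral_mono (integrable_of_measurable_bounded (P := π) (hpm p) (hp1 p))
            (integrable_const 1) fun z => (le_abs_self _).trans (hp1 p z)
          simpa using this
        · rw [integral_mul_of_dependsOn (hηs _) (hηs _) (hA p hp) (hηm _) (hηm _), hη0, zero_mul]
    _ = A.card := by simp

/-- Chebyshev's inequality for sums of functions of few coordinates each. -/
lemma prob_sum_gt_le {α : Type*} [Fintype α] {ξ : α → (∀ i, X i) → ℝ}
    {s : α → Set ι} (hξ : ∀ a, Measurable (ξ a)) (h01 : ∀ a z, ξ a z ∈ Icc (0 : ℝ) 1)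
    (hs : ∀ a, DependsOn (ξ a) (s a)) {A : Finset (α × α)}
    (hA : ∀ p, p ∉ A → Disjoint (s p.1) (s p.2)) {q δ : ℝ} (hδ : 0 < δ)
    (hq : ∀ a, ∫ z, ξ a z ∂(Measure.pi μ) ≤ q) :
    (Measure.pi μ).real {z | Fintype.card α * q + δ < ∑ a, ξ a z} ≤ A.card / δ ^ 2 := by
  set π := Measure.pi μ
  set f : (∀ i, X i) → ℝ := fun z => (∑ a, (ξ a z - ∫ z, ξ a z ∂π)) ^ 2 with hf
  have hfm : Measurable f := (Finset.measurable_sum _ fun a _ => (hξ a).sub_const _).pow_const 2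
  have hmean : ∀ a, ∫ z, ξ a z ∂π ∈ Icc (0 : ℝ) 1 := fun a =>
    ⟨integral_nonneg fun z => (h01 a z).1, by
      have := integral_mono (integrable_of_measurable_bounded (P := π) (hξ a) (B := 1) fun z => by
        rw [abs_of_nonneg (h01 a z).1]; exact (h01 a z).2) (integrable_const 1)
        fun z => (h01 a z).2
      simpa using this⟩
  have hfi : Integrable f π := integrable_of_measurable_bounded hfm
    (B := (Fintype.card α : ℝ) ^ 2) fun z => by
    simp only [hf]
    rw [abs_of_nonneg (sq_nonneg _), ← sq_abs (∑ a, (ξ a z - ∫ z, ξ a z ∂π))]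
    refine pow_le_pow_left₀ (abs_nonneg _) ?_ 2
    refine (Finset.abs_sum_le_sum_abs _ _).trans ?_
    calc _ ≤ ∑ a : α, (1 : ℝ) := Finset.sum_le_sum fun a _ => by
          rw [abs_le]
          constructor <;> linarith [(h01 a z).1, (h01 a z).2, (hmean a).1, (hmean a).2]
      _ = _ := by simp
  have h1 := integral_sq_sum_sub_le hξ h01 hs hA (μ := μ)
  have h2 := mul_meas_ge_le_integral_of_nonneg (μ := π) (ae_of_all _ fun z => sq_nonneg _) hfi (δ ^ 2)
  rw [le_div_iff₀ (by positivity), mul_comm]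
  refine le_trans ?_ (h2.trans h1)
  refine mul_le_mul_of_nonneg_left (measureReal_mono fun z hz => ?_) (by positivity)
  have hz' : Fintype.card α * q + δ < ∑ a, ξ a z := hz
  have : ∑ a, ∫ z, ξ a z ∂π ≤ Fintype.card α * q :=
    (Finset.sum_le_sum fun a _ => hq a).trans (by simp)
  change δ ^ 2 ≤ (∑ a, (ξ a z - ∫ z, ξ a z ∂π)) ^ 2
  rw [Finset.sum_sub_distrib]
  exact pow_le_pow_left₀ hδ.le (by linarith) 2

end

/-! ### The space of all clocks -/

instance (n : ℕ) : Fintype (Clock n) :=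
  Fintype.ofInjective (fun c : Clock n => match c with
    | .vertex v => (Sum.inl v : Fin n ⊕ Sym2 (Fin n) ⊕ Sym2 (Fin n))
    | .on e => Sum.inr (Sum.inl e)
    | .off e => Sum.inr (Sum.inr e)) (by
      intro c c' h
      cases c <;> cases c' <;> simp_all)

instance (γ C : ℝ) [hγ : Fact (0 < γ)] [hC : Fact (0 < C)] {n : ℕ} (c : Clock n) :
    Fact (0 < c.rate γ C) :=
  ⟨by cases c <;> simp [Clock.rate, hγ.out, hC.out]⟩

/-- The values of all clocks. -/
abbrev Clocks (n : ℕ) : Type := Clock n → ℕ → ℝ × ℝ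

/-- The law of all clocks of the process on `n` vertices. -/
def clocksLaw (γ C : ℝ) [Fact (0 < γ)] [Fact (0 < C)] (n : ℕ) : Measure (Clocks n) :=
  Measure.pi fun c : Clock n => clockLaw (c.rate γ C)

instance (γ C : ℝ) [Fact (0 < γ)] [Fact (0 < C)] (n : ℕ) :
    IsProbabilityMeasure (clocksLaw γ C n) := by
  unfold clocksLaw; infer_instance

/-- The clocks on which the state of the pair `ij` depends. -/
def pairClocks {n : ℕ} (i j : Fin n) : Set (Clock n) :=
  {.vertex i, .vertex j, .on s(i, j), .off s(i, j)}

lemma disjoint_pairClocks {n : ℕ} {i j i' j' : Fin n} (h : i ≠ i' ∧ i ≠ j' ∧ j ≠ i' ∧ j ≠ j') :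
    Disjoint (pairClocks i j) (pairClocks i' j') := by
  rw [Set.disjoint_left]
  rintro c hc hc'
  simp only [pairClocks, mem_insert_iff, mem_singleton_iff] at hc hc'
  have hs : s(i, j) ≠ s(i', j') := by
    rw [Ne, Sym2.eq_iff]; tauto
  have hs' := hs.symm
  rcases hc with rfl | rfl | rfl | rfl <;> simp_all

/-- The edge clocks of the pair `ij`. -/
def edgeClocks {n : ℕ} (i j : Fin n) : Set (Clock n) := {.on s(i, j), .off s(i, j)}

lemma disjoint_edgeClocks {n : ℕ} {i j i' j' : Fin n} (h : s(i, j) ≠ s(i', j')) :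
    Disjoint (edgeClocks i j) (pairClocks i' j') := by
  rw [Set.disjoint_left]
  rintro c hc hc'
  simp only [pairClocks, edgeClocks, mem_insert_iff, mem_singleton_iff] at hc hc'
  rcases hc with rfl | rfl
  · simp only [reduceCtorEq, Clock.on.injEq, false_or, or_false] at hc'
    exact h hc'
  · simp only [reduceCtorEq, Clock.off.injEq, false_or] at hc'
    exact h hc'

open Classical in
/-- Ordered pairs of ordered pairs of vertices with a vertex in common. -/
def meetingPairs (n : ℕ) : Finset ((Fin n × Fin n) × (Fin n × Fin n)) :=
  Finset.univ.filter fun p => p.1.1 = p.2.1 ∨ p.1.1 = p.2.2 ∨ p.1.2 = p.2.1 ∨ p.1.2 = p.2.2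

lemma card_meetingPairs (n : ℕ) : ((meetingPairs n).card : ℝ) ≤ 4 * n ^ 3 := by
  classical
  let g : Fin 4 × Fin n × Fin n × Fin n → (Fin n × Fin n) × (Fin n × Fin n) := fun q =>
    if q.1 = 0 then ((q.2.1, q.2.2.1), (q.2.1, q.2.2.2))
    else if q.1 = 1 then ((q.2.1, q.2.2.1), (q.2.2.2, q.2.1))
    else if q.1 = 2 then ((q.2.2.1, q.2.1), (q.2.1, q.2.2.2))
    else ((q.2.2.1, q.2.1), (q.2.2.2, q.2.1))
  have hsub : meetingPairs n ⊆ Finset.univ.image g := by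
    rintro ⟨⟨a, b⟩, ⟨c, d⟩⟩ hp
    simp only [meetingPairs, Finset.mem_filter, Finset.mem_univ, true_and] at hp
    rw [Finset.mem_image]
    rcases hp with rfl | rfl | rfl | rfl
    · exact ⟨(0, a, b, d), Finset.mem_univ _, by simp [g]⟩
    · exact ⟨(1, a, b, c), Finset.mem_univ _, by simp [g]⟩
    · exact ⟨(2, b, a, d), Finset.mem_univ _, by simp [g]⟩
    · exact ⟨(3, b, a, c), Finset.mem_univ _, by simp [g]⟩
  have h := (Finset.card_le_card hsub).trans Finset.card_image_le
  rw [Finset.card_univ] at h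
  simp only [Fintype.card_prod, Fintype.card_fin] at h
  calc ((meetingPairs n).card : ℝ) ≤ ((4 * (n * (n * n)) : ℕ) : ℝ) := by exact_mod_cast h
    _ = 4 * n ^ 3 := by push_cast; ring

section
variable {γ C : ℝ} [hγ : Fact (0 < γ)] [hC : Fact (0 < C)] {n : ℕ}

/-- The law of large numbers for `[0,1]`-valued functions of the clocks of a pair. -/
lemma prob_pair_sum_gt_le {ξ : Fin n × Fin n → Clocks n → ℝ} (hξ : ∀ a, Measurable (ξ a))
    (h01 : ∀ a z, ξ a z ∈ Icc (0 : ℝ) 1) (hs : ∀ a, DependsOn (ξ a) (pairClocks a.1 a.2))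
    {q δ : ℝ} (hn : 0 < n) (hδ : 0 < δ) (hq : ∀ a, ∫ z, ξ a z ∂(clocksLaw γ C n) ≤ q) :
    (clocksLaw γ C n).real {z | (n : ℝ) ^ 2 * (q + δ) < ∑ a, ξ a z} ≤ 4 / (n * δ ^ 2) := by
  have hn' : (0 : ℝ) < n := Nat.cast_pos.2 hn
  have h := prob_sum_gt_le (μ := fun c : Clock n => clockLaw (c.rate γ C)) hξ h01 hs
    (A := meetingPairs n) (fun p hp => by
      simp only [meetingPairs, Finset.mem_filter, Finset.mem_univ, true_and, not_or] at hp
      exact disjoint_pairClocks hp) (δ := (n : ℝ) ^ 2 * δ) (by positivity) hq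
  have e : (Fintype.card (Fin n × Fin n) : ℝ) * q + (n : ℝ) ^ 2 * δ = (n : ℝ) ^ 2 * (q + δ) := by
    simp; ring
  rw [e] at h
  refine h.trans ?_
  calc ((meetingPairs n).card : ℝ) / ((n : ℝ) ^ 2 * δ) ^ 2 ≤
        4 * n ^ 3 / ((n : ℝ) ^ 2 * δ) ^ 2 := by
        gcongr; exact card_meetingPairs n
    _ = 4 / (n * δ ^ 2) := by field_simp

/-- Second moment of the codegrees of a centred random matrix: a product of entries at the corners
of a nondegenerate rectangle has mean zero, since each corner has edge clocks of its own. -/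
lemma integral_codegree_le {M : Fin n → Fin n → Clocks n → ℝ} (hM : ∀ i j, Measurable (M i j))
    (h1 : ∀ i j z, |M i j z| ≤ 1) (hdiag : ∀ i z, M i i z = 0)
    (hs : ∀ i j, DependsOn (M i j) (pairClocks i j))
    (h0 : ∀ i j, i ≠ j → ∀ x, ∫ y, M i j (resample (edgeClocks i j) (x, y))
      ∂(clocksLaw γ C n) = 0) :
    ∫ z, ∑ i, ∑ i', (∑ j, M i j z * M i' j z) ^ 2 ∂(clocksLaw γ C n) ≤ 2 * n ^ 3 := by
  set P := clocksLaw γ C n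
  have e : ∀ z, ∑ i, ∑ i', (∑ j, M i j z * M i' j z) ^ 2 =
      ∑ i, ∑ i', ∑ j, ∑ j', M i j z * (M i' j z * (M i j' z * M i' j' z)) := fun z => by
    refine Finset.sum_congr rfl fun i _ => Finset.sum_congr rfl fun i' _ => ?_
    rw [sq, Finset.sum_mul_sum]
    exact Finset.sum_congr rfl fun j _ => Finset.sum_congr rfl fun j' _ => by ring
  have hmeas : ∀ i i' j j', Measurable fun z => M i j z * (M i' j z * (M i j' z * M i' j' z)) :=
    fun i i' j j' => (hM _ _).mul ((hM _ _).mul ((hM _ _).mul (hM _ _)))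
  have hbd : ∀ i i' j j' z, |M i j z * (M i' j z * (M i j' z * M i' j' z))| ≤ 1 := by
    intro i i' j j' z
    simp only [abs_mul]
    refine mul_le_one₀ (h1 _ _ _) (by positivity) (mul_le_one₀ (h1 _ _ _) (by positivity)
      (mul_le_one₀ (h1 _ _ _) (by positivity) (h1 _ _ _)))
  have hint : ∀ i i' j j', Integrable (fun z => M i j z * (M i' j z * (M i j' z * M i' j' z))) P :=
    fun i i' j j' => integrable_of_measurable_bounded (hmeas i i' j j') (hbd i i' j j')
  have hzero : ∀ i i' j j', i ≠ i' → j ≠ j' →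
      ∫ z, M i j z * (M i' j z * (M i j' z * M i' j' z)) ∂P = 0 := by
    intro i i' j j' hi hj
    by_cases hd : i = j ∨ i' = j ∨ i = j' ∨ i' = j'
    · have : ∀ z, M i j z * (M i' j z * (M i j' z * M i' j' z)) = 0 := fun z => by
        rcases hd with rfl | rfl | rfl | rfl <;> simp [hdiag]
      simp [this]
    · push Not at hd
      obtain ⟨hij, hi'j, hij', hi'j'⟩ := hd
      change ∫ z, _ ∂(Measure.pi _) = 0
      rw [integral_resample (edgeClocks i j) (hint i i' j j')]
      have : ∀ x y, M i j (resample (edgeClocks i j) (x, y)) *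
          (M i' j (resample (edgeClocks i j) (x, y)) * (M i j' (resample (edgeClocks i j) (x, y)) *
          M i' j' (resample (edgeClocks i j) (x, y)))) =
          M i j (resample (edgeClocks i j) (x, y)) * (M i' j x * (M i j' x * M i' j' x)) := by
        intro x y
        rw [dependsOn_resample_left (hs i' j) (disjoint_edgeClocks _),
          dependsOn_resample_left (hs i j') (disjoint_edgeClocks _),
          dependsOn_resample_left (hs i' j') (disjoint_edgeClocks _)]
        all_goals rw [Ne, Sym2.eq_iff]; tauto
      simp_rw [this]
      have h0' := fun x => h0 i j hij x
      simp_rw [integral_mul_const]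
      refine (integral_congr_ae (ae_of_all _ fun x => ?_)).trans (integral_zero _ _)
      exact mul_eq_zero_of_left (h0' x) _
  have hle : ∀ i i' j j', ∫ z, M i j z * (M i' j z * (M i j' z * M i' j' z)) ∂P ≤
      (if i = i' then 1 else 0) + if j = j' then 1 else 0 := by
    intro i i' j j'
    have hone : ∫ z, M i j z * (M i' j z * (M i j' z * M i' j' z)) ∂P ≤ 1 := by
      have := integral_mono (hint i i' j j') (integrable_const 1)
        fun z => (le_abs_self _).trans (hbd i i' j j' z)
      simpa [P] using this
    split_ifs with hi hj hj
    · linarith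
    · linarith
    · linarith
    · rw [hzero i i' j j' hi hj]; norm_num
  simp_rw [e]
  rw [integral_finsetSum _ fun i _ => integrable_finsetSum _ fun i' _ => integrable_finsetSum _
    fun j _ => integrable_finsetSum _ fun j' _ => hint i i' j j']
  simp_rw [fun i => integral_finsetSum Finset.univ fun i' _ => integrable_finsetSum Finset.univ
    fun j _ => integrable_finsetSum Finset.univ fun j' _ => hint i i' j j',
    fun i i' => integral_finsetSum Finset.univ
    fun j _ => integrable_finsetSum Finset.univ fun j' _ => hint i i' j j',
    fun i i' j => integral_finsetSum Finset.univ fun j' _ => hint i i' j j']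
  calc _ ≤ ∑ i : Fin n, ∑ i' : Fin n, ∑ j : Fin n, ∑ j' : Fin n,
        ((if i = i' then (1 : ℝ) else 0) + if j = j' then 1 else 0) :=
        Finset.sum_le_sum fun i _ => Finset.sum_le_sum fun i' _ => Finset.sum_le_sum fun j _ =>
          Finset.sum_le_sum fun j' _ => hle i i' j j'
    _ = 2 * n ^ 3 := by
        simp [Finset.sum_add_distrib]
        ring

end

/-! ### Step functions and their cut norm -/

section
variable {n : ℕ} [NeZero n]

lemma block_le_iff (k : Fin n) (x : I) : block n x ≤ k ↔ (n : ℝ) * x ≤ k + 1 := by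
  rw [Fin.le_def]
  change ⌈(n : ℝ) * x⌉₊ - 1 ≤ (k : ℕ) ↔ _
  rw [tsub_le_iff_right, Nat.ceil_le]
  push_cast
  rfl

lemma block_mono : Monotone (block n) := by
  intro x y hxy
  have hxy' : (x : ℝ) ≤ y := hxy
  have h := (block_le_iff (block n y) y).1 le_rfl
  refine (block_le_iff _ x).2 (le_trans ?_ h)
  exact mul_le_mul_of_nonneg_left hxy' (Nat.cast_nonneg n)

lemma volume_block (k : Fin n) : (volume : Measure I).real (block n ⁻¹' {k}) = (n : ℝ)⁻¹ := by
  have hn : (0 : ℝ) < n := Nat.cast_pos.2 (NeZero.pos n)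
  have hk : (k : ℝ) + 1 ≤ n := by exact_mod_cast k.2
  let a : I := ⟨k / n, by positivity, by rw [div_le_one hn]; linarith⟩
  let b : I := ⟨(k + 1) / n, by positivity, by rw [div_le_one hn]; linarith⟩
  have h0 : ∀ᵐ x : I, x ≠ 0 := by simp [ae_iff]
  have hae : block n ⁻¹' {k} =ᵐ[volume] Ioc a b := by
    filter_upwards [h0] with x hx
    refine propext ?_
    change block n x = k ↔ a < x ∧ x ≤ b
    have hx0 : (0 : ℝ) < x := lt_of_le_of_ne x.2.1 fun h => hx (Subtype.ext h.symm)
    have h1 : x ≤ b ↔ block n x ≤ k := by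
      rw [block_le_iff, ← Subtype.coe_le_coe, le_div_iff₀ hn, mul_comm]
    have h2 : a < x ↔ k ≤ block n x := by
      rw [← Subtype.coe_lt_coe, div_lt_iff₀ hn, mul_comm]
      constructor
      · intro h
        have h3 := (block_le_iff (block n x) x).1 le_rfl
        have h4 : (k : ℝ) < (block n x : ℕ) + 1 := h.trans_le h3
        have h5 : (k : ℕ) < (block n x : ℕ) + 1 := by exact_mod_cast h4
        exact Fin.le_def.2 (Nat.lt_succ_iff.1 h5)
      · intro h
        by_contra! h3
        rcases Nat.eq_zero_or_pos (k : ℕ) with hk0 | hk0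
        · rw [hk0] at h3
          have := mul_pos hn hx0
          simp only [Nat.cast_zero] at h3
          linarith
        · have h4 : block n x ≤ ⟨(k : ℕ) - 1, by omega⟩ := by
            rw [block_le_iff]
            simp only
            rw [Nat.cast_sub hk0]
            simpa using h3
          have h5 := Fin.le_def.1 (h.trans h4)
          simp only at h5
          omega
    rw [h1, h2, and_comm]
    exact le_antisymm_iff
  rw [measureReal_congr hae, measureReal_def, unitInterval.volume_Ioc,
    ENNReal.toReal_ofReal (by simp only [a, b]; rw [← sub_div]; simp)]
  simp only [a, b]
  field_simp
  ring

lemma integral_block (S : Set I) (f : Fin n → ℝ) :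
    ∫ x in S, f (block n x) = ∑ k, f k * (volume : Measure I).real (block n ⁻¹' {k} ∩ S) := by
  have hm := measurable_block n
  have e : ∀ x, f (block n x) = ∑ k, (block n ⁻¹' {k}).indicator (fun _ => f k) x := fun x => by
    rw [Finset.sum_eq_single (block n x)]
    · simp
    · intro k _ hk
      rw [indicator_of_notMem]
      exact fun h => hk h.symm
    · simp
  simp_rw [e]
  rw [integral_finsetSum _ fun k _ => (integrable_const _).indicator (hm (measurableSet_singleton k))]
  refine Finset.sum_congr rfl fun k _ => ?_
  rw [integral_indicator_const _ (hm (measurableSet_singleton k)),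
    measureReal_restrict_apply (hm (measurableSet_singleton k)), smul_eq_mul, mul_comm]

lemma integral_block_univ (f : Fin n → ℝ) : ∫ x : I, f (block n x) = (n : ℝ)⁻¹ * ∑ k, f k := by
  have := integral_block (n := n) univ f
  rw [setIntegral_univ] at this
  rw [this, Finset.mul_sum]
  refine Finset.sum_congr rfl fun k _ => ?_
  rw [inter_univ, volume_block, mul_comm]

lemma integrable_block₂ (f : Fin n → Fin n → ℝ) (μ : Measure (I × I)) [IsFiniteMeasure μ] :
    Integrable (fun p : I × I => f (block n p.1) (block n p.2)) μ := by
  have hm : Measurable fun p : I × I => f (block n p.1) (block n p.2) :=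
    (measurable_of_finite fun q : Fin n × Fin n => f q.1 q.2).comp
      (((measurable_block n).comp measurable_fst).prodMk ((measurable_block n).comp measurable_snd))
  refine integrable_of_measurable_bounded hm (B := ∑ i, ∑ j, |f i j|) fun p => ?_
  refine (Finset.single_le_sum (f := fun j => |f (block n p.1) j|) (fun _ _ => abs_nonneg _)
    (Finset.mem_univ (block n p.2))).trans ?_
  exact Finset.single_le_sum (f := fun i => ∑ j, |f i j|)
    (fun _ _ => Finset.sum_nonneg fun _ _ => abs_nonneg _) (Finset.mem_univ (block n p.1))

lemma integral_block₂ (S T : Set I) (f : Fin n → Fin n → ℝ) :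
    ∫ p in S ×ˢ T, f (block n p.1) (block n p.2) =
      ∑ j, (∑ i, f i j * (volume : Measure I).real (block n ⁻¹' {i} ∩ S)) *
        (volume : Measure I).real (block n ⁻¹' {j} ∩ T) := by
  rw [Measure.volume_eq_prod, ← Measure.prod_restrict, integral_prod_symm _ (integrable_block₂ f _)]
  simp_rw [fun y => integral_block S fun i => f i (block n y)]
  exact integral_block T fun j => ∑ i, f i j * (volume : Measure I).real (block n ⁻¹' {i} ∩ S)

/-- The cut norm of a step function is controlled by the codegrees of its matrix, by using the
Cauchy–Schwarz inequality twice. -/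
lemma pow_four_integral_block_le (S T : Set I) (M : Fin n → Fin n → ℝ) :
    (∫ p in S ×ˢ T, M (block n p.1) (block n p.2)) ^ 4 ≤
      ((n : ℝ) ^ 4)⁻¹ * ∑ i, ∑ i', (∑ j, M i j * M i' j) ^ 2 := by
  have hn : (0 : ℝ) < n := Nat.cast_pos.2 (NeZero.pos n)
  rw [integral_block₂]
  set a : Fin n → ℝ := fun i => (volume : Measure I).real (block n ⁻¹' {i} ∩ S) with ha
  set c : Fin n → ℝ := fun i => (volume : Measure I).real (block n ⁻¹' {i} ∩ T) with hc
  have ha1 : ∀ i, |a i| ≤ (n : ℝ)⁻¹ := fun i => by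
    rw [abs_of_nonneg measureReal_nonneg, ← volume_block i]
    exact measureReal_mono inter_subset_left
  have hc1 : ∀ i, |c i| ≤ (n : ℝ)⁻¹ := fun i => by
    rw [abs_of_nonneg measureReal_nonneg, ← volume_block i]
    exact measureReal_mono inter_subset_left
  set κ : Fin n → Fin n → ℝ := fun i i' => ∑ j, M i j * M i' j with hκ
  have h1 : (∑ j, (∑ i, M i j * a i) * c j) ^ 2 ≤ (n : ℝ)⁻¹ ^ 3 * ∑ i, ∑ i', |κ i i'| := by
    have e1 : ∑ j, (∑ i, M i j * a i) ^ 2 = ∑ i, ∑ i', a i * a i' * κ i i' := by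
      simp only [hκ, Finset.mul_sum]
      have e0 : ∀ j, (∑ i, M i j * a i) ^ 2 = ∑ i, ∑ i', (M i j * a i) * (M i' j * a i') :=
        fun j => by rw [sq, Finset.sum_mul_sum]
      simp_rw [e0]
      rw [Finset.sum_comm]
      refine Finset.sum_congr rfl fun i _ => ?_
      rw [Finset.sum_comm]
      exact Finset.sum_congr rfl fun i' _ => Finset.sum_congr rfl fun j _ => by ring
    have e2 : ∑ j, (∑ i, M i j * a i) ^ 2 ≤ (n : ℝ)⁻¹ ^ 2 * ∑ i, ∑ i', |κ i i'| := by
      rw [e1, Finset.mul_sum]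
      refine Finset.sum_le_sum fun i _ => ?_
      rw [Finset.mul_sum]
      refine Finset.sum_le_sum fun i' _ => ?_
      refine (le_abs_self _).trans ?_
      rw [abs_mul, abs_mul, sq]
      exact mul_le_mul_of_nonneg_right (mul_le_mul (ha1 i) (ha1 i') (abs_nonneg _) (by positivity))
        (abs_nonneg _)
    have e3 : ∑ j, c j ^ 2 ≤ (n : ℝ)⁻¹ := by
      calc ∑ j, c j ^ 2 ≤ ∑ _j : Fin n, (n : ℝ)⁻¹ ^ 2 := Finset.sum_le_sum fun j _ => by
            rw [← sq_abs]; exact pow_le_pow_left₀ (abs_nonneg _) (hc1 j) 2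
        _ = (n : ℝ)⁻¹ := by simp; field_simp
    refine (Finset.sum_mul_sq_le_sq_mul_sq _ _ _).trans ?_
    calc _ ≤ ((n : ℝ)⁻¹ ^ 2 * ∑ i, ∑ i', |κ i i'|) * (n : ℝ)⁻¹ :=
          mul_le_mul e2 e3 (Finset.sum_nonneg fun _ _ => sq_nonneg _) (by positivity)
      _ = _ := by ring
  have h2 : (∑ i, ∑ i', |κ i i'|) ^ 2 ≤ (n : ℝ) ^ 2 * ∑ i, ∑ i', κ i i' ^ 2 := by
    have := sq_sum_le_card_mul_sum_sq (s := (Finset.univ : Finset (Fin n × Fin n)))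
      (f := fun p => |κ p.1 p.2|)
    simp only [Fintype.sum_prod_type, Finset.card_univ, Fintype.card_prod, Fintype.card_fin,
      sq_abs] at this
    refine this.trans (le_of_eq ?_)
    push_cast; ring
  calc (∑ j, (∑ i, M i j * a i) * c j) ^ 4 = ((∑ j, (∑ i, M i j * a i) * c j) ^ 2) ^ 2 := by ring
    _ ≤ ((n : ℝ)⁻¹ ^ 3 * ∑ i, ∑ i', |κ i i'|) ^ 2 := pow_le_pow_left₀ (sq_nonneg _) h1 2
    _ = (n : ℝ)⁻¹ ^ 6 * (∑ i, ∑ i', |κ i i'|) ^ 2 := by ring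
    _ ≤ (n : ℝ)⁻¹ ^ 6 * ((n : ℝ) ^ 2 * ∑ i, ∑ i', κ i i' ^ 2) :=
        mul_le_mul_of_nonneg_left h2 (by positivity)
    _ = ((n : ℝ) ^ 4)⁻¹ * ∑ i, ∑ i', κ i i' ^ 2 := by field_simp

open Classical in
lemma empiricalGraphon_ae (H : SimpleGraph (Fin n)) : ∀ᵐ p : I × I, (empiricalGraphon H p : ℝ) =
    if H.Adj (block n p.1) (block n p.2) then 1 else 0 := by
  have h := AEEqFun.coeFn_mk (μ := (volume : Measure (I × I)))
      (fun p : I × I => if H.Adj (block n p.1) (block n p.2) then (1 : I) else 0)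
      (((measurable_of_finite
          (fun q : Fin n × Fin n => if H.Adj q.1 q.2 then (1 : I) else 0)).comp
        (((measurable_block n).comp measurable_fst).prodMk
          ((measurable_block n).comp measurable_snd))).aestronglyMeasurable)
  filter_upwards [h] with p hp
  have : empiricalGraphon H p = if H.Adj (block n p.1) (block n p.2) then (1 : I) else 0 := hp
  rw [this]
  split_ifs <;> rfl

open Classical in
/-- The cut distance between a labelled graph and a graphon, when their difference is a matrix of
small cut norm up to an error which is small in `L¹`. -/
lemma cutDist_empiricalGraphon_le (H : SimpleGraph (Fin n)) (lb : Equiv.Perm (Fin n)) (g : Graphon)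
    (M D : Fin n → Fin n → ℝ) (w : I × I → ℝ) (hw : Integrable w) (hw0 : ∀ p, 0 ≤ w p)
    (hD : ∀ i j, 0 ≤ D i j) {δ : ℝ} (hδ : 0 ≤ δ)
    (hM : ∑ i, ∑ i', (∑ j, M i j * M i' j) ^ 2 ≤ (n : ℝ) ^ 4 * δ ^ 4)
    (h : ∀ᵐ p : I × I, |(if H.Adj (lb (block n p.1)) (lb (block n p.2)) then (1 : ℝ) else 0) - g p -
      M (lb (block n p.1)) (lb (block n p.2))| ≤ D (lb (block n p.1)) (lb (block n p.2)) + w p) :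
    cutDist (empiricalGraphon (H.comap lb)) g ≤
      δ + ((n : ℝ) ^ 2)⁻¹ * (∑ i, ∑ j, D i j) + ∫ p, w p := by
  have hn : (0 : ℝ) < n := Nat.cast_pos.2 (NeZero.pos n)
  refine cutDist_le fun S T hS hT => ?_
  set M' : Fin n → Fin n → ℝ := fun k l => M (lb k) (lb l)
  set D' : Fin n → Fin n → ℝ := fun k l => D (lb k) (lb l)
  have hMi := integrable_block₂ M' (volume.restrict (S ×ˢ T))
  have hDi := integrable_block₂ D' volume
  have hgi : Integrable (fun p => (empiricalGraphon (H.comap lb) p : ℝ) - g p)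
      (volume.restrict (S ×ˢ T)) :=
    (integrableOn_graphon (empiricalGraphon (H.comap lb)) (S ×ˢ T)).sub
      (integrableOn_graphon g (S ×ˢ T))
  have hdec : ∫ p in S ×ˢ T, ((empiricalGraphon (H.comap lb) p : ℝ) - g p) =
      (∫ p in S ×ˢ T, M' (block n p.1) (block n p.2)) +
      ∫ p in S ×ˢ T, (((empiricalGraphon (H.comap lb) p : ℝ) - g p) -
        M' (block n p.1) (block n p.2)) := by
    have := integral_sub hgi hMi
    linarith
  have b1 : |∫ p in S ×ˢ T, M' (block n p.1) (block n p.2)| ≤ δ := by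
    have h4 := pow_four_integral_block_le S T M'
    have e : ∑ i, ∑ i', (∑ j, M' i j * M' i' j) ^ 2 = ∑ i, ∑ i', (∑ j, M i j * M i' j) ^ 2 := by
      rw [← Equiv.sum_comp lb fun i => ∑ i', (∑ j, M i j * M i' j) ^ 2]
      refine Finset.sum_congr rfl fun i _ => ?_
      rw [← Equiv.sum_comp lb fun i' => (∑ j, M (lb i) j * M i' j) ^ 2]
      refine Finset.sum_congr rfl fun i' _ => ?_
      rw [← Equiv.sum_comp lb fun j => M (lb i) j * M (lb i') j]
    rw [e] at h4
    have h5 : (∫ p in S ×ˢ T, M' (block n p.1) (block n p.2)) ^ 4 ≤ δ ^ 4 := by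
      refine h4.trans ?_
      rw [inv_mul_le_iff₀ (by positivity)]
      exact hM
    rw [← Even.pow_abs (by decide : Even 4)] at h5
    exact (pow_le_pow_iff_left₀ (abs_nonneg _) hδ four_ne_zero).1 h5
  have b2 : |∫ p in S ×ˢ T, (((empiricalGraphon (H.comap lb) p : ℝ) - g p) -
      M' (block n p.1) (block n p.2))| ≤ ((n : ℝ) ^ 2)⁻¹ * (∑ i, ∑ j, D i j) + ∫ p, w p := by
    have hDint : ∫ p : I × I, D' (block n p.1) (block n p.2) =
        ((n : ℝ) ^ 2)⁻¹ * (∑ i, ∑ j, D i j) := by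
      have := integral_block₂ (n := n) univ univ D'
      rw [univ_prod_univ, setIntegral_univ] at this
      rw [this]
      simp only [inter_univ, volume_block]
      simp only [← Finset.sum_mul]
      rw [Finset.sum_comm]
      have e : ∑ i, ∑ j, D' i j = ∑ i, ∑ j, D i j := by
        rw [← Equiv.sum_comp lb fun i => ∑ j, D i j]
        refine Finset.sum_congr rfl fun i _ => ?_
        rw [← Equiv.sum_comp lb fun j => D (lb i) j]
      rw [e]
      field_simp
    rw [← hDint, ← integral_add hDi hw]
    have hae : ∀ᵐ p : I × I, |((empiricalGraphon (H.comap lb) p : ℝ) - g p) -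
        M' (block n p.1) (block n p.2)| ≤ D' (block n p.1) (block n p.2) + w p := by
      filter_upwards [h, empiricalGraphon_ae (H.comap lb)] with p hp hp'
      rw [hp']
      simpa only [SimpleGraph.comap_adj] using hp
    calc _ ≤ ∫ p in S ×ˢ T, (D' (block n p.1) (block n p.2) + w p) := by
          rw [← Real.norm_eq_abs]
          exact norm_integral_le_of_norm_le (hDi.add hw).integrableOn (ae_restrict_of_ae hae)
      _ ≤ ∫ p, (D' (block n p.1) (block n p.2) + w p) :=
          setIntegral_le_integral (hDi.add hw) (ae_of_all _ fun p => add_nonneg (hD _ _) (hw0 p))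
  rw [hdec]
  refine (abs_add_le _ _).trans ?_
  linarith

end

/-! ### Relabelling the vertices of a graph -/

section
variable {n : ℕ} [NeZero n]

lemma block_eq_iff {x : I} (hx : x ≠ 0) (k : Fin n) :
    block n x = k ↔ (k : ℝ) < n * x ∧ (n : ℝ) * x ≤ k + 1 := by
  have hn : (0 : ℝ) < n := Nat.cast_pos.2 (NeZero.pos n)
  have hx0 : (0 : ℝ) < x := lt_of_le_of_ne x.2.1 fun h => hx (Subtype.ext h.symm)
  have hpos : 0 < ⌈(n : ℝ) * x⌉₊ := Nat.ceil_pos.2 (by positivity)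
  rw [Fin.ext_iff]
  change ⌈(n : ℝ) * x⌉₊ - 1 = (k : ℕ) ↔ _
  have e : ⌈(n : ℝ) * x⌉₊ - 1 = (k : ℕ) ↔ ⌈(n : ℝ) * x⌉₊ = (k : ℕ) + 1 := by omega
  rw [e, Nat.ceil_eq_iff (by omega)]
  push_cast
  simp

/-- The bijection of `[0,1]` which translates each block onto the block of its image under a
permutation. The endpoint `0`, which is not the left end of a half-open block, is fixed. -/
def blockPerm (lb : Equiv.Perm (Fin n)) (x : I) : I :=
  if x = 0 then 0 else clamp (x + ((lb (block n x) : ℕ) - (block n x : ℕ)) / n)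

lemma coe_blockPerm (lb : Equiv.Perm (Fin n)) {x : I} (hx : x ≠ 0) :
    (blockPerm lb x : ℝ) = x + (((lb (block n x) : ℕ) : ℝ) - (block n x : ℕ)) / n := by
  have hn : (0 : ℝ) < n := Nat.cast_pos.2 (NeZero.pos n)
  have h := (block_eq_iff hx (block n x)).1 rfl
  have hlt : ((lb (block n x) : ℕ) : ℝ) + 1 ≤ n := by exact_mod_cast (lb (block n x)).2
  have h0 : (0 : ℝ) ≤ (lb (block n x) : ℕ) := Nat.cast_nonneg _
  rw [blockPerm, if_neg hx, coe_clamp_of_mem]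
  have e : (x : ℝ) + (((lb (block n x) : ℕ) : ℝ) - (block n x : ℕ)) / n =
      (n * x + (lb (block n x) : ℕ) - (block n x : ℕ)) / n := by field_simp; ring
  rw [e]
  constructor
  · apply div_nonneg _ hn.le; linarith
  · rw [div_le_one hn]; linarith

lemma mul_blockPerm (lb : Equiv.Perm (Fin n)) {x : I} (hx : x ≠ 0) :
    (n : ℝ) * blockPerm lb x = n * x + (lb (block n x) : ℕ) - (block n x : ℕ) := by
  have hn : (0 : ℝ) < n := Nat.cast_pos.2 (NeZero.pos n)
  rw [coe_blockPerm lb hx]; field_simp; ring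

lemma blockPerm_ne_zero (lb : Equiv.Perm (Fin n)) {x : I} (hx : x ≠ 0) : blockPerm lb x ≠ 0 := by
  intro h
  have e := mul_blockPerm lb hx
  rw [h] at e
  have h1 := (block_eq_iff hx (block n x)).1 rfl
  have h0 : (0 : ℝ) ≤ (lb (block n x) : ℕ) := Nat.cast_nonneg _
  simp only [Icc.coe_zero, mul_zero] at e
  linarith

lemma block_blockPerm (lb : Equiv.Perm (Fin n)) {x : I} (hx : x ≠ 0) :
    block n (blockPerm lb x) = lb (block n x) := by
  have h1 := (block_eq_iff hx (block n x)).1 rfl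
  rw [block_eq_iff (blockPerm_ne_zero lb hx), mul_blockPerm lb hx]
  constructor <;> linarith

lemma blockPerm_symm_apply (lb : Equiv.Perm (Fin n)) (x : I) :
    blockPerm lb.symm (blockPerm lb x) = x := by
  by_cases hx : x = 0
  · simp [hx, blockPerm]
  · have h := blockPerm_ne_zero lb hx
    apply Subtype.ext
    rw [coe_blockPerm _ h, block_blockPerm lb hx, coe_blockPerm lb hx, Equiv.symm_apply_apply]
    ring

lemma measurable_blockPerm (lb : Equiv.Perm (Fin n)) : Measurable (blockPerm lb) := by
  refine Measurable.ite (measurableSet_singleton 0) measurable_const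
    (continuous_clamp.measurable.comp ?_)
  exact measurable_subtype_coe.add
    ((measurable_of_finite fun k : Fin n => (((lb k : ℕ) : ℝ) - (k : ℕ)) / n).comp
      (measurable_block n))

lemma measurePreserving_blockPerm (lb : Equiv.Perm (Fin n)) :
    MeasurePreserving (blockPerm lb) volume volume := by
  refine ⟨measurable_blockPerm lb, Measure.ext fun A hA => ?_⟩
  rw [Measure.map_apply (measurable_blockPerm lb) hA]
  have hz : (volume : Measure I) {0} = 0 := by simp
  have hsplit : ∀ B : Set I, MeasurableSet B →
      volume B = ∑ k, volume (B ∩ block n ⁻¹' {k}) := fun B hB => by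
    rw [← measure_biUnion_finset]
    · congr 1
      ext x
      simp
    · intro k _ l _ hkl
      refine disjoint_left.2 fun x hx hx' => hkl ?_
      exact hx.2.symm.trans hx'.2
    · exact fun k _ => hB.inter (measurable_block n (measurableSet_singleton k))
  rw [hsplit A hA, hsplit _ (measurable_blockPerm lb hA),
    ← Equiv.sum_comp lb fun k => volume (A ∩ block n ⁻¹' {k})]
  refine Finset.sum_congr rfl fun k _ => ?_
  -- on each block the map is a translation
  set c : ℝ := (((lb k : ℕ) : ℝ) - (k : ℕ)) / n with hc
  have e1 : volume (blockPerm lb ⁻¹' A ∩ block n ⁻¹' {k}) =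
      volume ((blockPerm lb ⁻¹' A ∩ block n ⁻¹' {k}) \ {0}) := (measure_sdiff_null hz).symm
  have e2 : volume (A ∩ block n ⁻¹' {lb k}) = volume ((A ∩ block n ⁻¹' {lb k}) \ {0}) :=
    (measure_sdiff_null hz).symm
  rw [e1, e2, unitInterval.volume_apply, unitInterval.volume_apply]
  have e3 : (Subtype.val '' ((blockPerm lb ⁻¹' A ∩ block n ⁻¹' {k}) \ {0}) : Set ℝ) =
      (fun r => r + c) ⁻¹' (Subtype.val '' ((A ∩ block n ⁻¹' {lb k}) \ {0})) := by
    ext r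
    constructor
    · rintro ⟨x, ⟨⟨hxA, hxk⟩, hx0⟩, rfl⟩
      have hxk : block n x = k := hxk
      refine ⟨blockPerm lb x, ⟨⟨hxA, ?_⟩, blockPerm_ne_zero lb hx0⟩, ?_⟩
      · change block n _ = _
        rw [block_blockPerm lb hx0, hxk]
      · rw [coe_blockPerm lb hx0, hxk]
    · rintro ⟨y, ⟨⟨hyA, hyk⟩, hy0⟩, hyr⟩
      have hyk : block n y = lb k := hyk
      have hinv := blockPerm_symm_apply lb.symm y
      rw [Equiv.symm_symm] at hinv
      refine ⟨blockPerm lb.symm y, ⟨⟨?_, ?_⟩, blockPerm_ne_zero _ hy0⟩, ?_⟩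
      · change blockPerm lb _ ∈ A
        rwa [hinv]
      · change block n _ = _
        rw [block_blockPerm _ hy0, hyk, Equiv.symm_apply_apply]
      · rw [coe_blockPerm _ hy0, hyk, Equiv.symm_apply_apply, hyr, hc]
        ring
  rw [e3, measure_preimage_add_right]

/-- A graph and its relabellings have the same unlabelled graphon. -/
lemma unlabel_empiricalGraphon_comap (H : SimpleGraph (Fin n)) (lb : Equiv.Perm (Fin n)) :
    (empiricalGraphon (H.comap lb)).unlabel = (empiricalGraphon H).unlabel := by
  classical
  refine Quotient.sound ⟨⟨⟨blockPerm lb, blockPerm lb.symm, blockPerm_symm_apply lb, fun y => ?_⟩,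
    measurable_blockPerm lb, measurable_blockPerm lb.symm⟩, measurePreserving_blockPerm lb, ?_⟩
  · have := blockPerm_symm_apply lb.symm y
    rwa [Equiv.symm_symm] at this
  · have h0 : ∀ᵐ p : I × I, p.1 ≠ 0 ∧ p.2 ≠ 0 := by
      have h : ∀ᵐ x : I, x ≠ 0 := by simp [ae_iff]
      exact (Measure.quasiMeasurePreserving_fst.ae h).and (Measure.quasiMeasurePreserving_snd.ae h)
    have h1 := (measurePreserving_prodMap
      (measurePreserving_blockPerm lb)).quasiMeasurePreserving.ae (empiricalGraphon_ae H)
    filter_upwards [h0, h1, empiricalGraphon_ae (H.comap lb)] with p hp hp1 hp2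
    refine Subtype.ext (hp2.trans (Eq.trans ?_ hp1.symm))
    simp only [SimpleGraph.comap_adj, block_blockPerm lb hp.1, block_blockPerm lb hp.2]

end

/-! ### Empirical age distributions -/

section
variable {n : ℕ} [NeZero n]

lemma integral_empirical (X : Fin n → I) (lb : Equiv.Perm (Fin n)) (f : I → ℝ) :
    ∫ z, f z ∂(empirical X : Measure I) = ∫ x : I, f (X (lb (block n x))) := by
  have h := integral_block_univ (n := n) fun k => f (X (lb k))
  rw [h]
  change ∫ z, f z ∂((n : ℝ≥0∞)⁻¹ • ∑ v, Measure.dirac (X v)) = _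
  rw [integral_smul_measure, integral_finsetSum_measure fun v _ => integrable_dirac (by simp)]
  simp only [integral_dirac, ENNReal.toReal_inv, ENNReal.toReal_natCast, smul_eq_mul]
  rw [Equiv.sum_comp lb fun v => f (X v)]

lemma integral_abs_indicator_sub (u v : I) :
    ∫ z : I, |(if u ≤ z then (1 : ℝ) else 0) - (if v ≤ z then (1 : ℝ) else 0)| =
      |(u : ℝ) - v| := by
  have key : ∀ u v : I, u ≤ v →
      ∫ z : I, |(if u ≤ z then (1 : ℝ) else 0) - (if v ≤ z then (1 : ℝ) else 0)| = v - u := by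
    intro u v huv
    have e : (fun z : I => |(if u ≤ z then (1 : ℝ) else 0) - (if v ≤ z then (1 : ℝ) else 0)|) =
        (Ico u v).indicator fun _ => (1 : ℝ) := by
      funext z
      by_cases h1 : u ≤ z <;> by_cases h2 : v ≤ z
      · simp [h1, h2]
      · simp [h1, h2, not_le.1 h2]
      · exact absurd (huv.trans h2) h1
      · simp [h1, h2]
    rw [e, integral_indicator_const _ measurableSet_Ico, measureReal_def, unitInterval.volume_Ico,
      ENNReal.toReal_ofReal (sub_nonneg.2 huv), smul_eq_mul, mul_one]
  rcases le_total u v with h | h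
  · rw [key _ _ h, abs_sub_comm, abs_of_nonneg (sub_nonneg.2 (Subtype.coe_le_coe.2 h))]
  · simp_rw [abs_sub_comm (if u ≤ _ then (1 : ℝ) else 0)]
    rw [key _ _ h, abs_of_nonneg (sub_nonneg.2 (Subtype.coe_le_coe.2 h))]

/-- The distance of two monotone functions is the distance of their distribution functions. -/
lemma integral_abs_sub_le_of_monotone {a q : I → I} (ha : Monotone a) (hq : Monotone q) :
    ∫ x, |(a x : ℝ) - q x| =
      ∫ z : I, |(volume : Measure I).real {x | a x ≤ z} - (volume : Measure I).real {x | q x ≤ z}| := by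
  have ham := ha.measurable
  have hqm := hq.measurable
  set f : I × I → ℝ := fun p =>
    |{p : I × I | a p.1 ≤ p.2}.indicator (1 : I × I → ℝ) p -
      {p : I × I | q p.1 ≤ p.2}.indicator (1 : I × I → ℝ) p| with hf
  have hma : MeasurableSet {p : I × I | a p.1 ≤ p.2} :=
    measurableSet_le (ham.comp measurable_fst) measurable_snd
  have hmq : MeasurableSet {p : I × I | q p.1 ≤ p.2} :=
    measurableSet_le (hqm.comp measurable_fst) measurable_snd
  have hfm : Measurable f := by
    have h : Measurable fun p => {p : I × I | a p.1 ≤ p.2}.indicator (1 : I × I → ℝ) p -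
      {p : I × I | q p.1 ≤ p.2}.indicator (1 : I × I → ℝ) p :=
      (measurable_one.indicator hma).sub (measurable_one.indicator hmq)
    exact h.abs
  have hfi : Integrable f := integrable_of_measurable_bounded hfm (B := 1) fun p => by
    simp only [hf, indicator, Pi.one_apply]
    split_ifs <;> simp
  have h1 : ∀ x, ∫ z, f (x, z) = |(a x : ℝ) - q x| := fun x => by
    have e : ∀ z, f (x, z) =
        |(if a x ≤ z then (1 : ℝ) else 0) - (if q x ≤ z then (1 : ℝ) else 0)| := fun z => rfl
    simp_rw [e]
    exact integral_abs_indicator_sub (a x) (q x)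
  have key2 : ∀ A B : Set I, MeasurableSet A → MeasurableSet B → A ⊆ B →
      ∫ x, |A.indicator (fun _ => (1 : ℝ)) x - B.indicator (fun _ => (1 : ℝ)) x| =
        |(volume : Measure I).real A - (volume : Measure I).real B| := by
    intro A B hA hB hAB
    have e : (fun x => |A.indicator (fun _ => (1 : ℝ)) x - B.indicator (fun _ => (1 : ℝ)) x|) =
        fun x => B.indicator (fun _ => (1 : ℝ)) x - A.indicator (fun _ => (1 : ℝ)) x := by
      funext x
      by_cases h1 : x ∈ A
      · simp [h1, hAB h1]
      · by_cases h2 : x ∈ B <;> simp [h1, h2]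
    have hi : ∀ S : Set I, MeasurableSet S → Integrable (S.indicator fun _ : I => (1 : ℝ)) := fun S hS =>
      (integrable_const (1 : ℝ)).indicator hS
    rw [e, integral_sub (hi B hB) (hi A hA), integral_indicator_const _ hA, integral_indicator_const _ hB,
      smul_eq_mul, smul_eq_mul, mul_one, mul_one,
      abs_sub_comm, abs_of_nonneg (sub_nonneg.2 (measureReal_mono hAB))]
  have h2 : ∀ z, ∫ x, f (x, z) =
      |(volume : Measure I).real {x | a x ≤ z} - (volume : Measure I).real {x | q x ≤ z}| := by
    intro z
    have e : ∀ x, f (x, z) = |{x | a x ≤ z}.indicator (fun _ => (1 : ℝ)) x -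
      {x | q x ≤ z}.indicator (fun _ => (1 : ℝ)) x| := fun x => rfl
    have hA : MeasurableSet {x | a x ≤ z} := measurableSet_le ham measurable_const
    have hB : MeasurableSet {x | q x ≤ z} := measurableSet_le hqm measurable_const
    simp_rw [e]
    -- sublevel sets of monotone functions are nested
    by_cases hAB : {x | a x ≤ z} ⊆ {x | q x ≤ z}
    · exact key2 _ _ hA hB hAB
    · obtain ⟨x₀, hx₀, hx₀'⟩ := not_subset.1 hAB
      have hBA : {x | q x ≤ z} ⊆ {x | a x ≤ z} := fun x hx => by
        have : x ≤ x₀ := by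
          by_contra! hlt
          exact hx₀' ((hq hlt.le).trans hx)
        exact (ha this).trans hx₀
      rw [abs_sub_comm]
      simp_rw [abs_sub_comm (indicator {x | a x ≤ z} _ _)]
      exact key2 _ _ hB hA hBA
  simp_rw [← h1, ← h2]
  exact integral_integral_swap (f := fun x z => f (x, z)) hfi

variable {γ : ℝ}

/-- The `L¹` distance of the empirical distribution function of the ages `X` and of `F*(t)`. -/
def ageDiscrepancy (γ : ℝ) (t : I) (X : Fin n → I) : ℝ :=
  ∫ z : I, |(n : ℝ)⁻¹ * ∑ v, {v | X v ≤ z}.indicator (1 : Fin n → ℝ) v -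
    (volume : Measure I).real {x | limitAgeI γ t x ≤ z}|

/-- Labelling by increasing age turns the vertex ages into a monotone function of the label, so that
its `L¹` distance to the limiting ages is the one of the distribution functions. -/
lemma integral_abs_age_sub (hγ : 0 < γ) (t : I) (X : Fin n → I) (lb : Equiv.Perm (Fin n))
    (hlb : Monotone fun k => X (lb k)) :
    ∫ x : I, |(X (lb (block n x)) : ℝ) - limitAge γ t x| = ageDiscrepancy γ t X := by
  have hq : Monotone (limitAgeI γ t) := fun x y hxy => by
    rw [← Subtype.coe_le_coe, coe_limitAgeI hγ, coe_limitAgeI hγ]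
    exact limitAge_mono hγ t hxy
  have h := integral_abs_sub_le_of_monotone (hlb.comp (block_mono (n := n))) hq
  simp only [Function.comp_apply, coe_limitAgeI hγ] at h
  rw [h, ageDiscrepancy]
  congr 1
  funext z
  have e : (volume : Measure I).real {x | X (lb (block n x)) ≤ z} =
      (n : ℝ)⁻¹ * ∑ v, {v | X v ≤ z}.indicator (1 : Fin n → ℝ) v := by
    rw [← Equiv.sum_comp lb, ← integral_block_univ, ← integral_indicator_one]
    · rfl
    · have : {x : I | X (lb (block n x)) ≤ z} = block n ⁻¹' {k | X (lb k) ≤ z} := rfl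
      rw [this]
      exact measurable_block n (toFinite _).measurableSet
  rw [e]

/-- Uniformly in `t`, an empirical age distribution of small discrepancy is close to `F*(t)` in any
metric for weak convergence. Uniformity comes from the compactness of `[0,1]`. -/
lemma exists_dist_empirical_lt (hγ : 0 < γ) {d : ProbabilityMeasure I → ProbabilityMeasure I → ℝ}
    (hd : MetrizesWeak d) {ε : ℝ} (hε : 0 < ε) :
    ∃ δ > 0, ∀ (n : ℕ) [NeZero n] (X : Fin n → I) (lb : Equiv.Perm (Fin n)) (t : I),
      ∫ x : I, |(X (lb (block n x)) : ℝ) - limitAge γ t x| ≤ δ →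
        d (empirical X) (limitLaw hγ t) < ε := by
  by_contra! hcon
  choose n hn X lb t hX hfar using fun k : ℕ => hcon (1 / ((k : ℝ) + 1)) (by positivity)
  obtain ⟨t₀, -, φ, hφ, ht⟩ := isCompact_univ.tendsto_subseq (x := t) fun _ => mem_univ _
  have hlim : Tendsto (fun k => limitLaw hγ (t (φ k))) atTop (𝓝 (limitLaw hγ t₀)) :=
    ((continuous_limitLaw hγ).tendsto t₀).comp ht
  have hX0 : Tendsto (fun k => ∫ x : I, |(X (φ k) (lb (φ k) (block (n (φ k)) x)) : ℝ) -
      limitAge γ t₀ x|) atTop (𝓝 0) := by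
    have hu : Tendsto (fun k => 1 / ((φ k : ℝ) + 1) + |(t (φ k) : ℝ) - t₀|) atTop (𝓝 0) := by
      have h1 := tendsto_one_div_add_atTop_nhds_zero_nat (𝕜 := ℝ) |>.comp hφ.tendsto_atTop
      have h2 : Tendsto (fun k => |(t (φ k) : ℝ) - t₀|) atTop (𝓝 0) := by
        have := (tendsto_iff_dist_tendsto_zero.1 ht)
        simpa only [Subtype.dist_eq, Real.dist_eq, Function.comp_apply] using! this
      simpa using! h1.add h2
    refine squeeze_zero (fun k => integral_nonneg fun x => abs_nonneg _) (fun k => ?_) hu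
    have hXm : Measurable fun x => (X (φ k) (lb (φ k) (block (n (φ k)) x)) : ℝ) :=
      (measurable_of_finite fun v => (X (φ k) (lb (φ k) v) : ℝ)).comp (measurable_block _)
    have hi : Integrable fun x => |(X (φ k) (lb (φ k) (block (n (φ k)) x)) : ℝ) -
        limitAge γ (t (φ k)) x| :=
      integrable_of_measurable_bounded (hXm.sub (measurable_limitAge hγ _)).abs (B := 1)
        fun x => by
          have h1 := limitAge_mem hγ (t (φ k)) x
          have h2 := (X (φ k) (lb (φ k) (block (n (φ k)) x))).2
          rw [abs_abs, abs_le]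
          constructor <;> linarith [h1.1, h1.2, h2.1, h2.2]
    calc ∫ x : I, |(X (φ k) (lb (φ k) (block (n (φ k)) x)) : ℝ) - limitAge γ t₀ x|
        ≤ ∫ x : I, (|(X (φ k) (lb (φ k) (block (n (φ k)) x)) : ℝ) - limitAge γ (t (φ k)) x| +
            |(t (φ k) : ℝ) - t₀|) := by
          refine integral_mono_of_nonneg (ae_of_all _ fun x => abs_nonneg _)
            (hi.add (integrable_const _)) (ae_of_all _ fun x => ?_)
          have := abs_limitAge_sub_le (γ := γ) t₀ (t (φ k)) x
          simp only
          refine (abs_sub_le _ (limitAge γ (t (φ k)) x) _).trans (by gcongr)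
      _ = (∫ x : I, |(X (φ k) (lb (φ k) (block (n (φ k)) x)) : ℝ) - limitAge γ (t (φ k)) x|) +
            |(t (φ k) : ℝ) - t₀| := by
          rw [integral_add hi (integrable_const _)]; simp
      _ ≤ _ := by gcongr; exact hX _
  have hemp : Tendsto (fun k => empirical (X (φ k))) atTop (𝓝 (limitLaw hγ t₀)) := by
    rw [tendsto_iff_forall_lipschitz_integral_tendsto]
    rintro f ⟨B, hB⟩ ⟨L, hL⟩
    rw [tendsto_iff_dist_tendsto_zero]
    have hL0 := hX0.const_mul (L : ℝ)
    rw [mul_zero] at hL0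
    refine squeeze_zero (fun k => dist_nonneg) (fun k => ?_) hL0
    rw [integral_empirical (X (φ k)) (lb (φ k))]
    have e : ∫ z, f z ∂(limitLaw hγ t₀ : Measure I) = ∫ x : I, f (limitAgeI γ t₀ x) :=
      integral_map (measurable_limitAgeI hγ t₀).aemeasurable hL.continuous.aestronglyMeasurable
    have hfb : ∀ z, |f z| ≤ B + |f 0| := fun z => by
      have := hB z 0
      rw [Real.dist_eq] at this
      calc |f z| = |(f z - f 0) + f 0| := by ring_nf
        _ ≤ _ := (abs_add_le _ _).trans (by gcongr)
    have hXm : Measurable fun x => X (φ k) (lb (φ k) (block (n (φ k)) x)) :=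
      (measurable_of_finite fun v => X (φ k) (lb (φ k) v)).comp (measurable_block _)
    have hfm := hL.continuous.measurable
    have hi1 : Integrable fun x => f (X (φ k) (lb (φ k) (block (n (φ k)) x))) :=
      integrable_of_measurable_bounded (hfm.comp hXm) fun x => hfb _
    have hi2 : Integrable fun x => f (limitAgeI γ t₀ x) :=
      integrable_of_measurable_bounded (hfm.comp (measurable_limitAgeI hγ t₀)) fun x => hfb _
    rw [e, Real.dist_eq, ← integral_sub hi1 hi2, ← integral_const_mul]
    refine (abs_integral_le_integral_abs).trans ?_
    refine integral_mono_of_nonneg (ae_of_all _ fun x => abs_nonneg _) ?_ (ae_of_all _ fun x => ?_)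
    · refine integrable_of_measurable_bounded (B := L * 1) (((measurable_subtype_coe.comp hXm).sub
        (measurable_limitAge hγ t₀)).abs.const_mul _) fun x => ?_
      have h1 := limitAge_mem hγ t₀ x
      have h2 := (X (φ k) (lb (φ k) (block (n (φ k)) x))).2
      rw [abs_mul, abs_abs, NNReal.abs_eq]
      refine mul_le_mul_of_nonneg_left ?_ L.2
      rw [abs_le]
      constructor <;> linarith [h1.1, h1.2, h2.1, h2.2]
    · have := hL.dist_le_mul (X (φ k) (lb (φ k) (block (n (φ k)) x))) (limitAgeI γ t₀ x)
      rwa [Real.dist_eq, Subtype.dist_eq, Real.dist_eq, coe_limitAgeI hγ] at this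
  obtain ⟨m, -, hm⟩ := id hd
  have htri : ∀ F F' F'', d F F'' ≤ d F F' + d F'' F' := fun F F' F'' => by
    simp_rw [← hm]
    exact @dist_triangle_right _ m.toPseudoMetricSpace _ _ _
  have hsum := (hd.tendsto hemp).add (hd.tendsto hlim)
  rw [add_zero] at hsum
  obtain ⟨k, hk⟩ := (hsum.eventually_lt_const hε).exists
  exact absurd (hfar (φ k)) (not_le.2 ((htri _ _ _).trans_lt hk))

end

/-! ### Ages in the random graph process -/

/-- The time at which the clock last rang before or at time `t` (`0` if it has not rung). -/
def birthTime (z : ℕ → ℝ × ℝ) (t : ℝ) : ℝ :=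
  sSup ({0} ∪ {τ : ℝ | τ ≤ t ∧ ∃ k, ringTime z k = τ})

lemma birthTime_bddAbove (z : ℕ → ℝ × ℝ) (t : ℝ) :
    BddAbove ({0} ∪ {τ : ℝ | τ ≤ t ∧ ∃ k, ringTime z k = τ}) := by
  refine ⟨max t 0, ?_⟩
  rintro τ (hτ | hτ)
  · rw [mem_singleton_iff.1 hτ]; exact le_max_right _ _
  · exact hτ.1.trans (le_max_left _ _)

lemma birthTime_nonneg (z : ℕ → ℝ × ℝ) (t : ℝ) : 0 ≤ birthTime z t :=
  le_csSup (birthTime_bddAbove z t) (Or.inl rfl)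

lemma birthTime_le_iff {s : ℝ} (hs : 0 ≤ s) (z : ℕ → ℝ × ℝ) (t : ℝ) :
    birthTime z t ≤ s ↔ ¬ HasRing s t z := by
  constructor
  · rintro h ⟨k, h1, h2⟩
    exact absurd ((le_csSup (birthTime_bddAbove z t) (Or.inr ⟨h2, k, rfl⟩)).trans h) (not_le.2 h1)
  · intro h
    refine csSup_le ⟨0, Or.inl rfl⟩ ?_
    rintro τ (hτ | ⟨hτ, k, rfl⟩)
    · rw [mem_singleton_iff.1 hτ]; exact hs
    · by_contra! hlt
      exact h ⟨k, hlt, hτ⟩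

lemma birthTime_le {t : ℝ} (ht : 0 ≤ t) (z : ℕ → ℝ × ℝ) : birthTime z t ≤ t :=
  (birthTime_le_iff ht z t).2 fun ⟨_, h1, h2⟩ => absurd h2 (not_le.2 h1)

lemma birthTime_eq {s t : ℝ} (hst : s ≤ t) {z : ℕ → ℝ × ℝ} (h : ¬ HasRing s t z) :
    birthTime z t = birthTime z s := by
  refine eq_of_forall_ge_iff fun c => ?_
  rcases lt_or_ge c 0 with hc | hc
  · constructor <;> intro h' <;> linarith [birthTime_nonneg z s, birthTime_nonneg z t]
  · rw [birthTime_le_iff hc, birthTime_le_iff hc, not_iff_not]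
    constructor
    · rintro ⟨k, h1, h2⟩
      exact ⟨k, h1, not_lt.1 fun h3 => h ⟨k, h3, h2⟩⟩
    · rintro ⟨k, h1, h2⟩
      exact ⟨k, h1, h2.trans hst⟩

lemma coe_age (z : ℕ → ℝ × ℝ) (t : I) : (age z t : ℝ) = t - birthTime z t :=
  coe_clamp_of_mem ⟨sub_nonneg.2 (birthTime_le t.2.1 z),
    (sub_le_self _ (birthTime_nonneg z t)).trans t.2.2⟩

lemma birthTime_mem (z : ℕ → ℝ × ℝ) (t : I) : birthTime z t ∈ Icc (0 : ℝ) t :=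
  ⟨birthTime_nonneg z t, birthTime_le t.2.1 z⟩

lemma measurable_birthTime :
    Measurable fun p : (ℕ → ℝ × ℝ) × ℝ => birthTime p.1 p.2 := by
  refine measurable_of_Iic fun s => ?_
  rcases lt_or_ge s 0 with hs | hs
  · have : (fun p : (ℕ → ℝ × ℝ) × ℝ => birthTime p.1 p.2) ⁻¹' Iic s = ∅ := by
      ext p
      simp only [mem_preimage, mem_Iic, mem_empty_iff_false, iff_false, not_le]
      exact hs.trans_le (birthTime_nonneg _ _)
    rw [this]; exact MeasurableSet.empty
  · have : (fun p : (ℕ → ℝ × ℝ) × ℝ => birthTime p.1 p.2) ⁻¹' Iic s =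
        (⋃ k, {p | s < ringTime p.1 k ∧ ringTime p.1 k ≤ p.2})ᶜ := by
      ext p
      simp only [mem_preimage, mem_Iic, birthTime_le_iff hs, HasRing, mem_compl_iff, mem_iUnion]
      rfl
    rw [this]
    refine (MeasurableSet.iUnion fun k => ?_).compl
    have hk : Measurable fun p : (ℕ → ℝ × ℝ) × ℝ => ringTime p.1 k :=
      (measurable_ringTime k).comp measurable_fst
    exact (measurableSet_lt measurable_const hk).inter (measurableSet_le hk measurable_snd)

lemma measurable_age (t : I) : Measurable fun z => age z t :=
  continuous_clamp.measurable.comp (measurable_const.sub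
    (measurable_birthTime.comp (measurable_id.prodMk measurable_const)))

section
variable {r : ℝ} [hr : Fact (0 < r)]

/-- A realisation of a clock with positive waiting times and finitely many rings in `[0,1]`. -/
structure RegularClock (z : ℕ → ℝ × ℝ) : Prop where
  wait_pos : ∀ k, 0 < (z k).1
  unbounded : ∃ k, 1 < ringTime z k

lemma ae_regularClock : ∀ᵐ z ∂(clockLaw r), RegularClock z := by
  filter_upwards [ae_clock_wait_pos (r := r), ae_ringTime_unbounded (r := r)] with z h1 h2
  exact ⟨h1, h2⟩

lemma RegularClock.finite {z : ℕ → ℝ × ℝ} (hz : RegularClock z) : {k | ringTime z k ≤ 1}.Finite := by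
  obtain ⟨k₀, hk₀⟩ := hz.unbounded
  have hmono : StrictMono (ringTime z) := strictMono_nat_of_lt_succ fun k => by
    rw [ringTime_succ]; linarith [hz.wait_pos (k + 1)]
  exact (finite_Iio k₀).subset fun k hk => hmono.lt_iff_lt.1 (lt_of_le_of_lt hk hk₀)

lemma RegularClock.birthTime_mem {z : ℕ → ℝ × ℝ} (hz : RegularClock z) {t : ℝ} (ht : t ≤ 1) :
    birthTime z t = 0 ∨ birthTime z t ≤ t ∧ ∃ k, ringTime z k = birthTime z t := by
  have hfin : ({0} ∪ {τ : ℝ | τ ≤ t ∧ ∃ k, ringTime z k = τ} : Set ℝ).Finite := by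
    refine (finite_singleton 0).union ((hz.finite.image (ringTime z)).subset ?_)
    rintro _ ⟨h, k, rfl⟩
    exact ⟨k, h.trans ht, rfl⟩
  have hne : ({0} ∪ {τ : ℝ | τ ≤ t ∧ ∃ k, ringTime z k = τ} : Set ℝ).Nonempty := ⟨0, Or.inl rfl⟩
  exact hne.csSup_mem hfin

/-- The age of a vertex has the law `F*(t)`. -/
lemma prob_age_le (t u : I) : (clockLaw r).real {z | age z t ≤ u} =
    (volume : Measure I).real {x | limitAgeI r t x ≤ u} := by
  have hr0 := hr.out
  have h1 : (volume : Measure I).real {x | limitAgeI r t x ≤ u} =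
      if u < t then 1 - Real.exp (-r * u) else 1 := by
    rw [← limitLaw_cdf hr0 t u]
    have hms : MeasurableSet {z : I | z ≤ u} := measurableSet_Iic
    change _ = ((volume : Measure I).map (limitAgeI r t)).real {z : I | z ≤ u}
    rw [map_measureReal_apply (measurable_limitAgeI hr0 t) hms]
    rfl
  rw [h1]
  split_ifs with hut
  · have hut' : (u : ℝ) < t := hut
    have e : {z | age z t ≤ u} =ᵐ[clockLaw r] ({z | ¬ HasRing ((t : ℝ) - u) t z}ᶜ : Set _) := by
      filter_upwards [ae_ringTime_ne (r := r) (y := (t : ℝ) - u) (by linarith)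
        (by linarith [t.2.2, u.2.1]), ae_regularClock (r := r)] with z hz hz'
      refine propext ?_
      change age z t ≤ u ↔ ¬ ¬ HasRing ((t : ℝ) - u) t z
      rw [not_not, ← Subtype.coe_le_coe, coe_age, sub_le_comm]
      constructor
      · intro h
        rcases hz'.birthTime_mem t.2.2 with h0 | ⟨h0, k, hk⟩
        · rw [h0] at h; linarith
        · exact ⟨k, lt_of_le_of_ne (by rw [hk]; exact h) (hz k).symm, by rw [hk]; exact h0⟩
      · rintro ⟨k, hk1, hk2⟩
        exact hk1.le.trans (le_csSup (birthTime_bddAbove z t) (Or.inr ⟨hk2, k, rfl⟩))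
    have hm : MeasurableSet {z | ¬ HasRing ((t : ℝ) - u) t z} := (measurableSet_hasRing _ _).compl
    rw [measureReal_congr e, probReal_compl_eq_one_sub hm,
      prob_not_hasRing (by linarith) (by linarith [u.2.1]) t.2.2]
    congr 2; ring
  · have : {z | age z t ≤ u} = univ := by
      ext z
      simp only [mem_univ, iff_true]
      change age z t ≤ u
      rw [← Subtype.coe_le_coe, coe_age]
      have : (t : ℝ) ≤ u := not_lt.1 hut
      linarith [birthTime_nonneg z t]
    rw [this, probReal_univ]

end

section
variable {γ C : ℝ} [hγ : Fact (0 < γ)] [hC : Fact (0 < C)] {n : ℕ}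

lemma integral_clock (c : Clock n) {f : (ℕ → ℝ × ℝ) → ℝ} (hf : Measurable f) :
    ∫ z, f (z c) ∂(clocksLaw γ C n) = ∫ z, f z ∂(clockLaw (c.rate γ C)) := by
  have h := measurePreserving_eval (fun c : Clock n => clockLaw (c.rate γ C)) c
  rw [← h.map_eq, integral_map h.measurable.aemeasurable hf.aestronglyMeasurable]
  rfl

lemma prob_clock (c : Clock n) {A : Set (ℕ → ℝ × ℝ)} (hA : MeasurableSet A) :
    (clocksLaw γ C n).real {z | z c ∈ A} = (clockLaw (c.rate γ C)).real A := by
  have h := measurePreserving_eval (fun c : Clock n => clockLaw (c.rate γ C)) c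
  rw [measureReal_def, measureReal_def, ← h.measure_preimage hA.nullMeasurableSet]
  rfl

lemma ae_clock (c : Clock n) {p : (ℕ → ℝ × ℝ) → Prop} (h : ∀ᵐ z ∂(clockLaw (c.rate γ C)), p z) :
    ∀ᵐ z ∂(clocksLaw γ C n), p (z c) :=
  (measurePreserving_eval (fun c : Clock n => clockLaw (c.rate γ C)) c).quasiMeasurePreserving.ae h

lemma measurable_empiricalCdf (t : I) : Measurable fun q : Clocks n × I =>
    (n : ℝ)⁻¹ * ∑ v, {v | vertexAge q.1 t v ≤ q.2}.indicator (1 : Fin n → ℝ) v := by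
  refine (Finset.measurable_sum _ fun v _ => ?_).const_mul _
  have hm : MeasurableSet {q : Clocks n × I | vertexAge q.1 t v ≤ q.2} :=
    measurableSet_le ((measurable_age t).comp ((measurable_pi_apply _).comp measurable_fst))
      measurable_snd
  exact (measurable_one.indicator hm : Measurable
    ({q : Clocks n × I | vertexAge q.1 t v ≤ q.2}.indicator (1 : Clocks n × I → ℝ)))

variable [NeZero n]

/-- By independence, the empirical distribution function at a point has fluctuations of order
`1 / √n`. -/
lemma integral_abs_empiricalCdf_sub_le (t u : I) :
    ∫ z, |(n : ℝ)⁻¹ * ∑ v, {v | vertexAge z t v ≤ u}.indicator (1 : Fin n → ℝ) v -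
      (volume : Measure I).real {x | limitAgeI γ t x ≤ u}| ∂(clocksLaw γ C n) ≤ 1 / √n := by
  have hn : (0 : ℝ) < n := Nat.cast_pos.2 (NeZero.pos n)
  set p := (volume : Measure I).real {x | limitAgeI γ t x ≤ u} with hp
  set A : Set (ℕ → ℝ × ℝ) := {z | age z t ≤ u} with hA
  have hAm : MeasurableSet A := measurableSet_le (measurable_age t) measurable_const
  set ξ : Fin n → Clocks n → ℝ := fun v z => A.indicator 1 (z (.vertex v)) with hξ
  have hξm : ∀ v, Measurable (ξ v) := fun v =>
    (measurable_one.indicator hAm).comp (measurable_pi_apply _)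
  have hmean : ∀ v, ∫ z, ξ v z ∂(clocksLaw γ C n) = p := fun v => by
    rw [integral_clock (.vertex v) (measurable_one.indicator hAm), integral_indicator_one hAm, hp,
      ← prob_age_le]
    rfl
  have hvar := integral_sq_sum_sub_le (μ := fun c : Clock n => clockLaw (c.rate γ C)) hξm
    (s := fun v => {.vertex v}) (fun v z => by
      simp only [hξ, indicator, Pi.one_apply]; split_ifs <;> simp)
    (fun v x y h => by simp only [hξ]; rw [h (.vertex v) rfl])
    (A := Finset.univ.image fun v => (v, v)) (fun q hq => by
      rw [Set.disjoint_singleton]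
      intro h
      refine hq (Finset.mem_image.2 ⟨q.1, Finset.mem_univ _, Prod.ext rfl ?_⟩)
      simpa using h)
  have hcard : ((Finset.univ.image fun v : Fin n => (v, v)).card : ℝ) ≤ n := by
    have := Finset.card_image_le (s := (Finset.univ : Finset (Fin n))) (f := fun v => (v, v))
    rw [Finset.card_univ, Fintype.card_fin] at this
    exact_mod_cast this
  change ∫ z, (∑ v, (ξ v z - ∫ z, ξ v z ∂(clocksLaw γ C n))) ^ 2 ∂(clocksLaw γ C n) ≤ _ at hvar
  simp only [hmean] at hvar
  have hsq := Real.sqrt_pos.2 hn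
  have hsq2 := Real.mul_self_sqrt hn.le
  have hS : ∀ z, (n : ℝ)⁻¹ * ∑ v, {v | vertexAge z t v ≤ u}.indicator (1 : Fin n → ℝ) v - p =
      (n : ℝ)⁻¹ * ∑ v, (ξ v z - p) := fun z => by
    have : ∀ v, {v | vertexAge z t v ≤ u}.indicator (1 : Fin n → ℝ) v = ξ v z := fun v => rfl
    simp only [this, Finset.sum_sub_distrib, Finset.sum_const, Finset.card_univ, Fintype.card_fin,
      nsmul_eq_mul]
    field_simp
  simp_rw [hS]
  have hSm : Measurable fun z => ∑ v, (ξ v z - p) :=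
    Finset.measurable_sum _ fun v _ => (hξm v).sub_const _
  have hSb : ∀ z, |∑ v, (ξ v z - p)| ≤ ∑ _v : Fin n, (1 + |p|) := fun z => by
    refine (Finset.abs_sum_le_sum_abs _ _).trans (Finset.sum_le_sum fun v _ => ?_)
    refine (abs_sub _ _).trans (by
      gcongr
      simp only [hξ, indicator, Pi.one_apply]; split_ifs <;> simp)
  have hSi : Integrable (fun z => (∑ v, (ξ v z - p)) ^ 2) (clocksLaw γ C n) :=
    integrable_of_measurable_bounded (hSm.pow_const 2) (B := (∑ _v : Fin n, (1 + |p|)) ^ 2)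
      fun z => by rw [abs_pow]; exact pow_le_pow_left₀ (abs_nonneg _) (hSb z) 2
  -- bound `|x|` by `(x ^ 2 / √n + √n) / 2`
  calc ∫ z, |(n : ℝ)⁻¹ * ∑ v, (ξ v z - p)| ∂(clocksLaw γ C n)
      ≤ ∫ z, (n : ℝ)⁻¹ * (((√n)⁻¹ * (∑ v, (ξ v z - p)) ^ 2 + √n) / 2) ∂(clocksLaw γ C n) := by
        refine integral_mono_of_nonneg (ae_of_all _ fun z => abs_nonneg _)
          ((((hSi.const_mul _).add (integrable_const _)).div_const 2).const_mul _)
          (ae_of_all _ fun z => ?_)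
        simp only
        rw [abs_mul, abs_of_pos (inv_pos.2 hn)]
        refine mul_le_mul_of_nonneg_left ?_ (inv_pos.2 hn).le
        set x := ∑ v, (ξ v z - p)
        rw [le_div_iff₀ two_pos, inv_mul_eq_div, ← sub_nonneg]
        have e : x ^ 2 / √n + √n - |x| * 2 = (|x| - √n) ^ 2 / √n := by
          rw [← sq_abs x]; field_simp; ring
        rw [e]; positivity
    _ = (n : ℝ)⁻¹ * (((√n)⁻¹ * (∫ z, (∑ v, (ξ v z - p)) ^ 2 ∂(clocksLaw γ C n)) + √n) / 2) := by
        rw [integral_const_mul, integral_div, integral_add (hSi.const_mul _) (integrable_const _),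
          integral_const_mul]
        simp
    _ ≤ (n : ℝ)⁻¹ * (((√n)⁻¹ * n + √n) / 2) := by
        gcongr; exact hvar.trans hcard
    _ = 1 / √n := by
        have h3 : (√n : ℝ)⁻¹ * n = √n := by rw [inv_mul_eq_iff_eq_mul₀ hsq.ne', hsq2]
        rw [h3, add_self_div_two, eq_div_iff hsq.ne', mul_assoc, hsq2, inv_mul_cancel₀ hn.ne']

lemma prob_ageDiscrepancy_gt_le (t : I) {δ : ℝ} (hδ : 0 < δ) :
    (clocksLaw γ C n).real {z | δ < ageDiscrepancy γ t (vertexAge z t)} ≤ 1 / (√n * δ) := by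
  have hn : (0 : ℝ) < n := Nat.cast_pos.2 (NeZero.pos n)
  set f : Clocks n × I → ℝ := fun q => |(n : ℝ)⁻¹ * ∑ v,
    {v | vertexAge q.1 t v ≤ q.2}.indicator (1 : Fin n → ℝ) v -
    (volume : Measure I).real {x | limitAgeI γ t x ≤ q.2}| with hf
  have hpm : Measurable fun u : I => (volume : Measure I).real {x | limitAgeI γ t x ≤ u} := by
    have : Monotone fun u : I => (volume : Measure I).real {x | limitAgeI γ t x ≤ u} :=
      fun u v huv => measureReal_mono fun x hx => le_trans hx huv
    exact this.measurable
  have hfm : Measurable f := ((measurable_empiricalCdf t).sub (hpm.comp measurable_snd)).abs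
  have hfi : Integrable f ((clocksLaw γ C n).prod volume) :=
    integrable_of_measurable_bounded hfm (B := 1) fun q => by
      rw [hf, abs_abs]
      have h1 : (n : ℝ)⁻¹ * ∑ v, {v | vertexAge q.1 t v ≤ q.2}.indicator (1 : Fin n → ℝ) v
          ∈ Icc (0 : ℝ) 1 := by
        constructor
        · exact mul_nonneg (inv_pos.2 hn).le (Finset.sum_nonneg fun v _ =>
            indicator_nonneg (fun _ _ => zero_le_one) _)
        · rw [inv_mul_le_iff₀ hn, mul_one]
          calc _ ≤ ∑ _v : Fin n, (1 : ℝ) := Finset.sum_le_sum fun v _ =>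
                indicator_le_self' (fun _ _ => zero_le_one) v
            _ = n := by simp
      have h2 : (volume : Measure I).real {x | limitAgeI γ t x ≤ q.2} ≤ 1 := measureReal_le_one
      have h3 : 0 ≤ (volume : Measure I).real {x | limitAgeI γ t x ≤ q.2} := measureReal_nonneg
      rw [abs_le]
      constructor <;> linarith [h1.1, h1.2]
  have hE : ∫ z, ageDiscrepancy γ t (vertexAge z t) ∂(clocksLaw γ C n) ≤ 1 / √n := by
    calc _ = ∫ u, ∫ z, f (z, u) ∂(clocksLaw γ C n) :=
          integral_integral_swap (f := fun z u => f (z, u)) hfi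
      _ ≤ ∫ _u : I, 1 / √n := by
          refine integral_mono hfi.integral_prod_right (integrable_const _) fun u => ?_
          exact integral_abs_empiricalCdf_sub_le t u
      _ = _ := by simp
  have hint : Integrable (fun z => ageDiscrepancy γ t (vertexAge z t)) (clocksLaw γ C n) :=
    hfi.integral_prod_left
  have hmk := mul_meas_ge_le_integral_of_nonneg (ae_of_all _ fun z =>
    integral_nonneg fun u => abs_nonneg _) hint δ
  have hsub : (clocksLaw γ C n).real {z | δ < ageDiscrepancy γ t (vertexAge z t)} ≤
      (clocksLaw γ C n).real {z | δ ≤ ageDiscrepancy γ t (vertexAge z t)} :=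
    measureReal_mono fun z (hz : δ < _) => hz.le
  refine hsub.trans ?_
  rw [one_div, mul_inv, ← div_eq_mul_inv, le_div_iff₀ hδ, mul_comm, ← one_div]
  exact hmk.trans hE

end

/-- Between two times, the discrepancy of the ages changes by at most the elapsed time and the
proportion of clocks that ring. -/
lemma ageDiscrepancy_le {γ : ℝ} (hγ : 0 < γ) {n : ℕ} [NeZero n] {s t : I} (hst : s ≤ t)
    (z : Clocks n) (D : Fin n → ℝ) (hD0 : ∀ v, 0 ≤ D v)
    (hD : ∀ v, HasRing s t (z (.vertex v)) → 1 ≤ D v) :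
    ageDiscrepancy γ t (vertexAge z t) ≤
      ageDiscrepancy γ s (vertexAge z s) + 2 * (t - s) + (n : ℝ)⁻¹ * ∑ v, D v := by
  have hn : (0 : ℝ) < n := Nat.cast_pos.2 (NeZero.pos n)
  have hst' : (s : ℝ) ≤ t := hst
  -- the distribution functions at time `r` of the vertex ages and of the limit
  set F : I → I → ℝ := fun r u =>
    (n : ℝ)⁻¹ * ∑ v, {v | vertexAge z r v ≤ u}.indicator (1 : Fin n → ℝ) v with hF
  set Q : I → I → ℝ := fun r u => (volume : Measure I).real {x | limitAgeI γ r x ≤ u} with hQ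
  have hQm : ∀ r, Monotone (Q r) := fun r u v huv => measureReal_mono fun x hx => le_trans hx huv
  have hQ1 : ∀ r u, Q r u ∈ Icc (0 : ℝ) 1 := fun r u => ⟨measureReal_nonneg, measureReal_le_one⟩
  have hFm : ∀ r, Monotone (F r) := fun r u v huv => by
    refine mul_le_mul_of_nonneg_left (Finset.sum_le_sum fun w _ => ?_) (inv_pos.2 hn).le
    exact indicator_le_indicator_of_subset (fun x hx => le_trans hx huv)
      (fun _ => zero_le_one) w
  have hF1 : ∀ r u, F r u ∈ Icc (0 : ℝ) 1 := fun r u => by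
    constructor
    · exact mul_nonneg (inv_pos.2 hn).le (Finset.sum_nonneg fun v _ =>
        indicator_nonneg (fun _ _ => zero_le_one) _)
    · rw [hF]
      simp only
      rw [inv_mul_le_iff₀ hn, mul_one]
      calc _ ≤ ∑ _v : Fin n, (1 : ℝ) := Finset.sum_le_sum fun v _ =>
            indicator_le_self' (fun _ _ => zero_le_one) v
        _ = n := by simp
  have hint : ∀ f g : I → ℝ, Monotone f → Monotone g → (∀ u, f u ∈ Icc (0 : ℝ) 1) →
      (∀ u, g u ∈ Icc (0 : ℝ) 1) → Integrable fun u => |f u - g u| := fun f g hf hg hf1 hg1 =>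
    integrable_of_measurable_bounded (hf.measurable.sub hg.measurable).abs (B := 1) fun u => by
      rw [abs_abs, abs_le]
      constructor <;> linarith [(hf1 u).1, (hf1 u).2, (hg1 u).1, (hg1 u).2]
  have i1 := hint _ _ (hFm t) (hFm s) (hF1 t) (hF1 s)
  have i2 := hint _ _ (hFm s) (hQm s) (hF1 s) (hQ1 s)
  have i3 := hint _ _ (hQm s) (hQm t) (hQ1 s) (hQ1 t)
  have i12 : Integrable fun u => |F t u - F s u| + |F s u - Q s u| := i1.add i2
  have b3 : ∫ u, |Q s u - Q t u| ≤ t - s := by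
    have hq : ∀ r, Monotone (limitAgeI γ r) := fun r x y hxy => by
      rw [← Subtype.coe_le_coe, coe_limitAgeI hγ, coe_limitAgeI hγ]
      exact limitAge_mono hγ r hxy
    rw [← integral_abs_sub_le_of_monotone (hq s) (hq t)]
    calc _ ≤ ∫ _x : I, ((t : ℝ) - s) := by
          refine integral_mono_of_nonneg (ae_of_all _ fun x => abs_nonneg _) (integrable_const _)
            (ae_of_all _ fun x => ?_)
          simp only
          rw [coe_limitAgeI hγ, coe_limitAgeI hγ, abs_sub_comm,
            ← abs_of_nonneg (sub_nonneg.2 hst')]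
          exact abs_limitAge_sub_le s t x
      _ = _ := by simp
  have b1 : ∫ u, |F t u - F s u| ≤ (t - s) + (n : ℝ)⁻¹ * ∑ v, D v := by
    set f : Fin n → I → ℝ := fun v u => |(if vertexAge z t v ≤ u then (1 : ℝ) else 0) -
      (if vertexAge z s v ≤ u then (1 : ℝ) else 0)| with hf
    have hfi : ∀ v, Integrable (f v) := fun v =>
      integrable_of_measurable_bounded ((Measurable.ite measurableSet_Ici measurable_const
        measurable_const).sub (Measurable.ite measurableSet_Ici measurable_const
        measurable_const)).abs (B := 1) fun u => by
          rw [hf]; simp only; split_ifs <;> simp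
    have hle : ∀ u, |F t u - F s u| ≤ (n : ℝ)⁻¹ * ∑ v, f v u := fun u => by
      simp only [hF]
      rw [← mul_sub, ← Finset.sum_sub_distrib, abs_mul, abs_of_pos (inv_pos.2 hn)]
      exact mul_le_mul_of_nonneg_left (Finset.abs_sum_le_sum_abs _ _) (inv_pos.2 hn).le
    have hfv : ∀ v, ∫ u, f v u ≤ (t - s) + D v := fun v => by
      rw [hf, integral_abs_indicator_sub]
      change |(age (z (.vertex v)) t : ℝ) - age (z (.vertex v)) s| ≤ _
      by_cases h : HasRing s t (z (.vertex v))
      · have h1 := (age (z (.vertex v)) t).2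
        have h2 := (age (z (.vertex v)) s).2
        have h3 := hD v h
        rw [abs_le]
        constructor <;> linarith [h1.1, h1.2, h2.1, h2.2]
      · rw [coe_age, coe_age, birthTime_eq hst' h,
          show ∀ a : ℝ, (t : ℝ) - a - (s - a) = t - s by intro a; ring,
          abs_of_nonneg (sub_nonneg.2 hst')]
        linarith [hD0 v]
    calc _ ≤ ∫ u, (n : ℝ)⁻¹ * ∑ v, f v u :=
          integral_mono i1 ((integrable_finsetSum _ fun v _ => hfi v).const_mul _) hle
      _ = (n : ℝ)⁻¹ * ∑ v, ∫ u, f v u := by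
          rw [integral_const_mul, integral_finsetSum _ fun v _ => hfi v]
      _ ≤ (n : ℝ)⁻¹ * ∑ v, (((t : ℝ) - s) + D v) :=
          mul_le_mul_of_nonneg_left (Finset.sum_le_sum fun v _ => hfv v) (inv_pos.2 hn).le
      _ = _ := by
          rw [Finset.sum_add_distrib, mul_add]
          simp only [Finset.sum_const, Finset.card_univ, Fintype.card_fin, nsmul_eq_mul]
          field_simp
  change ∫ u, |F t u - Q t u| ≤ (∫ u, |F s u - Q s u|) + _ + _
  calc ∫ u, |F t u - Q t u| ≤ ∫ u, (|F t u - F s u| + |F s u - Q s u| + |Q s u - Q t u|) := by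
        refine integral_mono (hint _ _ (hFm t) (hQm t) (hF1 t) (hQ1 t)) (i12.add i3)
          fun u => ?_
        have h1 := abs_sub_le (F t u) (F s u) (Q t u)
        have h2 := abs_sub_le (F s u) (Q s u) (Q t u)
        linarith
    _ = (∫ u, |F t u - F s u|) + (∫ u, |F s u - Q s u|) + ∫ u, |Q s u - Q t u| := by
        rw [integral_add i12 i3, integral_add i1 i2]
    _ ≤ _ := by linarith

/-! ### The edges of the idealised process -/

section
variable {K : ℝ} {r : I → I → I → UnlabelledGraphon → ℝ} {g : I → Graphon}

/-- The rate `r` at time `s` for a pair of vertices born at the times `b` and `b'`, in the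
environment given by the path `g`. -/
def threshold (r : I → I → I → UnlabelledGraphon → ℝ) (g : I → Graphon) (b b' s : ℝ) : ℝ :=
  r (clamp s) (clamp (s - b)) (clamp (s - b')) (g (clamp s)).unlabel

lemma continuous_threshold (hr : TameRate r K) (hg : Continuous g) :
    Continuous fun p : ℝ × ℝ × ℝ => threshold r g p.1 p.2.1 p.2.2 := by
  have hc := continuous_clamp
  exact (hr.cont _ (tendsto_cutMetric_of_continuous hg)).comp
    (g := fun p : I × I × I => r p.1 p.2.1 p.2.2 (g p.1).unlabel)
    (f := fun p : ℝ × ℝ × ℝ => (clamp p.2.2, clamp (p.2.2 - p.1), clamp (p.2.2 - p.2.1)))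
    (by fun_prop)

lemma continuous_threshold_right (hr : TameRate r K) (hg : Continuous g) (b b' : ℝ) :
    Continuous (threshold r g b b') :=
  (continuous_threshold hr hg).comp (g := fun p : ℝ × ℝ × ℝ => threshold r g p.1 p.2.1 p.2.2)
    (f := fun s => (b, b', s)) (by fun_prop)

end

section
variable {γ C : ℝ} [hγ : Fact (0 < γ)] [hC : Fact (0 < C)] {n : ℕ}

lemma integral_clock₂ {c c' : Clock n} (hcc : c ≠ c') {Φ : (ℕ → ℝ × ℝ) → (ℕ → ℝ × ℝ) → ℝ}
    (hΦ : Measurable (Function.uncurry Φ)) {B : ℝ} (hB : ∀ w w', |Φ w w'| ≤ B) :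
    ∫ z, Φ (z c) (z c') ∂(clocksLaw γ C n) =
      ∫ w', ∫ w, Φ w w' ∂(clockLaw (c.rate γ C)) ∂(clockLaw (c'.rate γ C)) := by
  have hcc' : Measurable fun z : Clocks n => (z c, z c') :=
    (measurable_pi_apply c).prodMk (measurable_pi_apply c')
  have hm : Measurable fun z : Clocks n => Φ (z c) (z c') := hΦ.comp hcc'
  have h := integral_resample (μ := fun c : Clock n => clockLaw (c.rate γ C)) {c}
    (integrable_of_measurable_bounded hm fun z => hB _ _)
  change ∫ z, Φ (z c) (z c') ∂(clocksLaw γ C n) =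
    ∫ x, ∫ y, Φ (resample {c} (x, y) c) (resample {c} (x, y) c')
      ∂(clocksLaw γ C n) ∂(clocksLaw γ C n) at h
  rw [h]
  have e : ∀ x : Clocks n, ∫ y, Φ (resample {c} (x, y) c) (resample {c} (x, y) c')
      ∂(clocksLaw γ C n) = ∫ w, Φ w (x c') ∂(clockLaw (c.rate γ C)) := fun x => by
    simp only [resample, mem_singleton_iff, if_true, hcc.symm, if_false]
    exact integral_clock c (hΦ.comp (measurable_id.prodMk measurable_const))
  simp_rw [e]
  refine integral_clock c' (f := fun w' => ∫ w, Φ w w' ∂(clockLaw (c.rate γ C))) ?_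
  exact (hΦ.stronglyMeasurable.integral_prod_left' (μ := clockLaw (c.rate γ C))).measurable

variable {K : ℝ} {l m : I → I → I → UnlabelledGraphon → ℝ} {g : I → Graphon}
  {U : ℝ → ℝ → ℝ → ℝ}

/-- The birth time of a vertex at time `t`. -/
def vertexBirth (z : Clocks n) (t : ℝ) (v : Fin n) : ℝ := birthTime (z (.vertex v)) t

/-- The state at time `t` of the pair `ij` in the idealised process, in which the rates are evaluated
in the limiting environment instead of the empirical one. Given the clocks of the vertices, the
states of different pairs are independent. -/
def edgeState (C : ℝ) (l m : I → I → I → UnlabelledGraphon → ℝ) (g : I → Graphon) (t : I)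
    (z : Clocks n) (i j : Fin n) : Prop :=
  EdgeActive C (threshold l g (vertexBirth z t i) (vertexBirth z t j))
    (threshold m g (vertexBirth z t i) (vertexBirth z t j))
    (max (vertexBirth z t i) (vertexBirth z t j)) t (z (.on s(i, j))) (z (.off s(i, j)))

open Classical in
/-- The difference of the state of a pair in the idealised process and its conditional probability
given the clocks of the vertices, with the value `0` on the diagonal. -/
def edgeFluct (C : ℝ) (l m : I → I → I → UnlabelledGraphon → ℝ) (g : I → Graphon)
    (U : ℝ → ℝ → ℝ → ℝ) (t : I) (i j : Fin n) (z : Clocks n) : ℝ :=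
  if i = j then 0 else
    (if edgeState C l m g t z i j then 1 else 0) - U t (vertexBirth z t i) (vertexBirth z t j)

lemma measurable_vertexBirth (v : Fin n) :
    Measurable fun p : Clocks n × ℝ => vertexBirth p.1 p.2 v := by
  have h : Measurable fun p : Clocks n × ℝ => (p.1 (.vertex v), p.2) :=
    ((measurable_pi_apply (Clock.vertex v)).comp measurable_fst).prodMk measurable_snd
  exact measurable_birthTime.comp h

lemma measurable_vertexBirth_left (t : ℝ) (v : Fin n) :
    Measurable fun z : Clocks n => vertexBirth z t v :=
  (measurable_vertexBirth v).comp (measurable_id.prodMk measurable_const)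

omit hC in
lemma measurableSet_edgeActive {ℓ μ : ℝ → ℝ} (hℓ : Measurable ℓ) (hμ : Measurable μ) (b t : ℝ) :
    MeasurableSet {p : (ℕ → ℝ × ℝ) × (ℕ → ℝ × ℝ) | EdgeActive C ℓ μ b t p.1 p.2} :=
  measurableSet_hasAccepted_comp (ℓ := fun _ => ℓ) (hℓ.comp measurable_snd)
    (measurable_lastAccepted (m := fun _ => μ) (hμ.comp measurable_snd) measurable_const t
      measurable_snd) t measurable_fst

omit hC in
lemma measurableSet_edgeState (hl : TameRate l K) (hm : TameRate m K) (hg : Continuous g) (t : I)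
    (i j : Fin n) : MeasurableSet {z : Clocks n | edgeState C l m g t z i j} := by
  have hb : ∀ v : Fin n, Measurable fun z : Clocks n => vertexBirth z t v :=
    measurable_vertexBirth_left t
  have hthr : ∀ {r : I → I → I → UnlabelledGraphon → ℝ}, TameRate r K →
      Measurable (Function.uncurry fun z : Clocks n =>
        threshold r g (vertexBirth z t i) (vertexBirth z t j)) := fun hr =>
    (continuous_threshold hr hg).measurable.comp
      (((hb i).comp measurable_fst).prodMk (((hb j).comp measurable_fst).prodMk measurable_snd))
  exact measurableSet_hasAccepted_comp (hthr hl) (measurable_lastAccepted (hthr hm)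
    ((hb i).max (hb j)) t (measurable_pi_apply _)) t (measurable_pi_apply _)

omit hC in
lemma measurable_edgeFluct (hl : TameRate l K) (hm : TameRate m K) (hU : IsProfile γ l m g U)
    (t : I) (i j : Fin n) : Measurable (edgeFluct C l m g U t i j) := by
  unfold edgeFluct
  by_cases hij : i = j
  · simp only [hij, if_true]; exact measurable_const
  · simp only [hij, if_false]
    refine (Measurable.ite (measurableSet_edgeState hl hm (hU.continuous hγ.out) t i j)
      measurable_const measurable_const).sub ?_
    exact hU.cont.measurable.comp (measurable_const.prodMk
      ((measurable_vertexBirth_left t i).prodMk (measurable_vertexBirth_left t j)))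

omit hγ hC in
lemma abs_edgeFluct_le (hU : IsProfile γ l m g U) (t : I) (i j : Fin n) (z : Clocks n) :
    |edgeFluct C l m g U t i j z| ≤ 1 := by
  unfold edgeFluct
  have h := hU.mem t (vertexBirth z t i) (vertexBirth z t j)
  rw [abs_le]
  split_ifs <;> constructor <;> linarith [h.1, h.2]

lemma dependsOn_vertexBirth (t : ℝ) (v : Fin n) {s : Set (Clock n)} (hs : .vertex v ∈ s) :
    DependsOn (fun z : Clocks n => vertexBirth z t v) s := fun x y h => by
  simp only [vertexBirth]; rw [h _ hs]

omit hC in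
lemma dependsOn_edgeFluct (t : I) (i j : Fin n) :
    DependsOn (edgeFluct C l m g U t i j) (pairClocks i j) := fun x y h => by
  have h1 : vertexBirth x t i = vertexBirth y t i :=
    dependsOn_vertexBirth t i (by simp [pairClocks]) h
  have h2 : vertexBirth x t j = vertexBirth y t j :=
    dependsOn_vertexBirth t j (by simp [pairClocks]) h
  have h3 : edgeState C l m g t x i j = edgeState C l m g t y i j := by
    simp only [edgeState]
    rw [h1, h2, h (.on s(i, j)) (by simp [pairClocks]), h (.off s(i, j)) (by simp [pairClocks])]
  simp only [edgeFluct, h1, h2]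
  rw [h3]

/-- Given the clocks of the vertices, an edge of the idealised process is present with the
probability predicted by the graphon equation. -/
lemma integral_edgeFluct_resample (hl : TameRate l K) (hm : TameRate m K)
    (hlC : ∀ t u v h, l t u v h ≤ C) (hmC : ∀ t u v h, m t u v h ≤ C)
    (hU : IsProfile γ l m g U) (t : I) {i j : Fin n} (hij : i ≠ j) (x : Clocks n) :
    ∫ y, edgeFluct C l m g U t i j (resample (edgeClocks i j) (x, y)) ∂(clocksLaw γ C n) = 0 := by
  classical
  have hg := hU.continuous hγ.out
  set b := vertexBirth x t i with hb
  set b' := vertexBirth x t j with hb'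
  have hb01 : b ∈ Icc (0 : ℝ) t := birthTime_mem _ t
  have hb01' : b' ∈ Icc (0 : ℝ) t := birthTime_mem _ t
  set ℓ := threshold l g b b' with hℓ
  set μ := threshold m g b b' with hμ
  have hℓc : Continuous ℓ := continuous_threshold_right hl hg b b'
  have hμc : Continuous μ := continuous_threshold_right hm hg b b'
  have e : ∀ y : Clocks n, edgeFluct C l m g U t i j (resample (edgeClocks i j) (x, y)) =
      {p : (ℕ → ℝ × ℝ) × (ℕ → ℝ × ℝ) | EdgeActive C ℓ μ (max b b') t p.1 p.2}.indicator (fun _ => (1 : ℝ))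
        (y (.on s(i, j)), y (.off s(i, j))) - U t b b' := fun y => by
    have h1 : resample (edgeClocks i j) (x, y) (.vertex i) = x (.vertex i) := by
      simp [resample, edgeClocks]
    have h2 : resample (edgeClocks i j) (x, y) (.vertex j) = x (.vertex j) := by
      simp [resample, edgeClocks]
    have h3 : resample (edgeClocks i j) (x, y) (.on s(i, j)) = y (.on s(i, j)) := by
      simp [resample, edgeClocks]
    have h4 : resample (edgeClocks i j) (x, y) (.off s(i, j)) = y (.off s(i, j)) := by
      simp [resample, edgeClocks]
    simp only [edgeFluct, if_neg hij, edgeState, vertexBirth, h1, h2, h3, h4]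
    congr 1
  simp_rw [e]
  set A := {p : (ℕ → ℝ × ℝ) × (ℕ → ℝ × ℝ) | EdgeActive C ℓ μ (max b b') t p.1 p.2} with hA
  have hAm : MeasurableSet A := measurableSet_edgeActive hℓc.measurable hμc.measurable _ _
  have hA1 : ∀ p, |A.indicator (fun _ => (1 : ℝ)) p| ≤ 1 := fun p => by
    simp only [indicator]; split_ifs <;> simp
  have hAi : Measurable (A.indicator (fun _ => (1 : ℝ))) := measurable_const.indicator hAm
  have hi : Integrable (fun y : Clocks n =>
      A.indicator (fun _ => (1 : ℝ)) (y (.on s(i, j)), y (.off s(i, j)))) (clocksLaw γ C n) :=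
    integrable_of_measurable_bounded (hAi.comp
      ((measurable_pi_apply (Clock.on s(i, j))).prodMk (measurable_pi_apply (Clock.off s(i, j)))))
      fun y => hA1 _
  rw [integral_sub hi (integrable_const _)]
  have h2 := integral_clock₂ (γ := γ) (C := C) (c := .on s(i, j)) (c' := .off s(i, j))
    (by simp) (Φ := fun w w' => A.indicator (fun _ => (1 : ℝ)) (w, w')) hAi fun w w' => hA1 _
  rw [h2]
  have h3 : ∀ w', ∫ w, A.indicator (fun _ => (1 : ℝ)) (w, w') ∂(clockLaw C) =
      (clockLaw C).real {w | EdgeActive C ℓ μ (max b b') t w w'} := fun w' => by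
    have hm' : MeasurableSet {w | EdgeActive C ℓ μ (max b b') t w w'} :=
      hAm.preimage (measurable_id.prodMk measurable_const)
    rw [← integral_indicator_one hm']
    rfl
  change (∫ w', ∫ w, A.indicator (fun _ => (1 : ℝ)) (w, w') ∂(clockLaw C) ∂(clockLaw C)) - _ = 0
  simp_rw [h3]
  have hmax0 : 0 ≤ max b b' := hb01.1.trans (le_max_left _ _)
  have hmaxt : max b b' ≤ t := max_le hb01.2 hb01'.2
  rw [prob_edgeActive hℓc hμc (fun y => ⟨hl.nonneg _ _ _ _, hlC _ _ _ _⟩)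
    (fun y => ⟨hm.nonneg _ _ _ _, hmC _ _ _ _⟩) hmax0 hmaxt t.2.2]
  let bI : I := ⟨b, hb01.1, hb01.2.trans t.2.2⟩
  let bI' : I := ⟨b', hb01'.1, hb01'.2.trans t.2.2⟩
  have hode := eq_integral_of_linear_ode (φ := fun s => U s b b') hℓc hμc hmaxt
    (hU.birth bI bI') fun s hs => (hU.deriv bI bI' s ⟨hs.1, hs.2.trans t.2.2⟩).mono
      (Icc_subset_Icc_right t.2.2)
  rw [hode]
  simp

/-- With high probability the centred edge indicators form a matrix of small cut norm. -/
lemma prob_codegree_gt_le (hl : TameRate l K) (hm : TameRate m K)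
    (hlC : ∀ t u v h, l t u v h ≤ C) (hmC : ∀ t u v h, m t u v h ≤ C)
    (hU : IsProfile γ l m g U) (t : I) (hn : 0 < n) {δ : ℝ} (hδ : 0 < δ) :
    (clocksLaw γ C n).real {z | (n : ℝ) ^ 4 * δ ^ 4 < ∑ i, ∑ i',
      (∑ j, edgeFluct C l m g U t i j z * edgeFluct C l m g U t i' j z) ^ 2} ≤
        2 / (n * δ ^ 4) := by
  have hn' : (0 : ℝ) < n := Nat.cast_pos.2 hn
  have hM := measurable_edgeFluct (C := C) (n := n) hl hm hU t
  set f : Clocks n → ℝ := fun z => ∑ i, ∑ i',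
      (∑ j, edgeFluct C l m g U t i j z * edgeFluct C l m g U t i' j z) ^ 2 with hf
  have hfm : Measurable f := Finset.measurable_sum _ fun i _ => Finset.measurable_sum _ fun i' _ =>
    (Finset.measurable_sum _ fun j _ => (hM i j).mul (hM i' j)).pow_const 2
  have hf0 : ∀ z, 0 ≤ f z := fun z =>
    Finset.sum_nonneg fun i _ => Finset.sum_nonneg fun i' _ => sq_nonneg _
  have hfi : Integrable f (clocksLaw γ C n) :=
    integrable_of_measurable_bounded hfm (B := ∑ _i : Fin n, ∑ _i' : Fin n,
      (∑ _j : Fin n, (1 : ℝ)) ^ 2) fun z => by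
        rw [abs_of_nonneg (hf0 z)]
        refine Finset.sum_le_sum fun i _ => Finset.sum_le_sum fun i' _ => ?_
        rw [← sq_abs]
        refine pow_le_pow_left₀ (abs_nonneg _) ?_ 2
        refine (Finset.abs_sum_le_sum_abs _ _).trans (Finset.sum_le_sum fun j _ => ?_)
        rw [abs_mul]
        exact mul_le_one₀ (abs_edgeFluct_le hU t i j z) (abs_nonneg _)
          (abs_edgeFluct_le hU t i' j z)
  have hE := integral_codegree_le (γ := γ) (C := C) hM (abs_edgeFluct_le hU t)
    (fun i z => by simp [edgeFluct]) (dependsOn_edgeFluct t)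
    fun i j hij x => integral_edgeFluct_resample hl hm hlC hmC hU t hij x
  have hmk := mul_meas_ge_le_integral_of_nonneg (ae_of_all _ hf0) hfi ((n : ℝ) ^ 4 * δ ^ 4)
  have hsub : (clocksLaw γ C n).real {z | (n : ℝ) ^ 4 * δ ^ 4 < f z} ≤
      (clocksLaw γ C n).real {z | (n : ℝ) ^ 4 * δ ^ 4 ≤ f z} :=
    measureReal_mono fun z (hz : _ < f z) => le_of_lt (α := ℝ) hz
  refine hsub.trans ?_
  rw [le_div_iff₀ (by positivity)]
  have h3 : ((n : ℝ) ^ 4 * δ ^ 4) * (clocksLaw γ C n).real {z | (n : ℝ) ^ 4 * δ ^ 4 ≤ f z} ≤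
    2 * n ^ 3 := hmk.trans hE
  have h4 : (n : ℝ) ^ 3 * ((clocksLaw γ C n).real {z | (n : ℝ) ^ 4 * δ ^ 4 ≤ f z} *
      (n * δ ^ 4)) ≤ (n : ℝ) ^ 3 * 2 := by
    calc _ = ((n : ℝ) ^ 4 * δ ^ 4) *
          (clocksLaw γ C n).real {z | (n : ℝ) ^ 4 * δ ^ 4 ≤ f z} := by ring
      _ ≤ _ := by rw [mul_comm _ (2 : ℝ)]; exact h3
  exact le_of_mul_le_mul_left h4 (by positivity)

/-! ### Counting rings and doubtful proposals -/

/-- One of the clocks that govern the pair rings in `(s, t]`. -/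
def PairRings (s t : ℝ) (z : Clocks n) (a : Fin n × Fin n) : Prop :=
  HasRing s t (z (.vertex a.1)) ∨ HasRing s t (z (.vertex a.2)) ∨
    HasRing s t (z (.on s(a.1, a.2))) ∨ HasRing s t (z (.off s(a.1, a.2)))

/-- Before time `t`, the mark of some proposal for the pair is so close to the idealised threshold
that an error `ρ` in the rate could change its outcome. -/
def PairDoubtful (C : ℝ) (l m : I → I → I → UnlabelledGraphon → ℝ) (g : I → Graphon) (ρ : ℝ → ℝ)
    (t : ℝ) (z : Clocks n) (a : Fin n × Fin n) : Prop :=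
  HasClose C (fun τ => threshold l g (vertexBirth z τ a.1) (vertexBirth z τ a.2) τ) ρ 0 t
      (z (.on s(a.1, a.2))) ∨
    HasClose C (fun τ => threshold m g (vertexBirth z τ a.1) (vertexBirth z τ a.2) τ) ρ 0 t
      (z (.off s(a.1, a.2)))

open Classical in
/-- The proportion of pairs that see a ring in `(s, t]` concentrates. -/
lemma prob_pairRings_gt_le (hn : 0 < n) {s t δ : ℝ} (h0 : 0 ≤ s) (hst : s ≤ t) (ht : t ≤ 1)
    (hδ : 0 < δ) : (clocksLaw γ C n).real {z | (n : ℝ) ^ 2 * (2 * (γ + C) * (t - s) + δ) <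
      ∑ a : Fin n × Fin n, if PairRings s t z a then (1 : ℝ) else 0} ≤ 4 / (n * δ ^ 2) := by
  have hms : ∀ c : Clock n, MeasurableSet {z : Clocks n | HasRing s t (z c)} := fun c =>
    (measurableSet_hasRing s t).preimage (measurable_pi_apply c)
  have hmp : ∀ a : Fin n × Fin n, MeasurableSet {z : Clocks n | PairRings s t z a} := fun a =>
    (hms _).union ((hms _).union ((hms _).union (hms _)))
  refine prob_pair_sum_gt_le (ξ := fun a z => if PairRings s t z a then (1 : ℝ) else 0)
    (fun a => Measurable.ite (hmp a) measurable_const measurable_const)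
    (fun a z => by split_ifs <;> simp) (fun a x y h => ?_) hn hδ fun a => ?_
  · have e : PairRings s t x a = PairRings s t y a := by
      simp only [PairRings]
      rw [h (.vertex a.1) (by simp [pairClocks]), h (.vertex a.2) (by simp [pairClocks]),
        h (.on s(a.1, a.2)) (by simp [pairClocks]), h (.off s(a.1, a.2)) (by simp [pairClocks])]
    beta_reduce
    rw [e]
  · have e : ∫ z, (if PairRings s t z a then (1 : ℝ) else 0) ∂(clocksLaw γ C n) =
        (clocksLaw γ C n).real {z | PairRings s t z a} := by
      rw [← integral_indicator_one (hmp a)]; rfl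
    rw [e]
    have hp : ∀ c : Clock n, (clocksLaw γ C n).real {z : Clocks n | HasRing s t (z c)} ≤
        c.rate γ C * (t - s) := fun c => by
      have := prob_clock (γ := γ) (C := C) c (measurableSet_hasRing s t)
      exact this.trans_le (prob_hasRing_le h0 hst ht)
    have h1 := hp (.vertex a.1)
    have h2 := hp (.vertex a.2)
    have h3 := hp (.on s(a.1, a.2))
    have h4 := hp (.off s(a.1, a.2))
    simp only [Clock.rate] at h1 h2 h3 h4
    have hset : {z : Clocks n | PairRings s t z a} =
        {z | HasRing s t (z (.vertex a.1))} ∪ ({z | HasRing s t (z (.vertex a.2))} ∪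
          ({z | HasRing s t (z (.on s(a.1, a.2)))} ∪ {z | HasRing s t (z (.off s(a.1, a.2)))})) :=
      rfl
    rw [hset]
    refine (measureReal_union_le _ _).trans ((add_le_add le_rfl ((measureReal_union_le _ _).trans
      (add_le_add le_rfl (measureReal_union_le _ _)))).trans ?_)
    linarith

open Classical in
/-- The proportion of pairs with a doubtful proposal concentrates, since doubtfulness of a pair is
determined by the four clocks which govern the pair. -/
lemma prob_pairDoubtful_gt_le (hl : TameRate l K) (hm : TameRate m K) (hg : Continuous g)
    {ρ : ℝ → ℝ} (hρ : Continuous ρ) (hρ0 : ∀ y, 0 ≤ ρ y) (hn : 0 < n) (t : I) {δ : ℝ}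
    (hδ : 0 < δ) : (clocksLaw γ C n).real {z | (n : ℝ) ^ 2 * (2 * (∫ y in (0 : ℝ)..t, 2 * ρ y) + δ) <
      ∑ a : Fin n × Fin n, if PairDoubtful C l m g ρ t z a then (1 : ℝ) else 0} ≤
        4 / (n * δ ^ 2) := by
  have hthr : ∀ {r : I → I → I → UnlabelledGraphon → ℝ} (_ : TameRate r K) (a : Fin n × Fin n),
      Measurable (Function.uncurry fun (z : Clocks n) τ =>
        threshold r g (vertexBirth z τ a.1) (vertexBirth z τ a.2) τ) := fun hr a =>
    (continuous_threshold hr hg).measurable.comp ((measurable_vertexBirth a.1).prodMk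
      ((measurable_vertexBirth a.2).prodMk measurable_snd))
  have hms : ∀ {r : I → I → I → UnlabelledGraphon → ℝ} (_ : TameRate r K) (a : Fin n × Fin n)
      (c : Clock n), MeasurableSet {z : Clocks n | HasClose C
        (fun τ => threshold r g (vertexBirth z τ a.1) (vertexBirth z τ a.2) τ) ρ 0 t (z c)} :=
    fun hr a c => measurableSet_hasClose_comp (hthr hr a) hρ.measurable 0 t (measurable_pi_apply c)
  have hmp : ∀ a : Fin n × Fin n, MeasurableSet {z : Clocks n | PairDoubtful C l m g ρ t z a} :=
    fun a => (hms hl a _).union (hms hm a _)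
  refine prob_pair_sum_gt_le (ξ := fun a z => if PairDoubtful C l m g ρ t z a then (1 : ℝ) else 0)
    (fun a => Measurable.ite (hmp a) measurable_const measurable_const)
    (fun a z => by split_ifs <;> simp) (fun a x y h => ?_) hn hδ fun a => ?_
  · have e : PairDoubtful C l m g ρ t x a = PairDoubtful C l m g ρ t y a := by
      simp only [PairDoubtful, vertexBirth]
      rw [h (.vertex a.1) (by simp [pairClocks]), h (.vertex a.2) (by simp [pairClocks]),
        h (.on s(a.1, a.2)) (by simp [pairClocks]), h (.off s(a.1, a.2)) (by simp [pairClocks])]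
    beta_reduce
    rw [e]
  · have e : ∫ z, (if PairDoubtful C l m g ρ t z a then (1 : ℝ) else 0) ∂(clocksLaw γ C n) =
        (clocksLaw γ C n).real {z | PairDoubtful C l m g ρ t z a} := by
      rw [← integral_indicator_one (hmp a)]; rfl
    rw [e]
    -- the clocks of the vertices are frozen by resampling the clocks of the pair
    have hp : ∀ {r : I → I → I → UnlabelledGraphon → ℝ} (_ : TameRate r K) (c : Clock n)
        (_ : c.rate γ C = C) (_ : ∀ v, c ≠ .vertex v),
        (clocksLaw γ C n).real {z : Clocks n | HasClose C
          (fun τ => threshold r g (vertexBirth z τ a.1) (vertexBirth z τ a.2) τ) ρ 0 t (z c)} ≤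
        ∫ y in (0 : ℝ)..t, 2 * ρ y := by
      intro r hr c hc hcv
      set A : Set (Clocks n) := {z : Clocks n | HasClose C
          (fun τ => threshold r g (vertexBirth z τ a.1) (vertexBirth z τ a.2) τ) ρ 0 t (z c)}
      have hA : MeasurableSet A := hms hr a c
      have hAi : Measurable (A.indicator (1 : Clocks n → ℝ)) := measurable_one.indicator hA
      rw [← integral_indicator_one hA]
      have hres := integral_resample (μ := fun c : Clock n => clockLaw (c.rate γ C)) {c}
        (integrable_of_measurable_bounded hAi (B := 1) fun z => by
          simp only [indicator, Pi.one_apply]; split_ifs <;> simp)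
      change ∫ z, A.indicator 1 z ∂(clocksLaw γ C n) =
        ∫ x, ∫ y, A.indicator 1 (resample {c} (x, y)) ∂(clocksLaw γ C n) ∂(clocksLaw γ C n) at hres
      rw [hres]
      have hin : ∀ x : Clocks n, ∫ y, A.indicator (1 : Clocks n → ℝ) (resample {c} (x, y))
          ∂(clocksLaw γ C n) ≤ ∫ y in (0 : ℝ)..t, 2 * ρ y := fun x => by
        set θ : ℝ → ℝ := fun τ => threshold r g (vertexBirth x τ a.1) (vertexBirth x τ a.2) τ
        have hθ : Measurable θ := (hthr hr a).comp (measurable_const.prodMk measurable_id)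
        have hB : MeasurableSet {w | HasClose C θ ρ 0 t w} :=
          measurableSet_hasClose_comp (θ := fun _ => θ) (hθ.comp measurable_snd) hρ.measurable 0 t
            measurable_id
        have e : ∀ y : Clocks n, A.indicator (1 : Clocks n → ℝ) (resample {c} (x, y)) =
            {w | HasClose C θ ρ 0 t w}.indicator 1 (y c) := fun y => by
          have h1 : ∀ v, resample {c} (x, y) (.vertex v) = x (.vertex v) := fun v => by
            have : Clock.vertex v ∉ ({c} : Set (Clock n)) := fun h => hcv v h.symm
            simp only [resample, if_neg this]
          have h2 : resample {c} (x, y) c = y c := by simp [resample]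
          have h3 : resample {c} (x, y) ∈ A ↔ HasClose C θ ρ 0 t (y c) := by
            change HasClose C (fun τ => threshold r g (vertexBirth (resample {c} (x, y)) τ a.1)
              (vertexBirth (resample {c} (x, y)) τ a.2) τ) ρ 0 t (resample {c} (x, y) c) ↔ _
            simp only [vertexBirth, h1, h2, θ]
          by_cases h : HasClose C θ ρ 0 t (y c)
          · rw [indicator_of_mem (h3.2 h),
              indicator_of_mem (show y c ∈ {w | HasClose C θ ρ 0 t w} from h)]
            rfl
          · rw [indicator_of_notMem (fun h' => h (h3.1 h')),
              indicator_of_notMem (show y c ∉ {w | HasClose C θ ρ 0 t w} from h)]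
        simp_rw [e]
        rw [integral_clock c (measurable_one.indicator hB), integral_indicator_one hB]
        have := prob_hasClose_le (r := C) hθ hρ hρ0 le_rfl t.2.1 t.2.2
        convert this
      calc _ ≤ ∫ _x : Clocks n, (∫ y in (0 : ℝ)..t, 2 * ρ y) ∂(clocksLaw γ C n) := by
            refine integral_mono_of_nonneg (ae_of_all _ fun x => integral_nonneg fun y =>
              indicator_nonneg (fun _ _ => zero_le_one) _) (integrable_const _) (ae_of_all _ hin)
        _ = _ := by simp
    refine (measureReal_union_le _ _).trans ((add_le_add (hp hl (.on s(a.1, a.2)) rfl (by simp))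
      (hp hm (.off s(a.1, a.2)) rfl (by simp))).trans ?_)
    linarith

end

/-! ### Realisations of the graph process -/

/-- A property of times that survives jumps and is locally constant to the right persists. -/
lemma stays_true {P : I → Prop} {s t : I} (hst : s ≤ t) (hs : P s)
    (right : ∀ x, ∀ᶠ y in 𝓝[>] x, P y ↔ P x)
    (step : ∀ x, s < x → x ≤ t → (∀ᶠ y in 𝓝[<] x, P y) → P x) : P t := by
  by_contra ht
  set S : Set I := {x | s ≤ x ∧ x ≤ t ∧ ¬ P x} with hS
  have htS : t ∈ S := ⟨hst, le_rfl, ht⟩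
  set a := sInf S with ha
  have hat : a ≤ t := sInf_le htS
  have hsa : s ≤ a := le_sInf fun x hx => hx.1
  have hlt : ∀ x, s ≤ x → x < a → P x := fun x hsx hxa => by
    by_contra h
    exact absurd (sInf_le (show x ∈ S from ⟨hsx, hxa.le.trans hat, h⟩)) (not_le.2 hxa)
  by_cases hPa : P a
  · have hat' : a < t := lt_of_le_of_ne hat fun h => ht (h ▸ hPa)
    have hr : ∀ᶠ y in 𝓝[>] a, P y := (right a).mono fun y hy => hy.2 hPa
    obtain ⟨u, hu, hsub⟩ := (mem_nhdsGT_iff_exists_Ioo_subset' hat').1 hr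
    have : u ≤ a := le_sInf fun x hx => by
      by_contra! hxu
      have hax : a ≤ x := sInf_le hx
      rcases hax.eq_or_lt with h | h
      · exact hx.2.2 (h ▸ hPa)
      · exact hx.2.2 (hsub ⟨h, hxu⟩)
    exact absurd hu (not_lt.2 this)
  · have hsa' : s < a := lt_of_le_of_ne hsa fun h => hPa (h ▸ hs)
    refine hPa (step a hsa' hat ?_)
    filter_upwards [Ioo_mem_nhdsLT hsa'] with x hx
    exact hlt x hx.1.le hx.2

lemma RegularClock.lastAccepted_mem {z : ℕ → ℝ × ℝ} (hz : RegularClock z) (r : ℝ) (m : ℝ → ℝ)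
    (b : ℝ) {t : ℝ} (ht : t ≤ 1) : lastAccepted r m b t z = b ∨
      ∃ k, ringTime z k = lastAccepted r m b t z ∧ b < ringTime z k ∧ ringTime z k ≤ t ∧
        r * (z k).2 ≤ m (ringTime z k) := by
  classical
  have hfin : (range fun k => if b < ringTime z k ∧ ringTime z k ≤ t ∧
      r * (z k).2 ≤ m (ringTime z k) then ringTime z k else b).Finite := by
    refine ((finite_singleton b).union (hz.finite.image (ringTime z))).subset ?_
    rintro _ ⟨k, rfl⟩
    simp only
    split_ifs with h
    · exact Or.inr ⟨k, h.2.1.trans ht, rfl⟩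
    · exact Or.inl rfl
  obtain ⟨k, hk⟩ := (range_nonempty _).csSup_mem hfin
  have hk' : (if b < ringTime z k ∧ ringTime z k ≤ t ∧ r * (z k).2 ≤ m (ringTime z k)
      then ringTime z k else b) = lastAccepted r m b t z := by
    rw [lastAccepted, iSup]
    convert hk
  split_ifs at hk' with h
  · exact Or.inr ⟨k, hk', h⟩
  · exact Or.inl hk'.symm

/-- Realisations of the clocks without accumulating rings, and in which no pair of vertices gets two
contradictory proposals at the same time. -/
structure RegularClocks {n : ℕ} (z : Clocks n) : Prop where
  clock : ∀ c, RegularClock (z c)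
  disjoint : ∀ e k k', ringTime (z (.on e)) k ≤ 1 →
    ringTime (z (.on e)) k ≠ ringTime (z (.off e)) k'

section
variable {n : ℕ} {γ C : ℝ} [hγ : Fact (0 < γ)] [hC : Fact (0 < C)]

lemma ae_clock₂ {c c' : Clock n} (hcc : c ≠ c') {A : Set ((ℕ → ℝ × ℝ) × (ℕ → ℝ × ℝ))}
    (hA : MeasurableSet A) (h : ∀ᵐ w' ∂(clockLaw (c'.rate γ C)), ∀ᵐ w ∂(clockLaw (c.rate γ C)),
      (w, w') ∉ A) : ∀ᵐ z ∂(clocksLaw γ C n), (z c, z c') ∉ A := by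
  have hi : Measurable (A.indicator fun _ => (1 : ℝ)) := measurable_const.indicator hA
  have e := integral_clock₂ (γ := γ) (C := C) hcc
    (Φ := fun w w' => A.indicator (fun _ => (1 : ℝ)) (w, w')) hi (B := 1) fun w w' => by
      simp only [indicator]; split_ifs <;> simp
  have h0 : ∫ w', ∫ w, A.indicator (fun _ => (1 : ℝ)) (w, w') ∂(clockLaw (c.rate γ C))
      ∂(clockLaw (c'.rate γ C)) = 0 := by
    refine integral_eq_zero_of_ae (h.mono fun w' hw' => ?_)
    exact integral_eq_zero_of_ae (hw'.mono fun w hw => indicator_of_notMem hw _)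
  rw [h0] at e
  have hcc' : Measurable fun z : Clocks n => (z c, z c') :=
    (measurable_pi_apply c).prodMk (measurable_pi_apply c')
  have hint : Integrable (fun z : Clocks n => A.indicator (fun _ => (1 : ℝ)) (z c, z c'))
      (clocksLaw γ C n) := integrable_of_measurable_bounded (hi.comp hcc') (B := 1) fun z => by
    simp only [indicator]; split_ifs <;> simp
  have := (integral_eq_zero_iff_of_nonneg
    (fun z => indicator_nonneg (fun _ _ => zero_le_one) _) hint).1 e
  filter_upwards [this] with z hz hzA
  simp only [Pi.zero_apply] at hz
  rw [indicator_of_mem hzA] at hz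
  exact one_ne_zero hz

lemma ae_regularClocks : ∀ᵐ z ∂(clocksLaw γ C n), RegularClocks z := by
  have h1 : ∀ᵐ z ∂(clocksLaw γ C n), ∀ c, RegularClock (z c) :=
    ae_all_iff.2 fun c => ae_clock c ae_regularClock
  have h2 : ∀ᵐ z ∂(clocksLaw γ C n), ∀ e : Sym2 (Fin n), (z (.on e), z (.off e)) ∉
      ⋃ (k : ℕ) (k' : ℕ), {p : (ℕ → ℝ × ℝ) × (ℕ → ℝ × ℝ) | ringTime p.2 k' ≤ 1 ∧
        ringTime p.1 k = ringTime p.2 k'} := by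
    refine ae_all_iff.2 fun e => ae_clock₂ (by simp) ?_ ?_
    · refine MeasurableSet.iUnion fun k => MeasurableSet.iUnion fun k' => ?_
      exact (measurableSet_le ((measurable_ringTime k').comp measurable_snd)
        measurable_const).inter (measurableSet_eq_fun ((measurable_ringTime k).comp measurable_fst)
          ((measurable_ringTime k').comp measurable_snd))
    · filter_upwards [ae_regularClock (r := (Clock.off e).rate γ C)] with w' hw'
      have : ∀ᵐ w ∂(clockLaw ((Clock.on e).rate γ C)), ∀ k', ringTime w' k' ≤ 1 →
          ∀ k, ringTime w k ≠ ringTime w' k' := by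
        refine ae_all_iff.2 fun k' => ?_
        by_cases hk : ringTime w' k' ≤ 1
        · filter_upwards [ae_ringTime_ne (r := (Clock.on e).rate γ C)
            (ringTime_pos hw'.wait_pos k') hk] with w hw _ using hw
        · exact ae_of_all _ fun w h => absurd h hk
      filter_upwards [this] with w hw hmem
      simp only [mem_iUnion] at hmem
      obtain ⟨k, k', hk, hkk⟩ := hmem
      exact hw k' hk k hkk
  filter_upwards [h1, h2] with z hz1 hz2
  refine ⟨hz1, fun e k k' hk hkk => hz2 e ?_⟩
  simp only [mem_iUnion]
  exact ⟨k, k', hkk ▸ hk, hkk⟩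

end

section
variable {n : ℕ} [NeZero n] {lam mu : Rate} {C : ℝ} {z : Clocks n} {G : I → SimpleGraph (Fin n)}
  {l m : I → I → I → UnlabelledGraphon → ℝ} {g : I → Graphon}

/-- As long as all proposals for a pair since the birth of the younger vertex are treated as in the
idealised process, so is the edge. -/
lemma FollowsDynamics.adj_iff_edgeState (hG : FollowsDynamics lam mu C z G) (hz : RegularClocks z)
    {i j : Fin n} (hij : i ≠ j) (t : I)
    (hon : ∀ τ : I, 0 < τ → τ ≤ t → ∀ H, (∀ᶠ s in 𝓝[<] τ, G s = H) → ∀ k,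
      ringTime (z (.on s(i, j))) k = τ →
      (C * (z (.on s(i, j)) k).2 ≤ currentRate lam z τ H i j ↔
        C * (z (.on s(i, j)) k).2 ≤ threshold l g (vertexBirth z τ i) (vertexBirth z τ j) τ))
    (hoff : ∀ τ : I, 0 < τ → τ ≤ t → ∀ H, (∀ᶠ s in 𝓝[<] τ, G s = H) → ∀ k,
      ringTime (z (.off s(i, j))) k = τ →
      (C * (z (.off s(i, j)) k).2 ≤ currentRate mu z τ H i j ↔
        C * (z (.off s(i, j)) k).2 ≤ threshold m g (vertexBirth z τ i) (vertexBirth z τ j) τ)) :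
    (G t).Adj i j ↔ edgeState C l m g t z i j := by
  have hbi := birthTime_mem (z (.vertex i)) t
  have hbj := birthTime_mem (z (.vertex j)) t
  set bi := vertexBirth z t i with hbi_def
  set bj := vertexBirth z t j with hbj_def
  change bi ∈ _ at hbi
  change bj ∈ _ at hbj
  set b := max bi bj with hb
  have hb0 : 0 ≤ b := hbi.1.trans (le_max_left _ _)
  have hbt : b ≤ t := max_le hbi.2 hbj.2
  set ℓ := threshold l g bi bj with hℓ
  set μ := threshold m g bi bj with hμ
  -- `On τ`, `Off τ`: the idealised process accepts a proposal at time `τ`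
  let On : I → Prop := fun τ => ∃ k, ringTime (z (.on s(i, j))) k = τ ∧
    C * (z (.on s(i, j)) k).2 ≤ ℓ τ
  let Off : I → Prop := fun τ => ∃ k, ringTime (z (.off s(i, j))) k = τ ∧
    C * (z (.off s(i, j)) k).2 ≤ μ τ
  have hOnOff : ∀ τ, On τ → ¬ Off τ := by
    rintro τ ⟨k, hk, -⟩ ⟨k', hk', -⟩
    exact hz.disjoint s(i, j) k k' (hk ▸ τ.2.2) (hk.trans hk'.symm)
  -- after the birth of the younger vertex neither of the vertices rings
  have hbirth : ∀ v, vertexBirth z t v ≤ b → ∀ τ : I, b < τ → τ ≤ t →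
      vertexBirth z τ v = vertexBirth z t v := fun v hv τ hτ hτt =>
    (birthTime_eq hτt ((birthTime_le_iff τ.2.1 _ _).1 (hv.trans hτ.le))).symm
  have hnoring : ∀ v, vertexBirth z t v ≤ b → ∀ τ : I, b < τ → τ ≤ t → ¬ VertexRings z τ v := by
    rintro v hv τ hτ hτt ⟨k, hk⟩
    exact (birthTime_le_iff hb0 _ _).1 hv ⟨k, by rw [hk]; exact hτ, by rw [hk]; exact hτt⟩
  have hstep : ∀ τ : I, b < τ → τ ≤ t → ∃ H : SimpleGraph (Fin n), (∀ᶠ s in 𝓝[<] τ, G s = H) ∧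
      ((G τ).Adj i j ↔ (¬ H.Adj i j ∧ On τ) ∨ (H.Adj i j ∧ ¬ Off τ)) := by
    intro τ hτ hτt
    have hτ0 : 0 < τ := by
      rw [← Subtype.coe_lt_coe]; exact hb0.trans_lt hτ
    obtain ⟨H, hH, hadj⟩ := hG.jump τ hτ0
    refine ⟨H, hH, ?_⟩
    have h1 : Accepted z C τ (.on s(i, j)) (currentRate lam z τ H i j) ↔ On τ := by
      refine exists_congr fun k => and_congr_right fun hk => ?_
      rw [hon τ hτ0 hτt H hH k hk, hbirth i (le_max_left _ _) τ hτ hτt,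
        hbirth j (le_max_right _ _) τ hτ hτt]
    have h2 : Accepted z C τ (.off s(i, j)) (currentRate mu z τ H i j) ↔ Off τ := by
      refine exists_congr fun k => and_congr_right fun hk => ?_
      rw [hoff τ hτ0 hτt H hH k hk, hbirth i (le_max_left _ _) τ hτ hτt,
        hbirth j (le_max_right _ _) τ hτ hτt]
    rw [hadj i j hij, h1, h2]
    have h3 := hnoring i (le_max_left _ _) τ hτ hτt
    have h4 := hnoring j (le_max_right _ _) τ hτ hτt
    simp only [h3, h4, not_false_eq_true, true_and]
  have hright : ∀ x, ∀ᶠ y in 𝓝[>] x, (G y).Adj i j ↔ (G x).Adj i j := fun x =>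
    (hG.right_cont x).mono fun y hy => by rw [hy]
  have hleft : ∀ {s x : I}, s < x → (𝓝[<] x).NeBot := fun h => nhdsLT_neBot_of_exists_lt ⟨_, h⟩
  -- at time `b` the clock of the younger vertex rings, unless `b = 0`
  have hstart : ∀ τ : I, (τ : ℝ) = b → ¬ (G τ).Adj i j := by
    intro τ hτ
    rcases hb0.eq_or_lt with h | h
    · have : τ = 0 := Subtype.ext (by rw [hτ, ← h]; rfl)
      rw [this, hG.initial]; simp
    · have hτ0 : 0 < τ := by rw [← Subtype.coe_lt_coe, hτ]; exact h
      obtain ⟨H, hH, hadj⟩ := hG.jump τ hτ0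
      rw [hadj i j hij]
      have hv : ∀ v, vertexBirth z t v = b → VertexRings z τ v := fun v hv => by
        rcases (hz.clock (.vertex v)).birthTime_mem t.2.2 with h' | ⟨-, k, hk⟩
        · exact absurd (hv.symm.trans h') h.ne'
        · exact ⟨k, by rw [hk, hτ]; exact hv⟩
      rcases max_choice bi bj with hmax | hmax
      · exact fun h => h.1 (hv i hmax.symm)
      · exact fun h => h.2.1 (hv j hmax.symm)
  set T := lastAccepted C μ b t (z (.off s(i, j))) with hT
  have hTmem : T ∈ Icc b (t : ℝ) := AgeGraphon.lastAccepted_mem hbt _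
  let TI : I := ⟨T, hb0.trans hTmem.1, hTmem.2.trans t.2.2⟩
  -- right after the last accepted proposal to switch it off, the edge is absent
  have hTstart : ¬ (G TI).Adj i j := by
    rcases (hz.clock (.off s(i, j))).lastAccepted_mem C μ b t.2.2 with h | ⟨k, hk, hk1, hk2, hk3⟩
    · exact hstart TI h
    · have hoffT : Off TI := ⟨k, hk, by rw [hk] at hk3; exact hk3⟩
      obtain ⟨H, -, hadj⟩ := hstep TI (by rw [hk] at hk1; exact hk1) hTmem.2
      rw [hadj]
      rintro (⟨-, h⟩ | ⟨-, h⟩)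
      · exact hOnOff TI h hoffT
      · exact h hoffT
  have hnooff : ∀ τ : I, T < τ → τ ≤ t → ¬ Off τ := by
    rintro τ hτ hτt ⟨k, hk, hk'⟩
    exact (lastAccepted_le_iff hTmem.1 _).1 (le_refl T)
      ⟨k, by rw [hk]; exact hτ, by rw [hk]; exact hτt, by rw [hk]; exact hk'⟩
  constructor
  · intro hadj
    by_contra hno
    refine (stays_true (P := fun x => ¬ (G x).Adj i j) (s := TI) (t := t) hTmem.2 hTstart
      (fun x => (hright x).mono fun y hy => not_congr hy) fun x hx hxt hev => ?_) hadj
    obtain ⟨H, hH, hx'⟩ := hstep x (hTmem.1.trans_lt hx) hxt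
    have : (𝓝[<] x).NeBot := hleft hx
    obtain ⟨y, hy1, hy2⟩ := (hev.and hH).exists
    have hHn : ¬ H.Adj i j := hy2 ▸ hy1
    have hOn : ¬ On x := by
      rintro ⟨k, hk, hk'⟩
      exact hno ⟨k, by rw [hk]; exact hx, by rw [hk]; exact hxt, by rw [hk]; exact hk'⟩
    rw [hx']
    rintro (⟨-, h⟩ | ⟨h, -⟩)
    · exact hOn h
    · exact hHn h
  · rintro ⟨k, hk1, hk2, hk3⟩
    let τ : I := ⟨ringTime (z (.on s(i, j))) k, (hb0.trans hTmem.1).trans hk1.le, hk2.trans t.2.2⟩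
    have hOn : On τ := ⟨k, rfl, hk3⟩
    have hτ : (G τ).Adj i j := by
      obtain ⟨H, -, hadj⟩ := hstep τ (hTmem.1.trans_lt hk1) hk2
      rw [hadj]
      by_cases h : H.Adj i j
      · exact Or.inr ⟨h, hOnOff τ hOn⟩
      · exact Or.inl ⟨h, hOn⟩
    refine stays_true (P := fun x => (G x).Adj i j) (s := τ) (t := t) hk2 hτ hright
      fun x hx hxt hev => ?_
    have hTx : T < x := hk1.trans hx
    obtain ⟨H, hH, hx'⟩ := hstep x (hTmem.1.trans_lt hTx) hxt
    have : (𝓝[<] x).NeBot := hleft hx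
    obtain ⟨y, hy1, hy2⟩ := (hev.and hH).exists
    have hHa : H.Adj i j := hy2 ▸ hy1
    rw [hx']
    exact Or.inr ⟨hHa, hnooff x hTx hxt⟩

/-- Edges differ from the idealised process only if one of their proposals is doubtful. -/
lemma FollowsDynamics.adj_iff_of_not_doubtful (hG : FollowsDynamics lam mu C z G)
    (hz : RegularClocks z) {i j : Fin n} (hij : i ≠ j) (t : I) {ρ : ℝ → ℝ}
    (hl : ∀ τ : I, 0 < τ → τ ≤ t → ∀ H, (∀ᶠ s in 𝓝[<] τ, G s = H) → |currentRate lam z τ H i j -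
      threshold l g (vertexBirth z τ i) (vertexBirth z τ j) τ| ≤ ρ τ)
    (hm : ∀ τ : I, 0 < τ → τ ≤ t → ∀ H, (∀ᶠ s in 𝓝[<] τ, G s = H) → |currentRate mu z τ H i j -
      threshold m g (vertexBirth z τ i) (vertexBirth z τ j) τ| ≤ ρ τ)
    (hnd : ¬ PairDoubtful C l m g ρ t z (i, j)) :
    (G t).Adj i j ↔ edgeState C l m g t z i j := by
  have key : ∀ a x y ρ : ℝ, |x - y| ≤ ρ → ρ < |a - y| → (a ≤ x ↔ a ≤ y) := by
    intro a x y ρ h1 h2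
    rw [abs_le] at h1
    rcases lt_abs.1 h2 with h | h
    · constructor <;> intro <;> linarith
    · constructor <;> intro <;> linarith
  refine hG.adj_iff_edgeState hz hij t (fun τ h0 hτ H hH k hk => ?_) fun τ h0 hτ H hH k hk => ?_
  · refine key _ _ _ (ρ τ) (hl τ h0 hτ H hH) (not_le.1 fun hle => hnd (Or.inl ⟨k, ?_, ?_, ?_⟩))
    · simp only; rw [hk]; exact h0
    · simp only; rw [hk]; exact hτ
    · simp only; rw [hk]; exact hle
  · refine key _ _ _ (ρ τ) (hm τ h0 hτ H hH) (not_le.1 fun hle => hnd (Or.inr ⟨k, ?_, ?_, ?_⟩))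
    · simp only; rw [hk]; exact h0
    · simp only; rw [hk]; exact hτ
    · simp only; rw [hk]; exact hle

/-- Between two times, the state of a pair changes only if one of its clocks rings. -/
lemma FollowsDynamics.adj_iff_of_not_rings (hG : FollowsDynamics lam mu C z G) {i j : Fin n}
    (hij : i ≠ j) {s t : I} (hst : s ≤ t) (h : ¬ PairRings s t z (i, j)) :
    (G t).Adj i j ↔ (G s).Adj i j := by
  have hright : ∀ x, ∀ᶠ y in 𝓝[>] x, (G y).Adj i j ↔ (G x).Adj i j := fun x =>
    (hG.right_cont x).mono fun y hy => by rw [hy]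
  have hring : ∀ c : Clock n, c = .vertex i ∨ c = .vertex j ∨ c = .on s(i, j) ∨ c = .off s(i, j) →
      ∀ x : I, s < x → x ≤ t → ¬ ∃ k, ringTime (z c) k = x := by
    rintro c hc x hx hxt ⟨k, hk⟩
    have hr : HasRing s t (z c) := ⟨k, by rw [hk]; exact hx, by rw [hk]; exact hxt⟩
    simp only [PairRings, not_or] at h
    rcases hc with rfl | rfl | rfl | rfl
    · exact h.1 hr
    · exact h.2.1 hr
    · exact h.2.2.1 hr
    · exact h.2.2.2 hr
  have hstep : ∀ x : I, s < x → x ≤ t → ∃ H : SimpleGraph (Fin n), (∀ᶠ y in 𝓝[<] x, G y = H) ∧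
      ((G x).Adj i j ↔ H.Adj i j) := by
    intro x hx hxt
    obtain ⟨H, hH, hadj⟩ := hG.jump x (lt_of_le_of_lt (zero_le) hx)
    refine ⟨H, hH, ?_⟩
    rw [hadj i j hij]
    have h1 : ¬ VertexRings z x i := hring _ (by simp) x hx hxt
    have h2 : ¬ VertexRings z x j := hring _ (by simp) x hx hxt
    have h3 : ¬ Accepted z C x (.on s(i, j)) (currentRate lam z x H i j) := fun ⟨k, hk, _⟩ =>
      hring (.on s(i, j)) (by simp) x hx hxt ⟨k, hk⟩
    have h4 : ¬ Accepted z C x (.off s(i, j)) (currentRate mu z x H i j) := fun ⟨k, hk, _⟩ =>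
      hring (.off s(i, j)) (by simp) x hx hxt ⟨k, hk⟩
    simp only [h1, h2, h3, h4, not_false_eq_true, true_and, and_false, and_true, false_or]
  have hleft : ∀ {s x : I}, s < x → (𝓝[<] x).NeBot := fun h => nhdsLT_neBot_of_exists_lt ⟨_, h⟩
  refine stays_true (P := fun x => (G x).Adj i j ↔ (G s).Adj i j) hst Iff.rfl
    (fun x => (hright x).mono fun y hy => by rw [hy]) fun x hx hxt hev => ?_
  obtain ⟨H, hH, hx'⟩ := hstep x hx hxt
  have : (𝓝[<] x).NeBot := hleft hx
  obtain ⟨y, hy1, hy2⟩ := (hev.and hH).exists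
  rw [hx', ← hy2]
  exact hy1

end

/-! ### From the idealised process to the graph process -/

/-- Uniform continuity of `U`, in a form which is affine in the distances and can therefore be
integrated over the labels. -/
lemma IsProfile.exists_modulus {γ : ℝ} {l m : I → I → I → UnlabelledGraphon → ℝ} {g : I → Graphon}
    {U : ℝ → ℝ → ℝ → ℝ} (hU : IsProfile γ l m g U) {ε : ℝ} (hε : 0 < ε) :
    ∃ η > 0, ∀ s t b b' c c' : I, |U s b b' - U t c c'| ≤
      ε + (|(s : ℝ) - t| + |(b : ℝ) - c| + |(b' : ℝ) - c'|) / η := by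
  have huc := (isCompact_Icc (a := ((0 : ℝ), (0 : ℝ), (0 : ℝ)))
    (b := (1, 1, 1))).uniformContinuousOn_of_continuous hU.cont.continuousOn
  rw [Metric.uniformContinuousOn_iff_le] at huc
  obtain ⟨η, hη, h⟩ := huc ε hε
  refine ⟨η, hη, fun s t b b' c c' => ?_⟩
  set S := |(s : ℝ) - t| + |(b : ℝ) - c| + |(b' : ℝ) - c'| with hS
  have h1 := abs_nonneg ((s : ℝ) - t)
  have h2 := abs_nonneg ((b : ℝ) - c)
  have h3 := abs_nonneg ((b' : ℝ) - c')
  have hS0 : 0 ≤ S := by positivity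
  rcases le_or_gt S η with hle | hgt
  · have := h ((s : ℝ), (b : ℝ), (b' : ℝ)) ⟨⟨s.2.1, b.2.1, b'.2.1⟩, ⟨s.2.2, b.2.2, b'.2.2⟩⟩
      ((t : ℝ), (c : ℝ), (c' : ℝ)) ⟨⟨t.2.1, c.2.1, c'.2.1⟩, ⟨t.2.2, c.2.2, c'.2.2⟩⟩ (by
        rw [Prod.dist_eq, Prod.dist_eq, Real.dist_eq, Real.dist_eq, Real.dist_eq]
        refine max_le ?_ (max_le ?_ ?_) <;> simp only <;> linarith)
    rw [Real.dist_eq] at this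
    have h4 : 0 ≤ S / η := by positivity
    simp only at this
    linarith
  · have h4 : 1 ≤ S / η := (one_le_div hη).2 hgt.le
    have h5 := hU.mem s b b'
    have h6 := hU.mem t c c'
    rw [abs_le]
    constructor <;> linarith [h5.1, h5.2, h6.1, h6.2]

section
variable {n : ℕ} [NeZero n] {γ C : ℝ} {lam mu : Rate} {z : Clocks n} {G : I → SimpleGraph (Fin n)}
  {l m : I → I → I → UnlabelledGraphon → ℝ} {g : I → Graphon} {U : ℝ → ℝ → ℝ → ℝ}

open Classical in
/-- The distance of the graph at time `t` to the limit, in terms of the idealised process at an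
earlier time `s`. -/
lemma cutDist_graph_le (hγ : 0 < γ) (hU : IsProfile γ l m g U) (hG : FollowsDynamics lam mu C z G)
    {s t : I} (hst : s ≤ t) (lb : Equiv.Perm (Fin n))
    (hlb : Monotone fun k => vertexAge z t (lb k)) {ε η δ κ : ℝ} (hε : 0 ≤ ε) (hη : 0 < η)
    (hδ : 0 ≤ δ)
    (hmod : ∀ s t b b' c c' : I, |U s b b' - U t c c'| ≤
      ε + (|(s : ℝ) - t| + |(b : ℝ) - c| + |(b' : ℝ) - c'|) / η)
    (hcod : ∑ i, ∑ i', (∑ j, edgeFluct C l m g U s i j z * edgeFluct C l m g U s i' j z) ^ 2 ≤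
      (n : ℝ) ^ 4 * δ ^ 4)
    (hκ : ageDiscrepancy γ t (vertexAge z t) ≤ κ) :
    cutDist (empiricalGraphon ((G t).comap lb)) (g t) ≤
      δ + ((n : ℝ) ^ 2)⁻¹ * (2 * (∑ a, if PairRings s t z a then (1 : ℝ) else 0) +
        ∑ a : Fin n × Fin n, if a.1 ≠ a.2 ∧ ¬ ((G s).Adj a.1 a.2 ↔ edgeState C l m g s z a.1 a.2)
          then (1 : ℝ) else 0) + 1 / n + (ε + ((t - s) + 2 * κ) / η) := by
  have hn : (0 : ℝ) < n := Nat.cast_pos.2 (NeZero.pos n)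
  have hst' : (s : ℝ) ≤ t := hst
  -- `X x`: the error in the age, and hence in the birth time, at the label `x`
  set X : I → ℝ := fun x => |(vertexAge z t (lb (block n x)) : ℝ) - limitAge γ t x| with hX
  have hXm : Measurable X := by
    have h : Measurable fun x : I => (vertexAge z t (lb (block n x)) : ℝ) :=
      (measurable_of_finite fun v => (vertexAge z t (lb v) : ℝ)).comp (measurable_block n)
    exact (h.sub (measurable_limitAge hγ t)).abs
  have hX0 : ∀ x, 0 ≤ X x := fun x => abs_nonneg _
  have hX1 : ∀ x, |X x| ≤ 1 := fun x => by
    have h1 := limitAge_mem hγ t x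
    have h2 := (vertexAge z t (lb (block n x))).2
    rw [abs_abs, abs_le]
    constructor <;> linarith [h1.1, h1.2, h2.1, h2.2]
  have hXi : Integrable X := integrable_of_measurable_bounded hXm hX1
  have hXint : ∫ x, X x ≤ κ := (integral_abs_age_sub hγ t (vertexAge z t) lb hlb).trans_le hκ
  set w : I × I → ℝ := fun p => ε + ((t - s) + X p.1 + X p.2) / η with hw
  have hX1i : Integrable fun p : I × I => X p.1 :=
    integrable_of_measurable_bounded (hXm.comp measurable_fst) fun p => hX1 _
  have hX2i : Integrable fun p : I × I => X p.2 :=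
    integrable_of_measurable_bounded (hXm.comp measurable_snd) fun p => hX1 _
  have hXXi : Integrable fun p : I × I => ((t : ℝ) - s) + X p.1 :=
    (integrable_const _).add hX1i
  have hXXXi : Integrable fun p : I × I => (((t : ℝ) - s) + X p.1 + X p.2) / η :=
    (hXXi.add hX2i).div_const η
  have hwi : Integrable w := (integrable_const _).add hXXXi
  have hwint : ∫ p, w p ≤ ε + ((t - s) + 2 * κ) / η := by
    have e1 : ∫ p : I × I, X p.1 = ∫ x, X x := by
      rw [Measure.volume_eq_prod, integral_fun_fst]; simp
    have e2 : ∫ p : I × I, X p.2 = ∫ x, X x := by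
      rw [Measure.volume_eq_prod, integral_fun_snd]; simp
    have : ∫ p, w p = ε + ((t - s) + (∫ x, X x) + ∫ x, X x) / η := by
      simp only [hw]
      rw [integral_add (integrable_const _) hXXXi, integral_div, integral_add hXXi hX2i,
        integral_add (integrable_const _) hX1i, e1, e2]
      simp
    rw [this]
    exact add_le_add le_rfl (div_le_div_of_nonneg_right (by linarith) hη.le)
  -- a pair that rings is estimated trivially, by `2`; diagonal and mismatched pairs by `1`
  set D : Fin n → Fin n → ℝ := fun i j => 2 * (if PairRings s t z (i, j) then (1 : ℝ) else 0) +
    (if i ≠ j ∧ ¬ ((G s).Adj i j ↔ edgeState C l m g s z i j) then (1 : ℝ) else 0) +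
    if i = j then (1 : ℝ) else 0 with hD
  have hD0 : ∀ i j, 0 ≤ D i j := fun i j => by
    simp only [hD]; split_ifs <;> norm_num
  have hDsum : ∑ i, ∑ j, D i j = 2 * (∑ a, if PairRings s t z a then (1 : ℝ) else 0) +
      (∑ a : Fin n × Fin n, if a.1 ≠ a.2 ∧ ¬ ((G s).Adj a.1 a.2 ↔ edgeState C l m g s z a.1 a.2)
          then (1 : ℝ) else 0) + n := by
    simp only [hD, Finset.sum_add_distrib, Fintype.sum_prod_type, ← Finset.mul_sum]
    simp
  have hmain := cutDist_empiricalGraphon_le (G t) lb (g t)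
    (fun i j => edgeFluct C l m g U s i j z) D w hwi (fun p => by
      have := hX0 p.1; have := hX0 p.2; have := sub_nonneg.2 hst'
      simp only [hw]; positivity) hD0 hδ hcod ?_
  · refine hmain.trans ?_
    rw [hDsum]
    have e : ((n : ℝ) ^ 2)⁻¹ * n = 1 / n := by field_simp
    rw [mul_add, e]
    linarith
  · filter_upwards [hU.graphon t] with p hp
    set i := lb (block n p.1) with hi
    set j := lb (block n p.2) with hj
    have hg := (g t p).2
    have hw0 : 0 ≤ w p := by
      have := hX0 p.1; have := hX0 p.2; have := sub_nonneg.2 hst'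
      simp only [hw]; positivity
    by_cases hij : i = j
    · have h1 : ¬ (G t).Adj i j := by rw [hij]; exact (G t).irrefl
      have h2 : 1 ≤ D i j := by
        simp only [hD, if_pos hij]; split_ifs <;> norm_num
      rw [if_neg h1, edgeFluct, if_pos hij, abs_le]
      constructor <;> linarith [hg.1, hg.2]
    · rw [edgeFluct, if_neg hij]
      set u := U s (vertexBirth z s i) (vertexBirth z s j) with hu
      have hu1 := hU.mem s (vertexBirth z s i) (vertexBirth z s j)
      rw [← hu] at hu1
      by_cases hr : PairRings s t z (i, j)
      · have h2 : 2 ≤ D i j := by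
          simp only [hD, if_pos hr]; split_ifs <;> norm_num
        rw [abs_le]
        constructor <;> split_ifs <;> linarith [hg.1, hg.2, hu1.1, hu1.2]
      · have hadj := hG.adj_iff_of_not_rings hij hst hr
        have hbi : vertexBirth z t i = vertexBirth z s i :=
          birthTime_eq hst' fun h => hr (Or.inl h)
        have hbj : vertexBirth z t j = vertexBirth z s j :=
          birthTime_eq hst' fun h => hr (Or.inr (Or.inl h))
        have hUw : |u - U t (limitBirth γ t p.1) (limitBirth γ t p.2)| ≤ w p := by
          have m1 := birthTime_mem (z (.vertex i)) s
          have m2 := birthTime_mem (z (.vertex j)) s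
          have m3 := limitBirth_mem hγ t p.1
          have m4 := limitBirth_mem hγ t p.2
          have h := hmod s t ⟨vertexBirth z s i, m1.1, m1.2.trans s.2.2⟩
            ⟨vertexBirth z s j, m2.1, m2.2.trans s.2.2⟩ ⟨_, m3.1, m3.2.trans t.2.2⟩
            ⟨_, m4.1, m4.2.trans t.2.2⟩
          simp only at h
          refine h.trans (le_of_eq ?_)
          have e1 : |vertexBirth z s i - limitBirth γ t p.1| = X p.1 := by
            rw [← hbi, hX]
            simp only
            rw [← hi, vertexAge, coe_age, limitBirth, vertexBirth, ← abs_neg]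
            congr 1; ring
          have e2 : |vertexBirth z s j - limitBirth γ t p.2| = X p.2 := by
            rw [← hbj, hX]
            simp only
            rw [← hj, vertexAge, coe_age, limitBirth, vertexBirth, ← abs_neg]
            congr 1; ring
          rw [e1, e2, abs_sub_comm, abs_of_nonneg (sub_nonneg.2 hst')]
        rw [← hp] at hUw
        rw [abs_le] at hUw ⊢
        by_cases hA : (G s).Adj i j ↔ edgeState C l m g s z i j
        · have e : (if (G t).Adj i j then (1 : ℝ) else 0) =
              if edgeState C l m g s z i j then 1 else 0 := by
            simp only [hadj, hA]
          rw [e]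
          have := hD0 i j
          constructor <;> linarith [hUw.1, hUw.2]
        · have h2 : 1 ≤ D i j := by
            simp only [hD, if_pos (show i ≠ j ∧ ¬ ((G s).Adj i j ↔ edgeState C l m g s z i j)
              from ⟨hij, hA⟩)]
            split_ifs; norm_num
          constructor <;> split_ifs <;> linarith [hUw.1, hUw.2]

/-- The error made by replacing the environment of the graph process by its limit. -/
lemma abs_currentRate_sub_le (hγ : 0 < γ) {d : ProbabilityMeasure I → ProbabilityMeasure I → ℝ}
    {r : Rate} {L : ℝ} (hL : ∀ t t' u u' v v' F F' h h', |r t u v F h - r t' u' v' F' h'| ≤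
      L * (dist t t' + dist u u' + dist v v' + d F F' + cutMetric h h')) (τ : I)
    (H : SimpleGraph (Fin n)) (i j : Fin n) :
    |currentRate r z τ H i j - threshold (fun t u v c => r t u v (limitLaw hγ t) c) g
      (vertexBirth z τ i) (vertexBirth z τ j) τ| ≤
      L * (d (empirical (vertexAge z τ)) (limitLaw hγ τ) +
        cutMetric (empiricalGraphon H).unlabel (g τ).unlabel) := by
  rw [currentRate, threshold, clamp_coe]
  refine (hL ..).trans (le_of_eq ?_)
  have h1 : clamp ((τ : ℝ) - vertexBirth z τ i) = vertexAge z τ i := rfl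
  have h2 : clamp ((τ : ℝ) - vertexBirth z τ j) = vertexAge z τ j := rfl
  rw [h1, h2, dist_self, dist_self, dist_self]
  ring

/-- The graph just before time `τ` is close to the limit if the graphs before are. -/
lemma cutMetric_leftLimit_le (hg : Continuous g) {H : SimpleGraph (Fin n)} {τ : I} (hτ : 0 < τ)
    (hH : ∀ᶠ s in 𝓝[<] τ, G s = H) (lb : I → Equiv.Perm (Fin n)) {e ε : ℝ} (hε : 0 < ε)
    (he : ∀ s < τ, cutDist (empiricalGraphon ((G s).comap (lb s))) (g s) ≤ e) :
    cutMetric (empiricalGraphon H).unlabel (g τ).unlabel ≤ e + ε := by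
  have hne : (𝓝[<] τ).NeBot := nhdsLT_neBot_of_exists_lt ⟨0, hτ⟩
  have hgc : ∀ᶠ s in 𝓝[<] τ, dist (g s) (g τ) < ε :=
    ((tendsto_iff_dist_tendsto_zero.1 (hg.tendsto τ)).mono_left
      nhdsWithin_le_nhds).eventually_lt_const hε
  obtain ⟨s, ⟨hs1, hs2⟩, hs3⟩ := ((hH.and hgc).and self_mem_nhdsWithin).exists
  rw [← unlabel_empiricalGraphon_comap H (lb s), ← hs1]
  refine (cutMetric_le _ _).trans ?_
  have := dist_triangle (empiricalGraphon ((G s).comap (lb s))) (g s) (g τ)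
  have h2 : dist (empiricalGraphon ((G s).comap (lb s))) (g s) ≤ e := he s hs3
  exact this.trans (add_le_add h2 hs2.le)

end

/-! ### Good realisations of the clocks -/

/-- The `k`-th point of the grid of mesh `1 / q`. -/
def gridPoint (q k : ℕ) : I := clamp (k / q)

lemma coe_gridPoint {q k : ℕ} (hq : 0 < q) (hk : k ≤ q) : (gridPoint q k : ℝ) = k / q :=
  coe_clamp_of_mem ⟨by positivity, (div_le_one (by exact_mod_cast hq)).2 (by exact_mod_cast hk)⟩

open Classical in
/-- The realisations of the clocks which satisfy all the laws of large numbers needed, up to an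
error `δ`, at the points of a grid. -/
structure GoodClocks (γ C : ℝ) (l m : I → I → I → UnlabelledGraphon → ℝ) (g : I → Graphon)
    (U : ℝ → ℝ → ℝ → ℝ) (ρ : ℝ → ℝ) (δ : ℝ) (q : ℕ) {n : ℕ} (z : Clocks n) :
    Prop where
  regular : RegularClocks z
  age : ∀ k < q, ageDiscrepancy γ (gridPoint q k) (vertexAge z (gridPoint q k)) ≤ δ
  rings : ∀ k < q, (∑ a, if PairRings (gridPoint q k) (gridPoint q (k + 1)) z a then (1 : ℝ) else 0)
    ≤ (n : ℝ) ^ 2 * δ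
  codegree : ∀ k < q, ∑ i, ∑ i', (∑ j, edgeFluct C l m g U (gridPoint q k) i j z *
    edgeFluct C l m g U (gridPoint q k) i' j z) ^ 2 ≤ (n : ℝ) ^ 4 * δ ^ 4
  doubtful : ∀ k < q, (∑ a, if PairDoubtful C l m g ρ (gridPoint q k) z a then (1 : ℝ) else 0) ≤
    (n : ℝ) ^ 2 * (2 * (∫ y in (0 : ℝ)..gridPoint q k, 2 * ρ y) + δ)

lemma exists_gridPoint {q : ℕ} (hq : 0 < q) (t : I) :
    ∃ k < q, gridPoint q k ≤ t ∧ t ≤ gridPoint q (k + 1) := by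
  have hq' : (0 : ℝ) < q := by exact_mod_cast hq
  by_cases ht : t = 1
  · refine ⟨q - 1, by omega, ht ▸ le_one', ?_⟩
    have e : q - 1 + 1 = q := by omega
    rw [e, ← Subtype.coe_le_coe, coe_gridPoint hq le_rfl, div_self hq'.ne']
    exact t.2.2
  · have ht1 : (t : ℝ) < 1 := lt_of_le_of_ne t.2.2 fun h => ht (Subtype.ext h)
    have h0 : 0 ≤ (q : ℝ) * t := mul_nonneg hq'.le t.2.1
    have hk : ⌊(q : ℝ) * t⌋₊ < q := by
      rw [Nat.floor_lt h0]
      nlinarith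
    refine ⟨⌊(q : ℝ) * t⌋₊, hk, ?_, ?_⟩
    · rw [← Subtype.coe_le_coe, coe_gridPoint hq hk.le, div_le_iff₀ hq', mul_comm (t : ℝ)]
      exact Nat.floor_le h0
    · rw [← Subtype.coe_le_coe, coe_gridPoint hq hk, le_div_iff₀ hq', mul_comm]
      push_cast
      exact (Nat.lt_floor_add_one _).le

lemma gridPoint_succ_sub {q k : ℕ} (hq : 0 < q) (hk : k < q) :
    (gridPoint q (k + 1) : ℝ) - gridPoint q k = 1 / q := by
  rw [coe_gridPoint hq hk, coe_gridPoint hq hk.le]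
  push_cast
  ring

lemma integral_add_exp (L ε a T : ℝ) :
    2 * (∫ y in (0 : ℝ)..T, 2 * (L * (2 * ε + a * Real.exp (4 * L * y)))) =
      8 * L * ε * T + a * (Real.exp (4 * L * T) - 1) := by
  have hd : ∀ y ∈ uIcc (0 : ℝ) T, HasDerivAt
      (fun y => 4 * L * ε * y + a / 2 * Real.exp (4 * L * y))
      (2 * (L * (2 * ε + a * Real.exp (4 * L * y)))) y := fun y _ => by
    have h1 : HasDerivAt (fun y : ℝ => 4 * L * y) (4 * L) y := by
      simpa using (hasDerivAt_id y).const_mul (4 * L)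
    have h2 : HasDerivAt (fun y : ℝ => 4 * L * ε * y) (4 * L * ε) y := by
      simpa using (hasDerivAt_id y).const_mul (4 * L * ε)
    refine (h2.add (h1.exp.const_mul (a / 2))).congr_deriv ?_
    ring
  rw [intervalIntegral.integral_eq_sub_of_hasDerivAt hd
    (Continuous.intervalIntegrable (by fun_prop) _ _)]
  simp
  ring

section
variable {γ C : ℝ} {lam mu : Rate} {g : I → Graphon} {U : ℝ → ℝ → ℝ → ℝ}

open Classical in
/-- On good realisations of the clocks the graph process stays close to the limit. This is a discrete
Grönwall argument along the grid. If the error was at most `a exp (4 L s)` at all earlier times `s`,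
the rates were off by at most `ρ s`, so up to `δ` a proportion `2 ∫ 2 ρ` of the edges differ from the
idealised process, and `ρ` is chosen such that this reproduces the bound. -/
lemma GoodClocks.cutDist_le (hγ : 0 < γ) {d : ProbabilityMeasure I → ProbabilityMeasure I → ℝ}
    {L : ℝ} (hL : 0 < L)
    (hlam : ∀ t t' u u' v v' F F' h h', |lam t u v F h - lam t' u' v' F' h'| ≤
      L * (dist t t' + dist u u' + dist v v' + d F F' + cutMetric h h'))
    (hmu : ∀ t t' u u' v v' F F' h h', |mu t u v F h - mu t' u' v' F' h'| ≤
      L * (dist t t' + dist u u' + dist v v' + d F F' + cutMetric h h'))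
    {n : ℕ} [NeZero n] {z : Clocks n} {G : I → SimpleGraph (Fin n)}
    (hU : IsProfile γ (fun t u v c => lam t u v (limitLaw hγ t) c)
      (fun t u v c => mu t u v (limitLaw hγ t) c) g U)
    {ε η δ δ' a : ℝ} {q : ℕ} (hq : 0 < q) (hε : 0 < ε) (hη : 0 < η) (hδ : 0 ≤ δ)
    (ha : a = (8 * L + 2) * ε)
    (hz : GoodClocks γ C (fun t u v c => lam t u v (limitLaw hγ t) c)
      (fun t u v c => mu t u v (limitLaw hγ t) c) g U
      (fun τ => L * (2 * ε + a * Real.exp (4 * L * τ))) δ q z)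
    (hmod : ∀ s t b b' c c' : I, |U s b b' - U t c c'| ≤
      ε + (|(s : ℝ) - t| + |(b : ℝ) - c| + |(b' : ℝ) - c'|) / η)
    (hemp : ∀ (X : Fin n → I) (lb : Equiv.Perm (Fin n)) (t : I),
      ∫ x : I, |(X (lb (block n x)) : ℝ) - limitAge γ t x| ≤ δ' →
        d (empirical X) (limitLaw hγ t) < ε)
    (hδ' : 2 * δ + 2 / q ≤ δ')
    (hbase : 4 * δ + 1 / n + ε + (1 / q + 2 * δ') / η ≤ 2 * ε)
    (hG : FollowsDynamics lam mu C z G) (lb : I → Equiv.Perm (Fin n))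
    (hlb : ∀ t, Monotone fun k => vertexAge z t (lb t k)) (t : I) :
    cutDist (empiricalGraphon ((G t).comap (lb t))) (g t) ≤ a * Real.exp (4 * L * t) := by
  have hn : (0 : ℝ) < n := Nat.cast_pos.2 (NeZero.pos n)
  have hn2 : (0 : ℝ) < (n : ℝ) ^ 2 := by positivity
  have hq' : (0 : ℝ) < q := by exact_mod_cast hq
  have ha0 : 0 ≤ a := by rw [ha]; positivity
  set l : I → I → I → UnlabelledGraphon → ℝ := fun t u v c => lam t u v (limitLaw hγ t) c with hl
  set m : I → I → I → UnlabelledGraphon → ℝ := fun t u v c => mu t u v (limitLaw hγ t) c with hm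
  set ρ : ℝ → ℝ := fun τ => L * (2 * ε + a * Real.exp (4 * L * τ)) with hρ
  have hg := hU.continuous hγ
  have hrings : ∀ k < q, ∀ t : I, t ≤ gridPoint q (k + 1) →
      (∑ a, if PairRings (gridPoint q k) t z a then (1 : ℝ) else 0) ≤ (n : ℝ) ^ 2 * δ := by
    intro k hk t ht
    refine le_trans (Finset.sum_le_sum fun a _ => ?_) (hz.rings k hk)
    have hsub : PairRings (gridPoint q k) t z a →
        PairRings (gridPoint q k) (gridPoint q (k + 1)) z a := by
      have h : ∀ w : ℕ → ℝ × ℝ, HasRing (gridPoint q k) t w →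
          HasRing (gridPoint q k) (gridPoint q (k + 1)) w := fun w ⟨i, h1, h2⟩ =>
        ⟨i, h1, h2.trans ht⟩
      exact Or.imp (h _) (Or.imp (h _) (Or.imp (h _) (h _)))
    by_cases h : PairRings (gridPoint q k) t z a
    · rw [if_pos h, if_pos (hsub h)]
    · rw [if_neg h]; split_ifs <;> norm_num
  -- the ages are close to their limit law at all times
  have hκ : ∀ t, ageDiscrepancy γ t (vertexAge z t) ≤ δ' := by
    intro t
    obtain ⟨k, hk, hk1, hk2⟩ := exists_gridPoint hq t
    have h := ageDiscrepancy_le hγ hk1 z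
      (fun v => (n : ℝ)⁻¹ * ∑ j, if PairRings (gridPoint q k) t z (v, j) then (1 : ℝ) else 0)
      (fun v => mul_nonneg (inv_pos.2 hn).le
        (Finset.sum_nonneg fun j _ => by split_ifs <;> norm_num))
      (fun v hv => by
        have : ∀ j, PairRings (gridPoint q k) t z (v, j) := fun j => Or.inl hv
        simp only [this, if_true, Finset.sum_const, Finset.card_univ, Fintype.card_fin,
          nsmul_eq_mul, mul_one]
        rw [inv_mul_cancel₀ hn.ne'])
    have hr := hrings k hk t hk2
    rw [Fintype.sum_prod_type] at hr
    rw [← Finset.mul_sum, ← mul_assoc] at h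
    have e : (n : ℝ)⁻¹ * (n : ℝ)⁻¹ * (∑ v, ∑ j, if PairRings (gridPoint q k) t z (v, j)
        then (1 : ℝ) else 0) ≤ δ := by
      calc _ ≤ (n : ℝ)⁻¹ * (n : ℝ)⁻¹ * ((n : ℝ) ^ 2 * δ) :=
            mul_le_mul_of_nonneg_left hr (by positivity)
        _ = δ := by field_simp
    have ht : (t : ℝ) - gridPoint q k ≤ 1 / q := by
      rw [← gridPoint_succ_sub hq hk]
      exact sub_le_sub_right (Subtype.coe_le_coe.2 hk2) _
    have hage := hz.age k hk
    have : (2 : ℝ) / q = 2 * (1 / q) := by ring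
    linarith
  have hd : ∀ t, d (empirical (vertexAge z t)) (limitLaw hγ t) < ε := fun t =>
    hemp _ (lb t) t ((integral_abs_age_sub hγ t _ (lb t) (hlb t)).trans_le (hκ t))
  have hstep : ∀ k < q, (∀ s < gridPoint q k,
      cutDist (empiricalGraphon ((G s).comap (lb s))) (g s) ≤ a * Real.exp (4 * L * s)) →
      ∀ t, gridPoint q k ≤ t → t ≤ gridPoint q (k + 1) →
      cutDist (empiricalGraphon ((G t).comap (lb t))) (g t) ≤ a * Real.exp (4 * L * t) := by
    intro k hk hprev t hk1 hk2
    set T := gridPoint q k with hT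
    have hrate : ∀ {r : Rate} (_ : ∀ t t' u u' v v' F F' h h', |r t u v F h - r t' u' v' F' h'| ≤
        L * (dist t t' + dist u u' + dist v v' + d F F' + cutMetric h h')) (i j : Fin n) (τ : I),
        0 < τ → τ ≤ T → ∀ H, (∀ᶠ s in 𝓝[<] τ, G s = H) →
        |currentRate r z τ H i j - threshold (fun t u v c => r t u v (limitLaw hγ t) c) g
          (vertexBirth z τ i) (vertexBirth z τ j) τ| ≤ ρ τ := by
      intro r hr i j τ hτ0 hτ H hH
      have h1 := abs_currentRate_sub_le (z := z) (g := g) hγ hr τ H i j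
      have h2 := cutMetric_leftLimit_le hg hτ0 hH lb hε (e := a * Real.exp (4 * L * τ))
        fun s hs => (hprev s (hs.trans_le hτ)).trans (by
          have : (s : ℝ) ≤ τ := Subtype.coe_le_coe.2 hs.le
          gcongr)
      refine h1.trans ?_
      simp only [hρ]
      refine mul_le_mul_of_nonneg_left ?_ hL.le
      linarith [hd τ]
    have hmis : (∑ p : Fin n × Fin n, if p.1 ≠ p.2 ∧ ¬ ((G T).Adj p.1 p.2 ↔
        edgeState C l m g T z p.1 p.2) then (1 : ℝ) else 0) ≤
        (n : ℝ) ^ 2 * (2 * (∫ y in (0 : ℝ)..T, 2 * ρ y) + δ) := by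
      refine le_trans (Finset.sum_le_sum fun p _ => ?_) (hz.doubtful k hk)
      by_cases h : p.1 ≠ p.2 ∧ ¬ ((G T).Adj p.1 p.2 ↔ edgeState C l m g T z p.1 p.2)
      · have hdoubt : PairDoubtful C l m g ρ T z p := by
          by_contra hno
          exact h.2 (hG.adj_iff_of_not_doubtful hz.regular h.1 T (hrate hlam p.1 p.2)
            (hrate hmu p.1 p.2) hno)
        rw [if_pos h, if_pos hdoubt]
      · rw [if_neg h]; split_ifs <;> norm_num
    have hmain := cutDist_graph_le (C := C) hγ hU hG hk1 (lb t) (hlb t) hε.le hη hδ hmod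
      (hz.codegree k hk) (hκ t)
    refine hmain.trans ?_
    have hr := hrings k hk t hk2
    have hI : 2 * (∫ y in (0 : ℝ)..T, 2 * ρ y) =
        8 * L * ε * T + a * (Real.exp (4 * L * T) - 1) := integral_add_exp L ε a T
    have hsum : ((n : ℝ) ^ 2)⁻¹ * (2 * (∑ a, if PairRings T t z a then (1 : ℝ) else 0) +
        ∑ p : Fin n × Fin n, if p.1 ≠ p.2 ∧ ¬ ((G T).Adj p.1 p.2 ↔
          edgeState C l m g T z p.1 p.2) then (1 : ℝ) else 0) ≤
        2 * δ + (8 * L * ε * T + a * (Real.exp (4 * L * T) - 1) + δ) := by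
      rw [inv_mul_le_iff₀ hn2, ← hI]
      linarith
    have htT : (t : ℝ) - T ≤ 1 / q := by
      rw [← gridPoint_succ_sub hq hk]
      exact sub_le_sub_right (Subtype.coe_le_coe.2 hk2) _
    have hlast : ((t : ℝ) - T + 2 * δ') / η ≤ (1 / q + 2 * δ') / η :=
      div_le_div_of_nonneg_right (by linarith) hη.le
    have hexp : a * Real.exp (4 * L * T) ≤ a * Real.exp (4 * L * t) := by
      have : (T : ℝ) ≤ t := Subtype.coe_le_coe.2 hk1
      gcongr
    have hT1 : 8 * L * ε * T ≤ 8 * L * ε * 1 := mul_le_mul_of_nonneg_left T.2.2 (by positivity)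
    have ha' : a = 8 * L * ε + 2 * ε := by rw [ha]; ring
    linarith
  -- induction over the grid
  have hall : ∀ k ≤ q, ∀ s < gridPoint q k,
      cutDist (empiricalGraphon ((G s).comap (lb s))) (g s) ≤ a * Real.exp (4 * L * s) := by
    intro k
    induction k with
    | zero =>
      intro _ s hs
      have : (s : ℝ) < gridPoint q 0 := hs
      rw [coe_gridPoint hq (Nat.zero_le q)] at this
      simp only [Nat.cast_zero, zero_div] at this
      exact absurd s.2.1 (not_le.2 this)
    | succ k ih =>
      intro hk s hs
      by_cases h : s < gridPoint q k
      · exact ih (by omega) s h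
      · exact hstep k (by omega) (ih (by omega)) s (not_lt.1 h) hs.le
  obtain ⟨k, hk, hk1, hk2⟩ := exists_gridPoint hq t
  exact hstep k hk (hall k hk.le) t hk1 hk2

end

section
variable {γ C : ℝ} [hγ : Fact (0 < γ)] [hC : Fact (0 < C)] {K : ℝ}
  {l m : I → I → I → UnlabelledGraphon → ℝ} {g : I → Graphon} {U : ℝ → ℝ → ℝ → ℝ}

/-- With high probability a realisation of the clocks is good, by the laws of large numbers at each of
the `q` grid points. -/
lemma prob_not_goodClocks_le (hl : TameRate l K) (hm : TameRate m K)
    (hlC : ∀ t u v h, l t u v h ≤ C) (hmC : ∀ t u v h, m t u v h ≤ C)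
    (hU : IsProfile γ l m g U) {ρ : ℝ → ℝ} (hρ : Continuous ρ) (hρ0 : ∀ y, 0 ≤ ρ y)
    {δ : ℝ} (hδ : 0 < δ) {q : ℕ} (hq : 0 < q) (hqδ : 2 * (γ + C) * (1 / q) ≤ δ / 2)
    (n : ℕ) [NeZero n] :
    (clocksLaw γ C n).real {z | ¬ GoodClocks γ C l m g U ρ δ q z} ≤
      q * (1 / (√n * δ) + (4 / (n * (δ / 2) ^ 2) + (2 / (n * δ ^ 4) + 4 / (n * δ ^ 2)))) := by
  classical
  have hn := NeZero.pos n
  set A : ℕ → Set (Clocks n) := fun k =>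
    {z | δ < ageDiscrepancy γ (gridPoint q k) (vertexAge z (gridPoint q k))} ∪
    ({z | (n : ℝ) ^ 2 * (2 * (γ + C) * (gridPoint q (k + 1) - gridPoint q k) + δ / 2) <
      ∑ a : Fin n × Fin n, if PairRings (gridPoint q k) (gridPoint q (k + 1)) z a
        then (1 : ℝ) else 0} ∪
    ({z | (n : ℝ) ^ 4 * δ ^ 4 < ∑ i, ∑ i', (∑ j, edgeFluct C l m g U (gridPoint q k) i j z *
      edgeFluct C l m g U (gridPoint q k) i' j z) ^ 2} ∪
    {z | (n : ℝ) ^ 2 * (2 * (∫ y in (0 : ℝ)..gridPoint q k, 2 * ρ y) + δ) <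
      ∑ a : Fin n × Fin n, if PairDoubtful C l m g ρ (gridPoint q k) z a then (1 : ℝ) else 0})) with hA
  have hAk : ∀ k < q, (clocksLaw γ C n).real (A k) ≤
      1 / (√n * δ) + (4 / (n * (δ / 2) ^ 2) + (2 / (n * δ ^ 4) + 4 / (n * δ ^ 2))) := by
    intro k hk
    have hkk : (gridPoint q k : ℝ) ≤ gridPoint q (k + 1) := by
      have := gridPoint_succ_sub hq hk
      have h2 : (0 : ℝ) ≤ 1 / q := by positivity
      linarith
    refine (measureReal_union_le _ _).trans (add_le_add
      (prob_ageDiscrepancy_gt_le (γ := γ) (C := C) _ hδ)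
      ((measureReal_union_le _ _).trans (add_le_add ?_ ((measureReal_union_le _ _).trans
        (add_le_add (prob_codegree_gt_le hl hm hlC hmC hU _ hn hδ)
          (prob_pairDoubtful_gt_le hl hm (hU.continuous hγ.out) hρ hρ0 hn _ hδ))))))
    exact prob_pairRings_gt_le hn (gridPoint q k).2.1 hkk (gridPoint q (k + 1)).2.2 (half_pos hδ)
  have hsub : {z : Clocks n | ¬ GoodClocks γ C l m g U ρ δ q z} ⊆
      {z | ¬ RegularClocks z} ∪ ⋃ k ∈ Finset.range q, A k := by
    intro z hz
    by_contra hno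
    simp only [mem_union, mem_iUnion, Finset.mem_range, not_or, not_exists] at hno
    obtain ⟨hreg, hA'⟩ := hno
    have hAz : ∀ k < q, z ∉ A k := fun k hk => hA' k hk
    simp only [hA, mem_union, not_or] at hAz
    refine hz ⟨not_not.1 hreg, fun k hk => not_lt.1 (hAz k hk).1, fun k hk => ?_,
      fun k hk => not_lt.1 (hAz k hk).2.2.1, fun k hk => ?_⟩
    · have h := (hAz k hk).2.1
      rw [mem_ofPred_eq, not_lt, gridPoint_succ_sub hq hk] at h
      convert h.trans (mul_le_mul_of_nonneg_left (show _ ≤ δ by linarith) (by positivity))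
    · have h := (hAz k hk).2.2.2
      rw [mem_ofPred_eq, not_lt] at h
      convert h
  have hreg : (clocksLaw γ C n).real {z | ¬ RegularClocks z} = 0 := by
    rw [measureReal_def]
    have : clocksLaw γ C n {z | ¬ RegularClocks z} = 0 := ae_regularClocks (γ := γ) (C := C)
    rw [this]; rfl
  calc _ ≤ (clocksLaw γ C n).real ({z | ¬ RegularClocks z} ∪ ⋃ k ∈ Finset.range q, A k) :=
        measureReal_mono hsub
    _ ≤ 0 + ∑ k ∈ Finset.range q, (clocksLaw γ C n).real (A k) :=
        (measureReal_union_le _ _).trans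
          (add_le_add hreg.le (measureReal_biUnion_finset_le _ _))
    _ ≤ ∑ _k ∈ Finset.range q, (1 / (√n * δ) +
          (4 / (n * (δ / 2) ^ 2) + (2 / (n * δ ^ 4) + 4 / (n * δ ^ 2)))) := by
        rw [zero_add]
        exact Finset.sum_le_sum fun k hk => hAk k (Finset.mem_range.1 hk)
    _ = _ := by rw [Finset.sum_const, Finset.card_range, nsmul_eq_mul]

end

/-! ### Convergence in distribution -/

/-- Convergence in probability to a constant implies convergence in distribution, for random
variables on varying probability spaces with values in a pseudo-emetric space. -/
lemma tendstoInDistribution_of_tendsto_prob {E : Type*} [PseudoEMetricSpace E] [MeasurableSpace E]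
    [BorelSpace E] {Ω : ℕ → Type*} [∀ n, MeasurableSpace (Ω n)] {P : ∀ n, Measure (Ω n)}
    [∀ n, IsProbabilityMeasure (P n)] {Y : ∀ n, Ω n → E} (hY : ∀ n, AEMeasurable (Y n) (P n))
    (c : E) (h : ∀ ε : ℝ≥0, 0 < ε →
      Tendsto (fun n => (P n).real {ω | ¬ edist (Y n ω) c ≤ ε}) atTop (𝓝 0)) :
    TendstoInDistribution Y atTop (fun _ : Unit => c) P (Measure.dirac ()) := by
  refine ⟨hY, aemeasurable_const, ?_⟩
  refine tendsto_iff_forall_lipschitz_integral_tendsto.2 ?_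
  rintro F ⟨M, hM⟩ ⟨L, hL⟩
  have hF := hL.continuous.measurable
  have hM0 : 0 ≤ M := dist_nonneg.trans (hM c c)
  simp only [ProbabilityMeasure.coe_mk]
  have hlim : ∫ y, F y ∂((Measure.dirac ()).map fun _ : Unit => c) = F c := by
    rw [Measure.map_dirac' measurable_const, integral_dirac' _ _ hF.stronglyMeasurable]
  have hdiff : ∀ n, ∫ y, F y ∂((P n).map (Y n)) - F c = ∫ ω, (F (Y n ω) - F c) ∂(P n) := by
    intro n
    rw [integral_map (hY n) hF.aestronglyMeasurable, integral_sub _ (integrable_const _)]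
    · simp
    · refine Integrable.of_bound (hF.comp_aemeasurable (hY n)).aestronglyMeasurable
        (‖F c‖ + M) (ae_of_all _ fun ω => ?_)
      have := hM (Y n ω) c
      rw [dist_eq_norm] at this
      linarith [norm_sub_norm_le (F (Y n ω)) (F c)]
  -- the Lipschitz bound within distance `ε` of `c`, and the bound `M` elsewhere
  have hle : ∀ (ε : ℝ≥0) (n : ℕ), |∫ y, F y ∂((P n).map (Y n)) - F c| ≤
      L * ε + M * (P n).real {ω | ¬ edist (Y n ω) c ≤ ε} := by
    intro ε n
    have hB : MeasurableSet {y : E | ¬ edist y c ≤ ε} :=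
      (isClosed_le (continuous_id.edist continuous_const) continuous_const).measurableSet.compl
    have hB' : NullMeasurableSet {ω | ¬ edist (Y n ω) c ≤ ε} (P n) :=
      (hY n).nullMeasurableSet_preimage hB
    rw [hdiff]
    refine (abs_integral_le_integral_abs).trans ?_
    have hint : Integrable ({ω | ¬ edist (Y n ω) c ≤ ε}.indicator fun _ => M) (P n) :=
      (integrable_const M).indicator₀ hB'
    calc ∫ ω, |F (Y n ω) - F c| ∂(P n)
        ≤ ∫ ω, (L * ε + {ω | ¬ edist (Y n ω) c ≤ ε}.indicator (fun _ => M) ω) ∂(P n) := by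
          refine integral_mono_of_nonneg (ae_of_all _ fun ω => abs_nonneg _)
            ((integrable_const _).add hint) (ae_of_all _ fun ω => ?_)
          beta_reduce
          by_cases hω : edist (Y n ω) c ≤ ε
          · rw [indicator_of_notMem (not_not.2 hω), add_zero, ← Real.dist_eq]
            have := (hL (Y n ω) c).trans (mul_le_mul_right hω (L : ℝ≥0∞))
            rw [edist_nndist, ← ENNReal.coe_mul, ENNReal.coe_le_coe] at this
            exact_mod_cast this
          · rw [indicator_of_mem (show ω ∈ {ω | ¬ edist (Y n ω) c ≤ ε} from hω), ← Real.dist_eq]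
            have := hM (Y n ω) c
            have h0 : (0 : ℝ) ≤ L * ε := by positivity
            linarith
      _ = L * ε + M * (P n).real {ω | ¬ edist (Y n ω) c ≤ ε} := by
          rw [integral_add (integrable_const _) hint, integral_indicator₀ hB',
            setIntegral_const, integral_const]
          simp [mul_comm]
  rw [hlim, Metric.tendsto_atTop]
  intro ε hε
  have hε1 : 0 < ε / (2 * (L + 1)) := by positivity
  lift ε / (2 * (L + 1)) to ℝ≥0 using hε1.le with κ hκ
  obtain ⟨N, hN⟩ := Metric.tendsto_atTop.1 (h κ (by exact_mod_cast hε1))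
    (ε / (2 * (M + 1))) (by positivity)
  refine ⟨N, fun n hn => ?_⟩
  have h1 := hN n hn
  rw [Real.dist_eq, sub_zero, abs_of_nonneg measureReal_nonneg] at h1
  rw [Real.dist_eq]
  refine (hle κ n).trans_lt ?_
  have h2 : (L : ℝ) * κ ≤ ε / 2 := by
    rw [hκ, ← mul_div_assoc, div_le_div_iff₀ (by positivity) two_pos]
    nlinarith [L.coe_nonneg]
  have h3 : M * (ε / (2 * (M + 1))) < ε / 2 := by
    rw [← mul_div_assoc, div_lt_div_iff₀ (by positivity) two_pos]
    nlinarith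
  have h4 := mul_le_mul_of_nonneg_left h1.le hM0
  linarith

/-- The Skorokhod distance is at most the uniform distance. -/
lemma Skorokhod.edist_le {E : Type*} [PseudoMetricSpace E] {f g : Skorokhod E} {r : ℝ≥0∞}
    (h : ∀ t, edist (f t) (g t) ≤ r) : edist f g ≤ r := by
  refine iInf_le_of_le (OrderIso.refl I) (max_le ?_ (iSup_le h))
  simp

/-- A continuous path, as an element of the Skorokhod space. -/
def Skorokhod.ofContinuous {E : Type*} [TopologicalSpace E] {f : I → E} (hf : Continuous f) :
    Skorokhod E where
  toFun := f
  right_cont _ := hf.continuousWithinAt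
  left_lim t := ⟨f t, hf.continuousAt.mono_left nhdsWithin_le_nhds⟩

section
variable {Ω : Type*} [MeasurableSpace Ω] {P : Measure Ω} {n : ℕ} [NeZero n] {γ C : ℝ}
  [Fact (0 < γ)] [Fact (0 < C)] {lam mu : Rate} {Z : Clock n → ℕ → Ω → ℝ × ℝ}
  {G : Ω → I → SimpleGraph (Fin n)} {lab : Ω → I → Equiv.Perm (Fin n)}
  {Y : Ω → Skorokhod Graphon}

/-- The clocks of the graph process have the product law. -/
lemma IsLabelledGraphonProcess.hasLaw (h : IsLabelledGraphonProcess P γ C lam mu Z G lab Y) :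
    HasLaw (fun ω c k => Z c k ω) (clocksLaw γ C n) P := by
  have hm : AEMeasurable (fun ω (p : Clock n × ℕ) => Z p.1 p.2 ω) P :=
    aemeasurable_pi_iff.2 fun p => (h.law p.1 p.2).aemeasurable
  have h1 := h.indep.hasLaw_infinitePi
    (μ := fun p : Clock n × ℕ => waitLaw (p.1.rate γ C)) (fun p => h.law p.1 p.2) hm
  refine ⟨(MeasurableEquiv.curry (Clock n) ℕ (ℝ × ℝ)).measurable.comp_aemeasurable hm, ?_⟩
  have h2 := Measure.infinitePi_map_curry
    (fun (c : Clock n) (_ : ℕ) => waitLaw (c.rate γ C))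
  rw [← h1.map_eq, AEMeasurable.map_map_of_aemeasurable
    (MeasurableEquiv.measurable _).aemeasurable hm] at h2
  refine h2.trans ?_
  rw [Measure.infinitePi_eq_pi]
  rfl

open Classical in
/-- With high probability the labelled graphon process is uniformly close to the limit. -/
lemma IsLabelledGraphonProcess.prob_edist_gt_le [IsProbabilityMeasure P]
    (h : IsLabelledGraphonProcess P γ C lam mu Z G lab Y) {g : Skorokhod Graphon} {r : ℝ≥0}
    {p : Clocks n → Prop}
    (hp : ∀ z G, p z → FollowsDynamics lam mu C z G → ∀ lb : I → Equiv.Perm (Fin n),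
      (∀ t, Monotone fun k => vertexAge z t (lb t k)) → ∀ t,
      cutDist (empiricalGraphon ((G t).comap (lb t))) (g t) ≤ r) :
    P.real {ω | ¬ edist (Y ω) g ≤ r} ≤ (clocksLaw γ C n).real {z | ¬ p z} := by
  have hlaw := h.hasLaw
  refine ENNReal.toReal_mono (measure_ne_top _ _) ?_
  rw [← hlaw.map_eq]
  refine le_trans (measure_mono_ae ?_) (Measure.le_map_apply hlaw.aemeasurable _)
  filter_upwards [h.dynamics, h.labelling, h.graphon] with ω h1 h2 h3 hω hz
  refine hω (Skorokhod.edist_le fun t => ?_)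
  rw [edist_dist, h3 t, ENNReal.ofReal_le_coe]
  exact hp _ _ hz h1 _ h2 t
end

section
variable {γ C : ℝ} [hγ : Fact (0 < γ)] [hC : Fact (0 < C)] {lam mu : Rate}

/-- The labelled graphon processes converge in probability, uniformly in time, to the limit. -/
lemma tendsto_prob_edist_gt {d : ProbabilityMeasure I → ProbabilityMeasure I → ℝ}
    (hd : MetrizesWeak d) (hlam : IsRate d lam) (hmu : IsRate d mu) {K : ℝ}
    (hl : TameRate (fun t u v c => lam t u v (limitLaw hγ.out t) c) K)
    (hm : TameRate (fun t u v c => mu t u v (limitLaw hγ.out t) c) K)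
    (hlC : ∀ t u v F h, lam t u v F h ≤ C) (hmC : ∀ t u v F h, mu t u v F h ≤ C)
    {g : Skorokhod Graphon} {U : ℝ → ℝ → ℝ → ℝ}
    (hU : IsProfile γ (fun t u v c => lam t u v (limitLaw hγ.out t) c)
      (fun t u v c => mu t u v (limitLaw hγ.out t) c) g U)
    {Ω : ℕ → Type*} [∀ n, MeasurableSpace (Ω n)] {P : ∀ n, Measure (Ω n)}
    [∀ n, IsProbabilityMeasure (P n)] {Z : ∀ n, Clock (n + 1) → ℕ → Ω n → ℝ × ℝ}
    {G : ∀ n, Ω n → I → SimpleGraph (Fin (n + 1))}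
    {lab : ∀ n, Ω n → I → Equiv.Perm (Fin (n + 1))} {Y : ∀ n, Ω n → Skorokhod Graphon}
    (h : ∀ n, IsLabelledGraphonProcess (P n) γ C lam mu (Z n) (G n) (lab n) (Y n))
    {r : ℝ≥0} (hr : 0 < r) :
    Tendsto (fun n => (P n).real {ω | ¬ edist (Y n ω) g ≤ r}) atTop (𝓝 0) := by
  obtain ⟨L₁, hL₁, hlip₁⟩ := hlam.exists_lipschitz hd
  obtain ⟨L₂, hL₂, hlip₂⟩ := hmu.exists_lipschitz hd
  set L := L₁ + L₂ + 1 with hLdef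
  have hL : 0 < L := by positivity
  have hnn : ∀ (t t' u u' v v' : I) F F' h h',
      0 ≤ dist t t' + dist u u' + dist v v' + d F F' + cutMetric h h' := by
    intro _ _ _ _ _ _ F F' h h'
    have := hd.nonneg F F'
    have := cutMetric_nonneg h h'
    positivity
  have hlip₁' : ∀ t t' u u' v v' F F' h h', |lam t u v F h - lam t' u' v' F' h'| ≤
      L * (dist t t' + dist u u' + dist v v' + d F F' + cutMetric h h') :=
    fun t t' u u' v v' F F' h h' => (hlip₁ t t' u u' v v' F F' h h').trans
      (mul_le_mul_of_nonneg_right (by linarith) (hnn ..))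
  have hlip₂' : ∀ t t' u u' v v' F F' h h', |mu t u v F h - mu t' u' v' F' h'| ≤
      L * (dist t t' + dist u u' + dist v v' + d F F' + cutMetric h h') :=
    fun t t' u u' v v' F F' h h' => (hlip₂ t t' u u' v v' F F' h h').trans
      (mul_le_mul_of_nonneg_right (by linarith) (hnn ..))
  have hr' : (0 : ℝ) < r := hr
  -- the error at time `t` will be at most `(8 L + 2) ε exp (4 L t)`
  set ε : ℝ := r / ((8 * L + 2) * Real.exp (4 * L)) with hεdef
  have hε : 0 < ε := by positivity
  obtain ⟨η, hη, hmod⟩ := hU.exists_modulus hε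
  obtain ⟨δ₀, hδ₀, hemp⟩ := exists_dist_empirical_lt hγ.out hd hε
  -- `δ'` bounds the discrepancy of the ages, `δ` the deviations in the laws of large numbers at the
  -- grid points, and the grid has mesh `1 / q`; they are chosen such that the error terms add up to `ε`
  set δ' := min δ₀ (ε * η / 8) with hδ'def
  have hδ'0 : 0 < δ' := lt_min hδ₀ (by positivity)
  set δ := min (δ' / 4) (ε / 16) with hδdef
  have hδ : 0 < δ := lt_min (by positivity) (by positivity)
  have hγ0 := hγ.out
  have hC0 := hC.out
  obtain ⟨q, hq⟩ := exists_nat_gt (max (max (4 / δ') (4 / (ε * η))) (4 * (γ + C) / δ))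
  obtain ⟨⟨hq1, hq2⟩, hq3⟩ : (4 / δ' < q ∧ 4 / (ε * η) < q) ∧ 4 * (γ + C) / δ < q :=
    ⟨max_lt_iff.1 (max_lt_iff.1 hq).1, (max_lt_iff.1 hq).2⟩
  have hq' : (0 : ℝ) < q := lt_trans (by positivity) hq1
  have hq0 : 0 < q := by exact_mod_cast hq'
  have hδδ' : 2 * δ + 2 / q ≤ δ' := by
    have h1 : δ ≤ δ' / 4 := min_le_left _ _
    have h2 : 2 / (q : ℝ) ≤ δ' / 2 := by
      rw [div_lt_iff₀ hδ'0] at hq1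
      rw [div_le_div_iff₀ hq' two_pos]
      linarith
    linarith
  have hqδ : 2 * (γ + C) * (1 / q) ≤ δ / 2 := by
    rw [div_lt_iff₀ hδ] at hq3
    rw [mul_one_div, div_le_div_iff₀ hq' two_pos]
    linarith
  have hrest : 4 * δ + (1 / q + 2 * δ') / η ≤ 3 * ε / 4 := by
    have h1 : δ ≤ ε / 16 := min_le_right _ _
    have h2 : δ' ≤ ε * η / 8 := min_le_right _ _
    have h3 : (1 : ℝ) / q ≤ ε * η / 4 := by
      rw [div_lt_iff₀ (by positivity)] at hq2
      rw [div_le_div_iff₀ hq' (by norm_num)]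
      linarith
    have h4 : (1 / q + 2 * δ') / η ≤ ε / 2 := by
      rw [div_le_iff₀ hη]
      linarith
    linarith
  set a : ℝ := (8 * L + 2) * ε with ha
  have har : a * Real.exp (4 * L) = r := by
    rw [ha, hεdef]
    field_simp
  set ρ : ℝ → ℝ := fun τ => L * (2 * ε + a * Real.exp (4 * L * τ)) with hρdef
  have hρ : Continuous ρ := by fun_prop
  have hρ0 : ∀ y, 0 ≤ ρ y := fun y => by
    simp only [hρdef]
    positivity
  set bound : ℕ → ℝ := fun n => q * (1 / (√(n : ℝ) * δ) + (4 / (n * (δ / 2) ^ 2) +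
    (2 / (n * δ ^ 4) + 4 / (n * δ ^ 2)))) with hbound
  have hlimit : Tendsto (fun n : ℕ => bound (n + 1)) atTop (𝓝 0) := by
    have hinv : ∀ c e : ℝ, 0 < e → Tendsto (fun n : ℕ => c / ((n : ℝ) * e)) atTop (𝓝 0) :=
      fun c e he => tendsto_const_nhds.div_atTop
        (tendsto_natCast_atTop_atTop.atTop_mul_const he)
    have hsqrt : Tendsto (fun n : ℕ => 1 / (√(n : ℝ) * δ)) atTop (𝓝 0) :=
      tendsto_const_nhds.div_atTop
        ((Real.tendsto_sqrt_atTop.comp tendsto_natCast_atTop_atTop).atTop_mul_const hδ)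
    have := (hsqrt.add ((hinv 4 ((δ / 2) ^ 2) (by positivity)).add
      ((hinv 2 (δ ^ 4) (by positivity)).add (hinv 4 (δ ^ 2) (by positivity))))).const_mul (q : ℝ)
    simp only [add_zero, mul_zero] at this
    exact this.comp (tendsto_add_atTop_nat 1)
  obtain ⟨N, hN⟩ := exists_nat_gt (4 / ε)
  refine squeeze_zero' (Eventually.of_forall fun n => measureReal_nonneg) ?_ hlimit
  filter_upwards [eventually_ge_atTop N] with n hn
  refine le_trans ?_ (prob_not_goodClocks_le hl hm (fun t u v c => hlC t u v _ c)
    (fun t u v c => hmC t u v _ c) hU hρ hρ0 hδ hq0 hqδ (n + 1))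
  refine (h n).prob_edist_gt_le fun z G hz hG lb hlb t => ?_
  have hn' : 1 / ((n + 1 : ℕ) : ℝ) ≤ ε / 4 := by
    have : (N : ℝ) ≤ n := by exact_mod_cast hn
    rw [div_lt_iff₀ hε] at hN
    push_cast
    rw [div_le_div_iff₀ (by positivity) (by norm_num)]
    nlinarith
  refine (hz.cutDist_le hγ0 hL hlip₁' hlip₂' hU hq0 hε hη hδ.le ha hmod
    (fun X lb t hX => hemp _ X lb t (hX.trans (min_le_left _ _))) hδδ' (by linarith) hG lb hlb
    t).trans ?_
  have ht : 4 * L * (t : ℝ) ≤ 4 * L := mul_le_of_le_one_right (by positivity) t.2.2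
  have ha0 : 0 ≤ a := by positivity
  calc a * Real.exp (4 * L * t) ≤ a * Real.exp (4 * L) := by gcongr
    _ = r := har

end

end AgeGraphon

end

theorem mainTheorem8
    (γ : ℝ) (hγ : 0 < γ)
    (d : ProbabilityMeasure I → ProbabilityMeasure I → ℝ) (hd : AgeGraphon.MetrizesWeak d)
    (lam mu : AgeGraphon.Rate)
    (hlam : AgeGraphon.IsRate d lam) (hmu : AgeGraphon.IsRate d mu) :
    ∃ Fstar : I → ProbabilityMeasure I,
      (∀ t x : I, ((Fstar t {z : I | z ≤ x} : ℝ≥0) : ℝ) =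
        if x < t then 1 - Real.exp (-γ * x) else 1) ∧
      ∃ g : AgeGraphon.Skorokhod AgeGraphon.Graphon,
        AgeGraphon.SolvesGraphonEquation lam mu Fstar g ∧
        (∀ g' : I → AgeGraphon.Graphon,
          AgeGraphon.SolvesGraphonEquation lam mu Fstar g' → g' = g) ∧
        ∀ (C : ℝ), 0 < C →
          (∀ t u v F h, lam t u v F h ≤ C) → (∀ t u v F h, mu t u v F h ≤ C) →
          ∀ (Ω : ℕ → Type*) [∀ n, MeasurableSpace (Ω n)]
            (P : ∀ n, Measure (Ω n)) [∀ n, IsProbabilityMeasure (P n)]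
            (Z : ∀ n, AgeGraphon.Clock (n + 1) → ℕ → Ω n → ℝ × ℝ)
            (G : ∀ n, Ω n → I → SimpleGraph (Fin (n + 1)))
            (lab : ∀ n, Ω n → I → Equiv.Perm (Fin (n + 1)))
            (Y : ∀ n, Ω n → AgeGraphon.Skorokhod AgeGraphon.Graphon),
            (∀ n, AgeGraphon.IsLabelledGraphonProcess (P n) γ C lam mu
              (Z n) (G n) (lab n) (Y n)) →
            TendstoInDistribution Y atTop (fun _ : Unit => g) P (Measure.dirac ()) := by
  obtain ⟨K₁, hl⟩ := hlam.tame hd (AgeGraphon.continuous_limitLaw hγ)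
  obtain ⟨K₂, hm⟩ := hmu.tame hd (AgeGraphon.continuous_limitLaw hγ)
  have hK : 0 < max 1 (max K₁ K₂) := lt_max_of_lt_left one_pos
  have hl' := hl.mono ((le_max_left K₁ K₂).trans (le_max_right 1 _))
  have hm' := hm.mono ((le_max_right K₁ K₂).trans (le_max_right 1 _))
  obtain ⟨g, U, hU⟩ := AgeGraphon.exists_isProfile hγ hl' hm' hK
  refine ⟨AgeGraphon.limitLaw hγ, AgeGraphon.limitLaw_cdf hγ,
    AgeGraphon.Skorokhod.ofContinuous (hU.continuous hγ), hU.solves hγ, fun g' hg' =>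
    hg'.unique (AgeGraphon.minAge_limitLaw_le hγ) hl' hm' hK (hU.solves hγ), ?_⟩
  intro C hC hlC hmC Ω _ P _ Z G lab Y hY
  have : Fact (0 < γ) := ⟨hγ⟩
  have : Fact (0 < C) := ⟨hC⟩
  exact AgeGraphon.tendstoInDistribution_of_tendsto_prob (fun n => (hY n).measurable) _
    fun r hr => AgeGraphon.tendsto_prob_edist_gt hd hlam hmu hl' hm' hlC hmC hU hY hr
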